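/- Let $M$ be a smooth real $n$-manifold, $V\to M$ a smooth real vector bundle of rank $n$ and $\nabla$ a flat connection on $V$, with dual connection $\nabla^\vee$ on $V^\vee$. Let $\pi\colon X=\mathrm{tot}(V)\to M$ and $\hat\pi\colon\hat X=\mathrm{tot}(V^\vee)\to M$ be the total spaces. A generalized almost complex structure on a real vector bundle $W$ is a smooth bundle automorphism $\mathcal K$ of $W\oplus W^\vee$ with $\mathcal K^2=-1$ that is orthogonal for the pairing $\langle v+f,w+g\rangle=-\tfrac12(f(w)+g(v))$; on a manifold $N$ it means one on $T_N$, and it is integrable (a generalized complex structure) if the sheaf of sections of its $(+i)$-eigenbundle in $(T_N\oplus T_N^\vee)\otimes\mathbb C$ is closed under the Courant bracket $$[X+\xi,Y+\eta]=[X,Y]+\mathcal L_X\eta-\mathcal L_Y\xi+\tfrac12 d(\iota_Y\xi-\iota_X\eta).$$ The connection splits the sequence $0\to\pi^*V\xrightarrow{j}T_X\xrightarrow{d\pi}\pi^*T_M\to0$: let $D=(\pi^*\nabla)(S)\colon T_X\to\pi^*V$, with $S$ the tautological section of $\pi^*V$, and let $\alpha\colon\pi^*T_M\to T_X$ be the map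 with $D\alpha=0$, $d\pi\,\alpha=1$. Let $$F\colon T_X\oplus T_X^\vee\to\pi^*(V\oplus T_M\oplus V^\vee\oplus T_M^\vee),\qquad F(Y+\eta)=(DY,\ d\pi\,Y,\ j^\vee\eta,\ \alpha^\vee\eta),$$ and let $\hat F$ be the same isomorphism for $(V^\vee,\nabla^\vee)$ on $\hat X$, with $V^{\vee\vee}=V$. A generalized almost complex structure $\mathcal K$ on $V\oplus T_M$ is adapted if $\mathcal K(V\oplus V^\vee)=T_M\oplus T_M^\vee$. A $\nabla$-semi-flat generalized almost complex structure on $X$ is one of the form $\mathcal J=F^{-1}(\pi^*\mathcal K)F$ with $\mathcal K$ adapted; $\nabla^\vee$-semi-flat structures on $\hat X$ are defined likewise from $(V^\vee,\nabla^\vee)$. For an endomorphism $\mathcal K$ of $V\oplus T_M\oplus V^\vee\oplus T_M^\vee$ let $\hat{\mathcal K}$ be the endomorphism of $V^\vee\oplus T_M\oplus V\oplus T_M^\vee$ obtained from it by exchanging the summands $V$ and $V^\vee$ fibrewise. Then for every adapted generalized almost complex structure $\mathcal K$ on $V\oplus T_M$ the structure $\mathcal J=F^{-1}(\pi^*\mathcal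 K)F$ on $X$ is $\nabla$-semi-flat, its mirror $\hat{\mathcal J}=\hat F^{-1}(\hat\pi^*\hat{\mathcal K})\hat F$ on $\hat X$ is $\nabla^\vee$-semi-flat, and $\mathcal J$ is integrable if and only if $\hat{\mathcal J}$ is integrable. Consequently $\mathcal J\mapsto\hat{\mathcal J}$ is a well-defined bijection from the set of $\nabla$-semi-flat generalized complex structures on $X$ onto the set of $\nabla^\vee$-semi-flat generalized complex structures on $\hat X$. -/

import Mathlib

open Bundle Set VectorField
open scoped Manifold ContDiff Topology

set_option linter.unusedSectionVars false

noncomputable section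

namespace GenGeom

/-! ### Generalized almost complex structures on a vector bundle -/

section Linear

variable {B : Type*}

/-- The fibres `V x →L[ℝ] ℝ` of the dual bundle. -/
abbrev DualBundle (V : B → Type*) [∀ x, AddCommGroup (V x)] [∀ x, Module ℝ (V x)]
    [∀ x, TopologicalSpace (V x)] : B → Type _ :=
  fun x => V x →L[ℝ] ℝ

/-- The fibres of `V ⊕ V^∨`. -/
abbrev GenBundle (V : B → Type*) [∀ x, AddCommGroup (V x)] [∀ x, Module ℝ (V x)]
    [∀ x, TopologicalSpace (V x)] : B → Type _ :=
  fun x => V x × (V x →L[ℝ] ℝ)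

/-- The standard pairing `⟨v + f, w + g⟩ = -(f(w) + g(v)) / 2`. -/
def pairing {W : Type*} [AddCommGroup W] [Module ℝ W] [TopologicalSpace W]
    (a b : W × (W →L[ℝ] ℝ)) : ℝ :=
  -(1 / 2) * (a.2 b.1 + b.2 a.1)

/-- A (not necessarily smooth) family of linear endomorphisms of the fibres of `V ⊕ V^∨`. -/
abbrev GenEnd (V : B → Type*) [∀ x, AddCommGroup (V x)] [∀ x, Module ℝ (V x)]
    [∀ x, TopologicalSpace (V x)] : Type _ :=
  ∀ x, Module.End ℝ (GenBundle V x)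

end Linear

section Smooth

variable {E : Type*} [NormedAddCommGroup E] [NormedSpace ℝ E]
  {H : Type*} [TopologicalSpace H] (I : ModelWithCorners ℝ E H)
  {M : Type*} [TopologicalSpace M] [ChartedSpace H M]
  (F : Type*) [NormedAddCommGroup F] [NormedSpace ℝ F]
  {V : M → Type*} [∀ x, AddCommGroup (V x)] [∀ x, Module ℝ (V x)]
  [TopologicalSpace (TotalSpace F V)] [∀ x, TopologicalSpace (V x)]
  [∀ x, IsTopologicalAddGroup (V x)] [∀ x, ContinuousSMul ℝ (V x)]
  [FiberBundle F V] [VectorBundle ℝ F V]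

/-- `J` is a generalized almost complex structure on the vector bundle `V`: a smooth bundle
endomorphism of `V ⊕ V^∨`, orthogonal for the standard pairing, with `J² = -1`. -/
structure IsGenAlmostComplex (J : GenEnd V) : Prop where
  smooth : ContMDiff (I.prod 𝓘(ℝ, F × (F →L[ℝ] ℝ))) (I.prod 𝓘(ℝ, F × (F →L[ℝ] ℝ))) ∞
    (fun e : TotalSpace (F × (F →L[ℝ] ℝ)) (GenBundle V) =>
      (⟨e.1, J e.1 e.2⟩ : TotalSpace (F × (F →L[ℝ] ℝ)) (GenBundle V)))
  orthogonal : ∀ x (a b : GenBundle V x), pairing (J x a) (J x b) = pairing a b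
  sq_eq_neg_one : ∀ x (a : GenBundle V x), J x (J x a) = -a

/-- `a` restricts to a smooth section of `V ⊕ V^∨` over `U`. -/
def SmoothGenSectionOn (a : ∀ x, GenBundle V x) (U : Set M) : Prop :=
  ContMDiffOn I (I.prod 𝓘(ℝ, F × (F →L[ℝ] ℝ))) ∞
    (fun x => (⟨x, a x⟩ : TotalSpace (F × (F →L[ℝ] ℝ)) (GenBundle V))) U

end Smooth

/-! ### The Courant bracket and integrability -/

section Courant

variable {E : Type*} [NormedAddCommGroup E] [NormedSpace ℝ E] [FiniteDimensional ℝ E]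
  {H : Type*} [TopologicalSpace H] (I : ModelWithCorners ℝ E H)
  {N : Type*} [TopologicalSpace N] [ChartedSpace H N] [IsManifold I ∞ N]

/-- The expression `(L_X η)(W) = X(η(W)) - η([X, W])` at the point `p`. -/
def lieDerivAux (X : ∀ p : N, TangentSpace I p) (η : ∀ p : N, TangentSpace I p →L[ℝ] ℝ) (p : N)
    (W : ∀ p : N, TangentSpace I p) : ℝ :=
  mvfderiv I (fun q => η q (W q)) p (X p) - η p (mlieBracket I X W p)

theorem tensorialAt_lieDerivAux (X : ∀ p : N, TangentSpace I p)
    (η : ∀ p : N, TangentSpace I p →L[ℝ] ℝ) (p : N)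
    (hη : MDifferentiableAt I (I.prod 𝓘(ℝ, E →L[ℝ] ℝ))
      (fun q => (⟨q, η q⟩ : TotalSpace (E →L[ℝ] ℝ)
        (DualBundle (TangentSpace I : N → Type _)))) p) :
    TensorialAt I E (lieDerivAux I X η p) p where
  smul {f W} hf hW := by
    have h : MDifferentiableAt I 𝓘(ℝ, ℝ) (fun q => η q (W q)) p := by
      have := MDifferentiableAt.clm_bundle_apply (F₂ := ℝ) (E₂ := Bundle.Trivial N ℝ) hη hW
      exact ((mdifferentiableAt_totalSpace I _).1 this).2
    have e : (fun q => η q ((f • W) q)) = f * fun q => η q (W q) := by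
      ext q; simp
    simp only [lieDerivAux, e, mvfderiv_mul hf h, mlieBracket_smul_right hf hW]
    simp
    ring
  add {W W'} hW hW' := by
    have h {W : ∀ p : N, TangentSpace I p}
        (hW : MDifferentiableAt I (I.prod 𝓘(ℝ, E)) (fun q => (⟨q, W q⟩ : TangentBundle I N)) p) :
        MDifferentiableAt I 𝓘(ℝ, ℝ) (fun q => η q (W q)) p := by
      have := MDifferentiableAt.clm_bundle_apply (F₂ := ℝ) (E₂ := Bundle.Trivial N ℝ) hη hW
      exact ((mdifferentiableAt_totalSpace I _).1 this).2
    have e : (fun q => η q ((W + W') q)) = (fun q => η q (W q)) + fun q => η q (W' q) := by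
      ext q; simp
    simp only [lieDerivAux, e, mvfderiv_add (h hW) (h hW'), mlieBracket_add_right hW hW']
    simp
    ring

open Classical in
/-- The Lie derivative `L_X η` of a one-form at `p`, that is, the covector with
`(L_X η)(W) = X(η(W)) - η([X, W])` for every vector field `W`. The right hand side only depends on
`W p` as soon as `η` is differentiable at `p`, see `tensorialAt_lieDerivAux`. -/
def lieDeriv (X : ∀ p : N, TangentSpace I p) (η : ∀ p : N, TangentSpace I p →L[ℝ] ℝ) (p : N) :
    TangentSpace I p →L[ℝ] ℝ :=
  if h : TensorialAt I E (lieDerivAux I X η p) p then TensorialAt.mkHom _ p h else 0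

/-- The Courant bracket of real sections of `T ⊕ T^∨`:
`[X + ξ, Y + η] = [X, Y] + L_X η - L_Y ξ + d(ξ(Y) - η(X)) / 2`. -/
def courant (a b : ∀ p : N, GenBundle (TangentSpace I : N → Type _) p) (p : N) :
    GenBundle (TangentSpace I : N → Type _) p :=
  (mlieBracket I (fun q => (a q).1) (fun q => (b q).1) p,
    lieDeriv I (fun q => (a q).1) (fun q => (b q).2) p
      - lieDeriv I (fun q => (b q).1) (fun q => (a q).2) p
      + (1 / 2 : ℝ) • mvfderiv I (fun q => (a q).2 (b q).1 - (b q).2 (a q).1) p)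

/-- A section `re + i im` of `(T ⊕ T^∨) ⊗ ℂ`, given by its real and imaginary parts. -/
structure ComplexSection where
  re : ∀ p : N, GenBundle (TangentSpace I : N → Type _) p
  im : ∀ p : N, GenBundle (TangentSpace I : N → Type _) p

variable {I}

/-- The `ℂ`-bilinear extension of the Courant bracket. -/
def ComplexSection.courant (a b : ComplexSection (N := N) I) : ComplexSection (N := N) I where
  re p := GenGeom.courant I a.re b.re p - GenGeom.courant I a.im b.im p
  im p := GenGeom.courant I a.re b.im p + GenGeom.courant I a.im b.re p

/-- `a` is smooth over `U`. -/
def ComplexSection.SmoothOn (a : ComplexSection (N := N) I) (U : Set N) : Prop :=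
  SmoothGenSectionOn I E a.re U ∧ SmoothGenSectionOn I E a.im U

/-- Over `U`, the section `a` lies in the `(+i)`-eigenbundle of `J`:
`J (re + i im) = i (re + i im)`. -/
def ComplexSection.MemEigenbundleOn (J : GenEnd (TangentSpace I : N → Type _))
    (a : ComplexSection (N := N) I) (U : Set N) : Prop :=
  ∀ p ∈ U, J p (a.re p) = -a.im p ∧ J p (a.im p) = a.re p

/-- The sheaf of sections of the `(+i)`-eigenbundle of `J` is closed under the Courant bracket. -/
def IsIntegrable (J : GenEnd (TangentSpace I : N → Type _)) : Prop :=
  ∀ U : Set N, IsOpen U → ∀ a b : ComplexSection (N := N) I,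
    a.SmoothOn U → b.SmoothOn U → a.MemEigenbundleOn J U → b.MemEigenbundleOn J U →
      (a.courant b).MemEigenbundleOn J U

/-- `J` is a generalized complex structure on the manifold `N`. -/
structure IsGenComplex (J : GenEnd (TangentSpace I : N → Type _)) : Prop where
  almost : IsGenAlmostComplex I E J
  integrable : IsIntegrable J

end Courant

/-! ### Connections -/

section Connection

variable {E : Type*} [NormedAddCommGroup E] [NormedSpace ℝ E]
  {H : Type*} [TopologicalSpace H] {I : ModelWithCorners ℝ E H}
  {M : Type*} [TopologicalSpace M] [ChartedSpace H M] [IsManifold I ∞ M]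
  {F : Type*} [NormedAddCommGroup F] [NormedSpace ℝ F]
  {V : M → Type*} [∀ x, AddCommGroup (V x)] [∀ x, Module ℝ (V x)]
  [TopologicalSpace (TotalSpace F V)] [∀ x, TopologicalSpace (V x)]
  [∀ x, IsTopologicalAddGroup (V x)] [∀ x, ContinuousSMul ℝ (V x)]
  [FiberBundle F V] [VectorBundle ℝ F V]

/-- `cov` is a smooth connection whose curvature
`R(X, Y) s = ∇_X ∇_Y s - ∇_Y ∇_X s - ∇_[X, Y] s` vanishes. Recall that `cov s x (X x)` stands for
`(∇_X s)(x)`. -/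
structure IsFlat (cov : CovariantDerivative I F V) : Prop where
  smooth : CovariantDerivative.ContMDiffCovariantDerivative cov ∞
  curvature_eq_zero : ∀ U : Set M, IsOpen U →
    ∀ (X Y : ∀ x : M, TangentSpace I x) (s : ∀ x : M, V x),
      ContMDiffOn I (I.prod 𝓘(ℝ, E)) ∞ (fun x => (⟨x, X x⟩ : TangentBundle I M)) U →
      ContMDiffOn I (I.prod 𝓘(ℝ, E)) ∞ (fun x => (⟨x, Y x⟩ : TangentBundle I M)) U →
      ContMDiffOn I (I.prod 𝓘(ℝ, F)) ∞ (fun x => (⟨x, s x⟩ : TotalSpace F V)) U →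
      ∀ x ∈ U, cov (fun y => cov s y (Y y)) x (X x) - cov (fun y => cov s y (X y)) x (Y x)
        - cov s x (mlieBracket I X Y x) = 0

theorem mdifferentiableAt_dual_apply {φ : ∀ x : M, DualBundle V x} {s : ∀ x : M, V x} {x : M}
    (hφ : MDifferentiableAt I (I.prod 𝓘(ℝ, F →L[ℝ] ℝ))
      (fun y => (⟨y, φ y⟩ : TotalSpace (F →L[ℝ] ℝ) (DualBundle V))) x)
    (hs : MDifferentiableAt I (I.prod 𝓘(ℝ, F)) (fun y => (⟨y, s y⟩ : TotalSpace F V)) x) :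
    MDifferentiableAt I 𝓘(ℝ, ℝ) (fun y => φ y (s y)) x := by
  have := MDifferentiableAt.clm_bundle_apply (F₂ := ℝ) (E₂ := Bundle.Trivial M ℝ) hφ hs
  exact ((mdifferentiableAt_totalSpace I _).1 this).2

/-- The expression `u ↦ u(φ(s)) - φ(∇_u s)` at the point `x`. -/
def dualCovAux (cov : CovariantDerivative I F V) (φ : ∀ x : M, DualBundle V x) (x : M)
    (s : ∀ x : M, V x) : TangentSpace I x →L[ℝ] ℝ :=
  mvfderiv I (fun y => φ y (s y)) x - (φ x).comp (cov s x)

theorem tensorialAt_dualCovAux (cov : CovariantDerivative I F V) (φ : ∀ x : M, DualBundle V x)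
    (x : M) (hφ : MDifferentiableAt I (I.prod 𝓘(ℝ, F →L[ℝ] ℝ))
      (fun y => (⟨y, φ y⟩ : TotalSpace (F →L[ℝ] ℝ) (DualBundle V))) x) :
    TensorialAt I F (dualCovAux cov φ x) x where
  smul {f s} hf hs := by
    have h := mdifferentiableAt_dual_apply hφ hs
    have e : (fun y => φ y ((f • s) y)) = f * fun y => φ y (s y) := by
      ext y; simp
    ext u
    simp only [dualCovAux, e, mvfderiv_mul hf h, cov.isCovariantDerivativeOnUniv.leibniz hs hf]
    simp
    ring
  add {s s'} hs hs' := by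
    have e : (fun y => φ y ((s + s') y)) = (fun y => φ y (s y)) + fun y => φ y (s' y) := by
      ext y; simp
    ext u
    simp only [dualCovAux, e, mvfderiv_add (mdifferentiableAt_dual_apply hφ hs)
      (mdifferentiableAt_dual_apply hφ hs'), cov.isCovariantDerivativeOnUniv.add hs hs']
    simp
    ring

variable [FiniteDimensional ℝ E] [FiniteDimensional ℝ F] [ContMDiffVectorBundle ∞ F V I]

/-- Exchange of the two arguments of a bilinear map, one of them in a tangent space. -/
def flipTangent {x : M} {W : Type*} [AddCommGroup W] [Module ℝ W] [TopologicalSpace W]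
    (L : W →L[ℝ] (TangentSpace I x →L[ℝ] ℝ)) : TangentSpace I x →L[ℝ] (W →L[ℝ] ℝ) :=
  haveI : FiniteDimensional ℝ (TangentSpace I x) := inferInstanceAs (FiniteDimensional ℝ E)
  haveI : T2Space (TangentSpace I x) := inferInstanceAs (T2Space E)
  LinearMap.toContinuousLinearMap
    { toFun u :=
        { toFun := fun w => L w u
          map_add' := by simp
          map_smul' := by simp
          cont := (continuous_eval_const u).comp L.continuous }
      map_add' u v := by ext; simp
      map_smul' c u := by ext; simp }

theorem flipTangent_apply {x : M} {W : Type*} [AddCommGroup W] [Module ℝ W] [TopologicalSpace W]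
    (L : W →L[ℝ] (TangentSpace I x →L[ℝ] ℝ)) (u : TangentSpace I x) (w : W) :
    flipTangent L u w = L w u := rfl

open Classical in
/-- The dual connection, `(∇^∨_u φ)(s) = u(φ(s)) - φ(∇_u s)` for every section `s`. -/
def dualConnection (cov : CovariantDerivative I F V) :
    CovariantDerivative I (F →L[ℝ] ℝ) (DualBundle V) where
  toFun φ x :=
    if h : TensorialAt I F (dualCovAux cov φ x) x then flipTangent (TensorialAt.mkHom _ x h) else 0
  isCovariantDerivativeOnUniv :=
    { add := by
        intro φ ψ x hφ hψ _
        have hs (v : V x) := FiberBundle.mdifferentiableAt_extend I F v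
        rw [dif_pos (tensorialAt_dualCovAux cov _ x hφ), dif_pos (tensorialAt_dualCovAux cov _ x hψ),
          dif_pos (tensorialAt_dualCovAux cov _ x (mdifferentiableAt_add_section hφ hψ))]
        ext u v
        have e : (fun y => (φ + ψ) y (FiberBundle.extend F v y))
            = (fun y => φ y (FiberBundle.extend F v y)) + fun y => ψ y (FiberBundle.extend F v y) := by
          ext y; simp
        simp only [flipTangent_apply, TensorialAt.mkHom_apply_eq_extend, dualCovAux, e,
          mvfderiv_add (mdifferentiableAt_dual_apply hφ (hs v))
            (mdifferentiableAt_dual_apply hψ (hs v)), add_apply]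
        simp
        ring
      leibniz := by
        intro φ g x hφ hg _
        have hs (v : V x) := FiberBundle.mdifferentiableAt_extend I F v
        rw [dif_pos (tensorialAt_dualCovAux cov _ x hφ),
          dif_pos (tensorialAt_dualCovAux cov _ x (hg.smul_section hφ))]
        ext u v
        have e : (fun y => (g • φ) y (FiberBundle.extend F v y))
            = g * fun y => φ y (FiberBundle.extend F v y) := by
          ext y; simp
        simp only [flipTangent_apply, TensorialAt.mkHom_apply_eq_extend, dualCovAux, e,
          mvfderiv_mul hg (mdifferentiableAt_dual_apply hφ (hs v)), add_apply]
        simp [flipTangent_apply, TensorialAt.mkHom_apply_eq_extend, dualCovAux]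
        ring }

end Connection

/-! ### The splitting of the tangent bundle of a total space and the lift -/

section Splitting

variable {E : Type*} [NormedAddCommGroup E] [NormedSpace ℝ E]
  {H : Type*} [TopologicalSpace H] (I : ModelWithCorners ℝ E H)
  {M : Type*} [TopologicalSpace M] [ChartedSpace H M]
  {F : Type*} [NormedAddCommGroup F] [NormedSpace ℝ F]
  {V : M → Type*} [∀ x, AddCommGroup (V x)] [∀ x, Module ℝ (V x)]
  [TopologicalSpace (TotalSpace F V)] [∀ x, TopologicalSpace (V x)]
  [∀ x, IsTopologicalAddGroup (V x)] [∀ x, ContinuousSMul ℝ (V x)]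
  [FiberBundle F V] [VectorBundle ℝ F V]

/-- The fibres of `V ⊕ T_M`. -/
abbrev SumTangent (V : M → Type*) : M → Type _ := fun x => V x × TangentSpace I x

/-- The tangent spaces of the total space `X = tot(V)`. -/
abbrev TotTangent (F : Type*) [NormedAddCommGroup F] [NormedSpace ℝ F] (V : M → Type*)
    [∀ x, AddCommGroup (V x)] [∀ x, Module ℝ (V x)]
    [TopologicalSpace (TotalSpace F V)] [∀ x, TopologicalSpace (V x)]
    [FiberBundle F V] : TotalSpace F V → Type _ :=
  TangentSpace (I.prod 𝓘(ℝ, F))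

/-- The differential `dπ : T_X → π^* T_M` of the projection, at `p`. -/
def projDeriv (p : TotalSpace F V) : TotTangent I F V p →L[ℝ] TangentSpace I p.1 :=
  mfderiv (I.prod 𝓘(ℝ, F)) I (TotalSpace.proj : TotalSpace F V → M) p

/-- The inclusion `j : π^* V → T_X` of the vertical vectors, at `p`: the differential of the
inclusion of the fibre through `p`, the fibre being parametrized by `F` through a linear
trivialization. -/
def vertical (p : TotalSpace F V) : V p.1 →L[ℝ] TotTangent I F V p :=
  let e := trivializationAt F V p.1
  (mfderiv 𝓘(ℝ, F) (I.prod 𝓘(ℝ, F)) (fun ξ : F => (⟨p.1, e.symm p.1 ξ⟩ : TotalSpace F V))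
    (e p).2).comp (e.continuousLinearMapAt ℝ p.1)

variable {I}

/-- The map `D = (π^* ∇)(S) : T_X → π^* V` at `p`, where `S` is the tautological section of
`π^* V`. In a trivialization with constant frame `e_i` and fibre coordinates `ξ_i` one has
`S = ∑ ξ_i π^* e_i`, whence `D = ∑ dξ_i π^* e_i + ξ_i π^* (∇ e_i)`. The section
`FiberBundle.extend F p.2` is the combination of the `e_i` with the constant coefficients
`ξ_i(p)`. -/
def connForm (cov : CovariantDerivative I F V) (p : TotalSpace F V) :
    TotTangent I F V p →L[ℝ] V p.1 :=
  let e := trivializationAt F V p.1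
  (e.symmL ℝ p.1).comp (mvfderiv (I.prod 𝓘(ℝ, F)) (fun q : TotalSpace F V => (e q).2) p)
    + (cov (FiberBundle.extend F p.2) p.1).comp (projDeriv I p)

/-- The horizontal lift `α : π^* T_M → T_X` at `p`, the splitting with `dπ ∘ α = 1` and
`D ∘ α = 0`: for a section `s` through `p` it is `α(u) = ds(u) - j(∇_u s)`. -/
def horizontal (cov : CovariantDerivative I F V) (p : TotalSpace F V) :
    TangentSpace I p.1 →L[ℝ] TotTangent I F V p :=
  let s := FiberBundle.extend F p.2
  let ds : TangentSpace I p.1 →L[ℝ] TotTangent I F V p :=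
    mfderiv I (I.prod 𝓘(ℝ, F)) (fun y : M => (⟨y, s y⟩ : TotalSpace F V)) p.1
  ds - (vertical I p).comp (cov s p.1)

/-! The identities `D ∘ j = 1`, `dπ ∘ j = 0`, `D ∘ α = 0`, `dπ ∘ α = 1`. -/

section Identities

variable [IsManifold I ∞ M] [ContMDiffVectorBundle ∞ F V I]

variable (cov : CovariantDerivative I F V) (p : TotalSpace F V)

theorem mdifferentiableAt_fibreCoord : MDifferentiableAt (I.prod 𝓘(ℝ, F)) 𝓘(ℝ, F)
    (fun q : TotalSpace F V => ((trivializationAt F V p.1) q).2) p := by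
  have h := (Bundle.Trivialization.contMDiffOn (n := ∞) (IB := I) (trivializationAt F V p.1)) p
    (FiberBundle.mem_trivializationAt_proj_source)
  have h2 := (h.contMDiffAt ((trivializationAt F V p.1).open_source.mem_nhds
    (FiberBundle.mem_trivializationAt_proj_source))).mdifferentiableAt (by simp)
  exact mdifferentiableAt_snd.comp p h2

theorem mk_symm_fibreCoord : (⟨p.1, (trivializationAt F V p.1).symm p.1
    ((trivializationAt F V p.1) p).2⟩ : TotalSpace F V) = p := by
  have := FiberBundle.extend_apply_self F p.2
  simp only [FiberBundle.extend] at this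
  exact congrArg (TotalSpace.mk p.1) this

theorem mdifferentiableAt_fibre (ξ : F) : MDifferentiableAt 𝓘(ℝ, F) (I.prod 𝓘(ℝ, F))
    (fun ξ : F => (⟨p.1, (trivializationAt F V p.1).symm p.1 ξ⟩ : TotalSpace F V)) ξ := by
  rw [mdifferentiableAt_totalSpace]
  refine ⟨mdifferentiableAt_const, ?_⟩
  simp only [Trivialization.apply_mk_symm, FiberBundle.mem_baseSet_trivializationAt']
  exact mdifferentiableAt_id

theorem mdifferentiableAt_extend : MDifferentiableAt I (I.prod 𝓘(ℝ, F))
    (fun y : M => (⟨y, FiberBundle.extend F p.2 y⟩ : TotalSpace F V)) p.1 :=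
  haveI : ContMDiffVectorBundle 1 F V I := ContMDiffVectorBundle.of_le (n := ∞) (by simp)
  FiberBundle.mdifferentiableAt_extend I F p.2

theorem mk_extend : (⟨p.1, FiberBundle.extend F p.2 p.1⟩ : TotalSpace F V) = p := by simp

theorem projDeriv_vertical (v : V p.1) : projDeriv I p (vertical I p v) = 0 := by
  have h1 := mdifferentiableAt_fibre (I := I) p ((trivializationAt F V p.1) p).2
  have h2 : MDifferentiableAt (I.prod 𝓘(ℝ, F)) I (TotalSpace.proj : TotalSpace F V → M)
    (⟨p.1, (trivializationAt F V p.1).symm p.1 ((trivializationAt F V p.1) p).2⟩ : TotalSpace F V) :=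
    (contMDiffAt_proj (n := ∞) V).mdifferentiableAt (by simp)
  have h := mfderiv_comp_apply (f := fun ξ : F => (⟨p.1, (trivializationAt F V p.1).symm p.1 ξ⟩ : TotalSpace F V)) _ h2 h1 ((trivializationAt F V p.1).continuousLinearMapAt ℝ p.1 v)
  have e : ((TotalSpace.proj : TotalSpace F V → M) ∘ fun ξ : F =>
    (⟨p.1, (trivializationAt F V p.1).symm p.1 ξ⟩ : TotalSpace F V)) = fun _ => p.1 := rfl
  rw [e, mfderiv_const] at h
  rw [mk_symm_fibreCoord] at h
  exact h.symm

theorem connForm_vertical (v : V p.1) : connForm cov p (vertical I p v) = v := by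
  have h1 := mdifferentiableAt_fibre (I := I) p ((trivializationAt F V p.1) p).2
  have h2 := mdifferentiableAt_fibreCoord (I := I) p
  have h := mfderiv_comp_apply_of_eq (f := fun ξ : F => (⟨p.1, (trivializationAt F V p.1).symm p.1 ξ⟩ : TotalSpace F V)) _ h2 h1 (mk_symm_fibreCoord p) ((trivializationAt F V p.1).continuousLinearMapAt ℝ p.1 v)
  have e : ((fun q : TotalSpace F V => ((trivializationAt F V p.1) q).2) ∘ fun ξ : F =>
    (⟨p.1, (trivializationAt F V p.1).symm p.1 ξ⟩ : TotalSpace F V)) = id := by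
    ext ξ; simp [Trivialization.apply_mk_symm, FiberBundle.mem_baseSet_trivializationAt']
  rw [e] at h
  have h' : (trivializationAt F V p.1).continuousLinearMapAt ℝ p.1 v =
      mvfderiv (I.prod 𝓘(ℝ, F)) (fun q : TotalSpace F V => ((trivializationAt F V p.1) q).2) p
        (vertical I p v) := by
    refine Eq.trans ?_ h
    rw [mfderiv_id]; rfl
  simp only [connForm, add_apply, ContinuousLinearMap.comp_apply, projDeriv_vertical,
    map_zero, add_zero, ← h']
  exact Trivialization.symmL_continuousLinearMapAt _ (FiberBundle.mem_baseSet_trivializationAt' p.1) v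

theorem projDeriv_extend (u : TangentSpace I p.1) : projDeriv I p
    (mfderiv I (I.prod 𝓘(ℝ, F)) (fun y : M => (⟨y, FiberBundle.extend F p.2 y⟩ : TotalSpace F V)) p.1 u) = u := by
  have h1 := mdifferentiableAt_extend (I := I) p
  have h2 : MDifferentiableAt (I.prod 𝓘(ℝ, F)) I (TotalSpace.proj : TotalSpace F V → M)
    (⟨p.1, FiberBundle.extend F p.2 p.1⟩ : TotalSpace F V) :=
    (contMDiffAt_proj (n := ∞) V).mdifferentiableAt (by simp)
  have h := mfderiv_comp_apply (f := fun y : M => (⟨y, FiberBundle.extend F p.2 y⟩ : TotalSpace F V)) _ h2 h1 u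
  have e : ((TotalSpace.proj : TotalSpace F V → M) ∘ fun y : M => (⟨y, FiberBundle.extend F p.2 y⟩ : TotalSpace F V)) = id := rfl
  rw [e, mfderiv_id] at h
  rw [mk_extend] at h
  exact h.symm

theorem fibreCoord_extend (u : TangentSpace I p.1) : mvfderiv (I.prod 𝓘(ℝ, F)) (fun q : TotalSpace F V => ((trivializationAt F V p.1) q).2) p
    (mfderiv I (I.prod 𝓘(ℝ, F)) (fun y : M => (⟨y, FiberBundle.extend F p.2 y⟩ : TotalSpace F V)) p.1 u) = 0 := by
  have h1 := mdifferentiableAt_extend (I := I) p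
  have h2 := mdifferentiableAt_fibreCoord (I := I) p
  have h := mfderiv_comp_apply_of_eq (f := fun y : M => (⟨y, FiberBundle.extend F p.2 y⟩ : TotalSpace F V)) _ h2 h1 (mk_extend p) u
  have e : ((fun q : TotalSpace F V => ((trivializationAt F V p.1) q).2) ∘ fun y : M => (⟨y, FiberBundle.extend F p.2 y⟩ : TotalSpace F V)) =ᶠ[nhds p.1] fun _ => ((trivializationAt F V p.1) p).2 := by
    filter_upwards [(trivializationAt F V p.1).open_baseSet.mem_nhds (FiberBundle.mem_baseSet_trivializationAt' p.1)] with y hy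
    simp [FiberBundle.extend, Trivialization.apply_mk_symm, hy]
  rw [e.mfderiv_eq, mfderiv_const] at h
  exact h.symm

theorem projDeriv_horizontal (u : TangentSpace I p.1) : projDeriv I p (horizontal cov p u) = u := by
  have := projDeriv_extend (I := I) p u
  have h2 := projDeriv_vertical (I := I) p (cov (FiberBundle.extend F p.2) p.1 u)
  unfold horizontal
  refine (map_sub (projDeriv I p) _ _).trans ?_
  exact (congrArg₂ (· - ·) this h2).trans (sub_zero u)

theorem connForm_horizontal (u : TangentSpace I p.1) : connForm cov p (horizontal cov p u) = 0 := by
  have h1 := projDeriv_extend (I := I) p u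
  have h2 := fibreCoord_extend (I := I) p u
  have h3 := connForm_vertical cov p (cov (FiberBundle.extend F p.2) p.1 u)
  unfold horizontal
  refine (map_sub (connForm cov p) _ _).trans ((congrArg₂ (· - ·) ?_ h3).trans (sub_self _))
  simp only [connForm, add_apply, ContinuousLinearMap.comp_apply]
  refine (congrArg₂ (· + ·) ((congrArg _ h2).trans (map_zero _)) (congrArg _ h1)).trans ?_
  simp
variable [FiniteDimensional ℝ E] [FiniteDimensional ℝ F]

/-- The identity `j ∘ D + α ∘ dπ = 1`. -/
theorem vertical_add_horizontal (y : TotTangent I F V p) :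
    vertical I p (connForm cov p y) + horizontal cov p (projDeriv I p y) = y := by
  let L : TotTangent I F V p →ₗ[ℝ] V p.1 × TangentSpace I p.1 :=
    ((connForm cov p).prod (projDeriv I p)).toLinearMap
  have hL (a : V p.1) (b : TangentSpace I p.1) :
      L (vertical I p a + horizontal cov p b) = (a, b) := by
    simp [L, connForm_vertical, projDeriv_vertical, connForm_horizontal, projDeriv_horizontal]
  have : FiniteDimensional ℝ (V p.1) := VectorBundle.finiteDimensional ℝ F V p.1
  have : FiniteDimensional ℝ (TangentSpace I p.1) := inferInstanceAs (FiniteDimensional ℝ E)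
  have : FiniteDimensional ℝ (TotTangent I F V p) := inferInstanceAs (FiniteDimensional ℝ (E × F))
  have hdim : Module.finrank ℝ (TotTangent I F V p)
      = Module.finrank ℝ (V p.1 × TangentSpace I p.1) := by
    have h₁ : Module.finrank ℝ (V p.1) = Module.finrank ℝ F :=
      (VectorBundle.continuousLinearEquivAt ℝ F V p.1).toLinearEquiv.finrank_eq
    have h₂ : Module.finrank ℝ (TangentSpace I p.1) = Module.finrank ℝ E := rfl
    have h₃ : Module.finrank ℝ (TotTangent I F V p) = Module.finrank ℝ (E × F) := rfl
    rw [Module.finrank_prod, h₁, h₂, h₃, Module.finrank_prod, add_comm]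
  have hinj : Function.Injective L :=
    (LinearMap.injective_iff_surjective_of_finrank_eq_finrank hdim).2
      fun c => ⟨_, hL c.1 c.2⟩
  exact hinj (hL (connForm cov p y) (projDeriv I p y))

/-- The map `F : T_X ⊕ T_X^∨ → π^*(V ⊕ T_M) ⊕ π^*(V ⊕ T_M)^∨` at `p`, with matrix entries
`D`, `dπ`, `j^∨`, `α^∨`, and its inverse, with matrix entries `j`, `α`, `D^∨`, `dπ^∨`. Here
`(V ⊕ T_M)^∨` stands for `V^∨ ⊕ T_M^∨`. -/
def splitting : GenBundle (TotTangent I F V) p ≃ₗ[ℝ] GenBundle (SumTangent I V) p.1 where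
  toFun a := ((connForm cov p a.1, projDeriv I p a.1),
    a.2.comp ((vertical I p).coprod (horizontal cov p)))
  invFun b := (vertical I p b.1.1 + horizontal cov p b.1.2,
    b.2.comp ((connForm cov p).prod (projDeriv I p)))
  map_add' a b := by ext <;> simp
  map_smul' c a := by ext <;> simp
  left_inv a := by
    refine Prod.ext (vertical_add_horizontal cov p a.1) ?_
    ext y
    exact congrArg a.2 (vertical_add_horizontal cov p y)
  right_inv b := by
    ext <;> simp [connForm_vertical, projDeriv_vertical, connForm_horizontal, projDeriv_horizontal]

/-- `J = F⁻¹ (π^* K) F` on `X = tot(V)`. -/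
def lift (K : GenEnd (SumTangent I V)) : GenEnd (TotTangent I F V) :=
  fun p => (splitting cov p).symm.conj (K p.1)

end Identities

/-- `V ⊕ V^∨` as a subset of `(V ⊕ T_M) ⊕ (V ⊕ T_M)^∨`, at `x`. -/
def fibrePart (V : M → Type*) [∀ x, AddCommGroup (V x)] [∀ x, Module ℝ (V x)]
    [∀ x, TopologicalSpace (V x)] (x : M) : Set (GenBundle (SumTangent I V) x) :=
  {a | a.1.2 = 0 ∧ ∀ u : TangentSpace I x, a.2 (0, u) = 0}

/-- `T_M ⊕ T_M^∨` as a subset of `(V ⊕ T_M) ⊕ (V ⊕ T_M)^∨`, at `x`. -/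
def basePart (V : M → Type*) [∀ x, AddCommGroup (V x)] [∀ x, Module ℝ (V x)]
    [∀ x, TopologicalSpace (V x)] (x : M) : Set (GenBundle (SumTangent I V) x) :=
  {a | a.1.1 = 0 ∧ ∀ v : V x, a.2 (v, 0) = 0}

/-- `K` is adapted: `K(V ⊕ V^∨) = T_M ⊕ T_M^∨`. -/
def IsAdapted (K : GenEnd (SumTangent I V)) : Prop :=
  ∀ x, K x '' fibrePart V x = basePart V x

variable [FiniteDimensional ℝ E] [FiniteDimensional ℝ F] [IsManifold I ∞ M]
  [ContMDiffVectorBundle ∞ F V I]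

/-- `J` is a `∇`-semi-flat generalized almost complex structure on `X = tot(V)`: the connection
`∇` is flat and `J = F⁻¹ (π^* K) F` for an adapted generalized almost complex structure `K` on
`V ⊕ T_M`. -/
structure IsSemiFlat (cov : CovariantDerivative I F V) (J : GenEnd (TotTangent I F V)) : Prop where
  flat : IsFlat cov
  almost : IsGenAlmostComplex (I.prod 𝓘(ℝ, F)) (E × F) J
  lifted : ∃ K : GenEnd (SumTangent I V),
    IsGenAlmostComplex I (F × E) K ∧ IsAdapted K ∧ J = lift cov K

end Splitting

/-! ### The mirror transformation -/

section Evaluation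

variable (W : Type*) [AddCommGroup W] [Module ℝ W] [TopologicalSpace W]
  [IsTopologicalAddGroup W] [ContinuousSMul ℝ W]

/-- The evaluation map `W → W^∨^∨`. -/
def evalMap : W →ₗ[ℝ] ((W →L[ℝ] ℝ) →L[ℝ] ℝ) where
  toFun w :=
    { toFun := fun φ => φ w
      map_add' := by simp
      map_smul' := by simp
      cont := continuous_eval_const w }
  map_add' w w' := by ext; simp
  map_smul' c w := by ext; simp

theorem evalMap_bijective [FiniteDimensional ℝ W] [T2Space W] :
    Function.Bijective (evalMap W) := by
  constructor
  · intro w w' hw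
    rw [← sub_eq_zero, ← Module.forall_dual_apply_eq_zero_iff ℝ]
    intro φ
    rw [map_sub, sub_eq_zero]
    exact DFunLike.congr_fun hw (LinearMap.toContinuousLinearMap φ)
  · intro Ψ
    let Ψ' : Module.Dual ℝ (Module.Dual ℝ W) :=
      { toFun := fun φ => Ψ (LinearMap.toContinuousLinearMap φ)
        map_add' := by simp
        map_smul' := by simp }
    refine ⟨(Module.evalEquiv ℝ W).symm Ψ', ?_⟩
    ext φ
    exact Module.apply_evalEquiv_symm_apply ℝ W φ Ψ'

/-- The canonical identification `W ≃ W^∨^∨`. -/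
def evalEquiv [FiniteDimensional ℝ W] [T2Space W] : W ≃ₗ[ℝ] ((W →L[ℝ] ℝ) →L[ℝ] ℝ) :=
  LinearEquiv.ofBijective (evalMap W) (evalMap_bijective W)

variable (T : Type*) [AddCommGroup T] [Module ℝ T] [TopologicalSpace T]
  [IsTopologicalAddGroup T] [ContinuousSMul ℝ T]

/-- The exchange `W ⊕ T ⊕ W^∨ ⊕ T^∨ ≃ W^∨ ⊕ T ⊕ W ⊕ T^∨` of the summands `W` and `W^∨`, with
`W` identified with `W^∨^∨`. -/
def shuffle [FiniteDimensional ℝ W] [T2Space W] :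
    ((W × T) × (W × T →L[ℝ] ℝ)) ≃ₗ[ℝ]
      (((W →L[ℝ] ℝ) × T) × ((W →L[ℝ] ℝ) × T →L[ℝ] ℝ)) where
  toFun a := ((a.2.comp (.inl ℝ W T), a.1.2),
    (evalEquiv W a.1.1).coprod (a.2.comp (.inr ℝ W T)))
  invFun b := (((evalEquiv W).symm (b.2.comp (.inl ℝ _ T)), b.1.2),
    b.1.1.coprod (b.2.comp (.inr ℝ _ T)))
  map_add' a b := by ext <;> simp
  map_smul' c a := by ext <;> simp
  left_inv a := by ext <;> simp
  right_inv b := by ext <;> simp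

end Evaluation

section Mirror

variable {E : Type*} [NormedAddCommGroup E] [NormedSpace ℝ E]
  {H : Type*} [TopologicalSpace H] {I : ModelWithCorners ℝ E H}
  {M : Type*} [TopologicalSpace M] [ChartedSpace H M]
  (F : Type*) [NormedAddCommGroup F] [NormedSpace ℝ F] [FiniteDimensional ℝ F]
  {V : M → Type*} [∀ x, AddCommGroup (V x)] [∀ x, Module ℝ (V x)]
  [TopologicalSpace (TotalSpace F V)] [∀ x, TopologicalSpace (V x)]
  [∀ x, IsTopologicalAddGroup (V x)] [∀ x, ContinuousSMul ℝ (V x)]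
  [FiberBundle F V] [VectorBundle ℝ F V]

/-- The endomorphism of `(V^∨ ⊕ T_M) ⊕ (V^∨ ⊕ T_M)^∨` obtained from the endomorphism `K` of
`(V ⊕ T_M) ⊕ (V ⊕ T_M)^∨` by exchanging `V` and `V^∨` on each fibre. -/
def mirror (K : GenEnd (SumTangent I V)) : GenEnd (SumTangent I (DualBundle V)) := fun x =>
  haveI : T2Space (V x) := FiberBundle.t2Space F V x
  haveI : FiniteDimensional ℝ (V x) := VectorBundle.finiteDimensional ℝ F V x
  (shuffle (V x) (TangentSpace I x)).conj (K x)

end Mirror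

end GenGeom

end

namespace GenGeom

section Manifold

variable {E : Type*} [NormedAddCommGroup E] [NormedSpace ℝ E] [FiniteDimensional ℝ E]
  {H : Type*} [TopologicalSpace H] {I : ModelWithCorners ℝ E H}
  {N : Type*} [TopologicalSpace N] [ChartedSpace H N] [IsManifold I ∞ N]
  {G : Type*} [NormedAddCommGroup G] [NormedSpace ℝ G]

theorem fderiv_lieBracket {f : E → G} {X Y : E → E} {x : E} (hf : ContDiffAt ℝ 2 f x)
    (hX : DifferentiableAt ℝ X x) (hY : DifferentiableAt ℝ Y x) :
    fderiv ℝ f x (lieBracket ℝ X Y x)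
      = fderiv ℝ (fun y => fderiv ℝ f y (Y y)) x (X x)
        - fderiv ℝ (fun y => fderiv ℝ f y (X y)) x (Y x) := by
  have hf' : DifferentiableAt ℝ (fderiv ℝ f) x :=
    (hf.fderiv_right (m := 1) (by norm_num)).differentiableAt (by simp)
  have hs : IsSymmSndFDerivAt ℝ f x := hf.isSymmSndFDerivAt (by simp)
  rw [fderiv_clm_apply hf' hX, fderiv_clm_apply hf' hY]
  simp only [lieBracket, map_sub, add_apply, ContinuousLinearMap.comp_apply,
    ContinuousLinearMap.flip_apply]
  rw [hs.eq (X x) (Y x)]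
  abel

theorem contMDiffOn_mvfderiv_apply {f : N → G} {Y : ∀ q : N, TangentSpace I q} {U : Set N}
    (hU : IsOpen U) (hf : ContMDiffOn I 𝓘(ℝ, G) ∞ f U)
    (hY : ContMDiffOn I (I.prod 𝓘(ℝ, E)) ∞ (fun q => (⟨q, Y q⟩ : TangentBundle I N)) U) :
    ContMDiffOn I 𝓘(ℝ, G) ∞ (fun q => mvfderiv I f q (Y q)) U := by
  have h1 := hf.contMDiffOn_tangentMapWithin (m := ∞) (by simp) hU.uniqueMDiffOn
  have h2 := h1.comp hY (fun q hq => hq)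
  have h3 := (contMDiff_snd_tangentBundle_modelSpace G 𝓘(ℝ, G) (n := ∞)).comp_contMDiffOn h2
  refine h3.congr fun q hq => ?_
  show mvfderiv I f q (Y q) = mfderivWithin I 𝓘(ℝ, G) f U q (Y q)
  rw [mfderivWithin_of_isOpen hU hq]
  rfl

theorem mvfderiv_mlieBracket [I.Boundaryless] {f : N → G} {X Y : ∀ q : N, TangentSpace I q} {p : N}
    (hf : ContMDiffAt I 𝓘(ℝ, G) 2 f p)
    (hX : MDifferentiableAt I (I.prod 𝓘(ℝ, E)) (fun q => (⟨q, X q⟩ : TangentBundle I N)) p)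
    (hY : MDifferentiableAt I (I.prod 𝓘(ℝ, E)) (fun q => (⟨q, Y q⟩ : TangentBundle I N)) p)
    (hXf : MDifferentiableAt I 𝓘(ℝ, G) (fun q => mvfderiv I f q (X q)) p)
    (hYf : MDifferentiableAt I 𝓘(ℝ, G) (fun q => mvfderiv I f q (Y q)) p) :
    mvfderiv I f p (mlieBracket I X Y p)
      = mvfderiv I (fun q => mvfderiv I f q (Y q)) p (X p)
        - mvfderiv I (fun q => mvfderiv I f q (X q)) p (Y p) := by
  set φ := extChartAt I p with hφ
  have hr : range I = univ := I.range_eq_univ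
  set g : E → G := f ∘ φ.symm with hg
  have hmd (h : N → G) (hh : MDifferentiableAt I 𝓘(ℝ, G) h p) (v : TangentSpace I p) :
      mvfderiv I h p v = fderiv ℝ (h ∘ φ.symm) (φ p) v := by
    rw [hh.mvfderiv, hr, fderivWithin_univ]
    rfl
  have hgd : ContDiffAt ℝ 2 g (φ p) := by
    have := (contMDiffAt_iff.1 hf).2
    rw [hr, contDiffWithinAt_univ] at this
    exact this
  have htar : ∀ᶠ y in 𝓝 (φ p), y ∈ φ.target := by
    have := extChartAt_target_mem_nhds (I := I) p
    exact this
  have hgev : ∀ᶠ y in 𝓝 (φ p), DifferentiableAt ℝ g y :=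
    (hgd.eventually (by decide)).mono fun y hy => hy.differentiableAt (by simp)
  let P (Z : ∀ q : N, TangentSpace I q) : E → E :=
    mpullbackWithin 𝓘(ℝ, E) I φ.symm Z (range I)
  have hP (Z : ∀ q : N, TangentSpace I q) :
      ((fun q => mvfderiv I f q (Z q)) ∘ φ.symm) =ᶠ[𝓝 (φ p)] fun y => fderiv ℝ g y (P Z y) := by
    filter_upwards [htar, hgev] with y hy hgy
    have hsrc : φ.symm y ∈ φ.source := φ.map_target hy
    have e1 : f =ᶠ[𝓝 (φ.symm y)] g ∘ φ := by
      filter_upwards [(isOpen_extChartAt_source (I := I) p).mem_nhds hsrc] with q hq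
      exact (congrArg f ((extChartAt I p).left_inv hq)).symm
    have e2 : MDifferentiableAt I 𝓘(ℝ, E) φ (φ.symm y) :=
      mdifferentiableAt_extChartAt (by simpa [hφ, extChartAt_source] using hsrc)
    have e3 : P Z y = mfderiv I 𝓘(ℝ, E) φ (φ.symm y) (Z (φ.symm y)) := by
      have a1 := mfderiv_extChartAt_comp_mfderivWithin_extChartAt_symm (I := I) hy
      have a2 := mfderivWithin_extChartAt_symm_comp_mfderiv_extChartAt (I := I) hy
      exact congrArg (fun L => L (Z (φ.symm y))) (ContinuousLinearMap.inverse_eq a2 a1)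
    have hgy' : MDifferentiableAt 𝓘(ℝ, E) 𝓘(ℝ, G) g (φ (φ.symm y)) := by
      rw [φ.right_inv hy]; exact hgy.mdifferentiableAt
    have e4 := mfderiv_comp_apply (φ.symm y) hgy' e2 (Z (φ.symm y))
    rw [← e1.mfderiv_eq, φ.right_inv hy, mfderiv_eq_fderiv] at e4
    exact e4.trans (congrArg (fderiv ℝ g y) e3.symm)
  have hPd (Z : ∀ q : N, TangentSpace I q)
      (hZ : MDifferentiableAt I (I.prod 𝓘(ℝ, E)) (fun q => (⟨q, Z q⟩ : TangentBundle I N)) p) :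
      DifferentiableAt ℝ (P Z) (φ p) := by
    have : DifferentiableWithinAt ℝ (P Z) (φ.symm ⁻¹' univ ∩ range I) (φ p) :=
      MDifferentiableWithinAt.differentiableWithinAt_mpullbackWithin_vectorField
        (s := univ) hZ.mdifferentiableWithinAt
    rwa [preimage_univ, hr, univ_inter, differentiableWithinAt_univ] at this
  have hPp (Z : ∀ q : N, TangentSpace I q) : P Z (φ p) = Z p := by
    have := mfderivWithin_extChartAt_symm_inverse_apply (I := I) (Z p)
    refine Eq.trans ?_ this
    have hz : ∀ q, q = p → (Z q : E) = Z p := by rintro _ rfl; rfl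
    exact congrArg (mfderivWithin 𝓘(ℝ, E) I φ.symm (range I) (φ p)).inverse
      (hz _ (extChartAt_to_inv p))
  have hbr : mlieBracket I X Y p = lieBracket ℝ (P X) (P Y) (φ p) := by
    have hid : ContinuousLinearMap.inverse (mfderiv I 𝓘(ℝ, E) φ p : E →L[ℝ] E)
        = ContinuousLinearMap.id ℝ E :=
      (congrArg ContinuousLinearMap.inverse (mfderiv_extChartAt_self (I := I) (x := p) :
        (mfderiv I 𝓘(ℝ, E) φ p : E →L[ℝ] E) = ContinuousLinearMap.id ℝ E)).trans
        ContinuousLinearMap.inverse_id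
    have h := mlieBracketWithin_apply (I := I) (V := X) (W := Y) (s := univ) (x₀ := p)
    rw [mlieBracketWithin_univ] at h
    refine h.trans ((congrArg (fun L : E →L[ℝ] E => L _) hid).trans ?_)
    show lieBracketWithin ℝ (P X) (P Y) (φ.symm ⁻¹' univ ∩ range I) (φ p) = _
    rw [preimage_univ, hr, univ_inter, lieBracketWithin_univ]
  have hX' := hmd _ hXf (Y p)
  have hY' := hmd _ hYf (X p)
  rw [(hP X).fderiv_eq] at hX'
  rw [(hP Y).fderiv_eq] at hY'
  rw [hX', hY', hmd f (hf.mdifferentiableAt (by simp)), hbr,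
    fderiv_lieBracket hgd (hPd X hX) (hPd Y hY), hPp, hPp]

end Manifold
section BundleSmooth

variable {E : Type*} [NormedAddCommGroup E] [NormedSpace ℝ E]
  {H : Type*} [TopologicalSpace H] {I : ModelWithCorners ℝ E H}
  {M : Type*} [TopologicalSpace M] [ChartedSpace H M]
  {F₁ : Type*} [NormedAddCommGroup F₁] [NormedSpace ℝ F₁]
  {V₁ : M → Type*} [∀ x, AddCommGroup (V₁ x)] [∀ x, Module ℝ (V₁ x)]
  [TopologicalSpace (TotalSpace F₁ V₁)] [∀ x, TopologicalSpace (V₁ x)]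
  [FiberBundle F₁ V₁] [VectorBundle ℝ F₁ V₁]
  {F₂ : Type*} [NormedAddCommGroup F₂] [NormedSpace ℝ F₂]
  {V₂ : M → Type*} [∀ x, AddCommGroup (V₂ x)] [∀ x, Module ℝ (V₂ x)]
  [TopologicalSpace (TotalSpace F₂ V₂)] [∀ x, TopologicalSpace (V₂ x)]
  [FiberBundle F₂ V₂] [VectorBundle ℝ F₂ V₂]
  {E' : Type*} [NormedAddCommGroup E'] [NormedSpace ℝ E']
  {H' : Type*} [TopologicalSpace H'] {I' : ModelWithCorners ℝ E' H'}
  {N : Type*} [TopologicalSpace N] [ChartedSpace H' N]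
  {n : WithTop ℕ∞}

theorem contMDiffAt_prodSection {b : N → M} {v : ∀ m, V₁ (b m)} {w : ∀ m, V₂ (b m)} {m₀ : N} :
    ContMDiffAt I' (I.prod 𝓘(ℝ, F₁ × F₂)) n
        (fun m => (⟨b m, (v m, w m)⟩ : TotalSpace (F₁ × F₂) (fun x => V₁ x × V₂ x))) m₀ ↔
      ContMDiffAt I' (I.prod 𝓘(ℝ, F₁)) n (fun m => (⟨b m, v m⟩ : TotalSpace F₁ V₁)) m₀ ∧
      ContMDiffAt I' (I.prod 𝓘(ℝ, F₂)) n (fun m => (⟨b m, w m⟩ : TotalSpace F₂ V₂)) m₀ := by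
  rw [contMDiffAt_totalSpace, contMDiffAt_totalSpace, contMDiffAt_totalSpace]
  have h : ContMDiffAt I' 𝓘(ℝ, F₁ × F₂) n (fun m => (trivializationAt (F₁ × F₂)
        (fun x => V₁ x × V₂ x) (b m₀) ⟨b m, (v m, w m)⟩).2) m₀ ↔
      ContMDiffAt I' 𝓘(ℝ, F₁) n (fun m => (trivializationAt F₁ V₁ (b m₀) ⟨b m, v m⟩).2) m₀ ∧
      ContMDiffAt I' 𝓘(ℝ, F₂) n (fun m => (trivializationAt F₂ V₂ (b m₀) ⟨b m, w m⟩).2) m₀ :=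
    contMDiffAt_prod_module_iff _
  simp only at h ⊢
  rw [h]
  tauto

theorem mdifferentiableAt_prodSection {b : N → M} {v : ∀ m, V₁ (b m)} {w : ∀ m, V₂ (b m)} {m₀ : N} :
    MDifferentiableAt I' (I.prod 𝓘(ℝ, F₁ × F₂))
        (fun m => (⟨b m, (v m, w m)⟩ : TotalSpace (F₁ × F₂) (fun x => V₁ x × V₂ x))) m₀ ↔
      MDifferentiableAt I' (I.prod 𝓘(ℝ, F₁)) (fun m => (⟨b m, v m⟩ : TotalSpace F₁ V₁)) m₀ ∧
      MDifferentiableAt I' (I.prod 𝓘(ℝ, F₂)) (fun m => (⟨b m, w m⟩ : TotalSpace F₂ V₂)) m₀ := by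
  rw [mdifferentiableAt_totalSpace, mdifferentiableAt_totalSpace, mdifferentiableAt_totalSpace]
  have h : MDifferentiableAt I' 𝓘(ℝ, F₁ × F₂) (fun m => (trivializationAt (F₁ × F₂)
        (fun x => V₁ x × V₂ x) (b m₀) ⟨b m, (v m, w m)⟩).2) m₀ ↔
      MDifferentiableAt I' 𝓘(ℝ, F₁) (fun m => (trivializationAt F₁ V₁ (b m₀) ⟨b m, v m⟩).2) m₀ ∧
      MDifferentiableAt I' 𝓘(ℝ, F₂) (fun m => (trivializationAt F₂ V₂ (b m₀) ⟨b m, w m⟩).2) m₀ :=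
    mdifferentiableAt_prod_module_iff _
  simp only at h ⊢
  rw [h]
  tauto

theorem contMDiffAt_clm [FiniteDimensional ℝ F₁] {A : N → F₁ →L[ℝ] F₂} {m₀ : N}
    (h : ∀ ξ, ContMDiffAt I' 𝓘(ℝ, F₂) n (fun m => A m ξ) m₀) :
    ContMDiffAt I' 𝓘(ℝ, F₁ →L[ℝ] F₂) n A m₀ := by
  let b := Module.finBasis ℝ F₁
  let c (i) : F₁ →L[ℝ] ℝ := LinearMap.toContinuousLinearMap (b.coord i)
  have e : A = fun m => ∑ i, ContinuousLinearMap.smulRightL ℝ F₁ F₂ (c i) (A m (b i)) := by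
    ext m ξ
    have h1 := congrArg (A m) (b.sum_repr ξ).symm
    rw [map_sum] at h1
    simpa [c] using h1
  rw [e]
  refine ContMDiffAt.sum fun i _ => ?_
  exact (ContinuousLinearMap.contMDiff (ContinuousLinearMap.smulRightL ℝ F₁ F₂ (c i))
    (n := n)).contMDiffAt.comp m₀ (h (b i))

theorem contMDiffAt_hom_of_apply [∀ x, IsTopologicalAddGroup (V₂ x)] [∀ x, ContinuousSMul ℝ (V₂ x)]
    [FiniteDimensional ℝ F₁] {b : N → M} {A : ∀ m, V₁ (b m) →L[ℝ] V₂ (b m)}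
    {m₀ : N} (hb : ContMDiffAt I' I n b m₀)
    (h : ∀ ξ, ContMDiffAt I' (I.prod 𝓘(ℝ, F₂)) n (fun m =>
      (⟨b m, A m ((trivializationAt F₁ V₁ (b m₀)).symm (b m) ξ)⟩ : TotalSpace F₂ V₂)) m₀) :
    ContMDiffAt I' (I.prod 𝓘(ℝ, F₁ →L[ℝ] F₂)) n
      (fun m => (⟨b m, A m⟩ : TotalSpace (F₁ →L[ℝ] F₂) (fun x => V₁ x →L[ℝ] V₂ x))) m₀ := by
  rw [contMDiffAt_hom_bundle]
  refine ⟨hb, contMDiffAt_clm fun ξ => ?_⟩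
  have h1 := (contMDiffAt_totalSpace.1 (h ξ)).2
  refine h1.congr_of_eventuallyEq ?_
  filter_upwards [hb.continuousAt ((trivializationAt F₁ V₁ (b m₀)).open_baseSet.mem_nhds
      (FiberBundle.mem_baseSet_trivializationAt' (b m₀))),
    hb.continuousAt ((trivializationAt F₂ V₂ (b m₀)).open_baseSet.mem_nhds
      (FiberBundle.mem_baseSet_trivializationAt' (b m₀)))] with y hy hy'
  rw [ContinuousLinearMap.inCoordinates_eq hy hy']
  simp

theorem contMDiffAt_trivialSection {b : N → M} {f : N → ℝ} {m₀ : N}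
    (hb : ContMDiffAt I' I n b m₀) :
    ContMDiffAt I' (I.prod 𝓘(ℝ, ℝ)) n (fun m => (⟨b m, f m⟩ : TotalSpace ℝ (Bundle.Trivial M ℝ))) m₀ ↔
      ContMDiffAt I' 𝓘(ℝ, ℝ) n f m₀ := by
  rw [contMDiffAt_totalSpace]
  exact ⟨fun h => h.2, fun h => ⟨hb, h⟩⟩

theorem contMDiffOn_symm [ContMDiffVectorBundle n F₁ V₁ I]
    (e : Trivialization F₁ (TotalSpace.proj : TotalSpace F₁ V₁ → M)) [MemTrivializationAtlas e]
    (ξ : F₁) :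
    ContMDiffOn I (I.prod 𝓘(ℝ, F₁)) n
      (fun y => (⟨y, e.symm y ξ⟩ : TotalSpace F₁ V₁)) e.baseSet := by
  refine (e.contMDiffOn_section_baseSet_iff).2 ?_
  refine (contMDiffOn_const (c := ξ)).congr fun y hy => ?_
  simp [e.apply_mk_symm hy]

variable [ContMDiffVectorBundle n F₁ V₁ I]

theorem contMDiffOn_hom_of_apply [∀ x, IsTopologicalAddGroup (V₂ x)]
    [∀ x, ContinuousSMul ℝ (V₂ x)]
    [FiniteDimensional ℝ F₁] {A : ∀ x, V₁ x →L[ℝ] V₂ x} {U : Set M} (hU : IsOpen U)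
    (h : ∀ W ⊆ U, IsOpen W → ∀ s : ∀ x, V₁ x,
      ContMDiffOn I (I.prod 𝓘(ℝ, F₁)) n (fun y => (⟨y, s y⟩ : TotalSpace F₁ V₁)) W →
      ContMDiffOn I (I.prod 𝓘(ℝ, F₂)) n (fun y => (⟨y, A y (s y)⟩ : TotalSpace F₂ V₂)) W) :
    ContMDiffOn I (I.prod 𝓘(ℝ, F₁ →L[ℝ] F₂)) n
      (fun y => (⟨y, A y⟩ : TotalSpace (F₁ →L[ℝ] F₂) (fun x => V₁ x →L[ℝ] V₂ x))) U := by
  intro x hx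
  refine (contMDiffAt_hom_of_apply (b := fun y => y) contMDiffAt_id fun ξ => ?_).contMDiffWithinAt
  set e := trivializationAt F₁ V₁ x
  have hW : IsOpen (U ∩ e.baseSet) := hU.inter e.open_baseSet
  exact (h _ inter_subset_left hW _ ((contMDiffOn_symm e ξ).mono inter_subset_right)).contMDiffAt
    (hW.mem_nhds ⟨hx, FiberBundle.mem_baseSet_trivializationAt' x⟩)

theorem contMDiffOn_dual_of_apply [FiniteDimensional ℝ F₁] {η : ∀ x, V₁ x →L[ℝ] ℝ} {U : Set M}
    (hU : IsOpen U)
    (h : ∀ W ⊆ U, IsOpen W → ∀ s : ∀ x, V₁ x,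
      ContMDiffOn I (I.prod 𝓘(ℝ, F₁)) n (fun y => (⟨y, s y⟩ : TotalSpace F₁ V₁)) W →
      ContMDiffOn I 𝓘(ℝ, ℝ) n (fun y => η y (s y)) W) :
    ContMDiffOn I (I.prod 𝓘(ℝ, F₁ →L[ℝ] ℝ)) n
      (fun y => (⟨y, η y⟩ : TotalSpace (F₁ →L[ℝ] ℝ) (DualBundle V₁))) U :=
  contMDiffOn_hom_of_apply (V₂ := Bundle.Trivial M ℝ) hU fun W hW hWo s hs _ hx =>
    ((contMDiffAt_trivialSection contMDiffAt_id).2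
      ((h W hW hWo s hs).contMDiffAt (hWo.mem_nhds hx))).contMDiffWithinAt

theorem ContMDiffAt.dual_apply {b : N → M} {η : ∀ m, V₁ (b m) →L[ℝ] ℝ} {v : ∀ m, V₁ (b m)}
    {m₀ : N}
    (hη : ContMDiffAt I' (I.prod 𝓘(ℝ, F₁ →L[ℝ] ℝ)) n
      (fun m => (⟨b m, η m⟩ : TotalSpace (F₁ →L[ℝ] ℝ) (DualBundle V₁))) m₀)
    (hv : ContMDiffAt I' (I.prod 𝓘(ℝ, F₁)) n (fun m => (⟨b m, v m⟩ : TotalSpace F₁ V₁)) m₀) :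
    ContMDiffAt I' 𝓘(ℝ, ℝ) n (fun m => η m (v m)) m₀ :=
  (contMDiffAt_totalSpace.1
    (ContMDiffAt.clm_bundle_apply (E₂ := Bundle.Trivial M ℝ) (F₂ := ℝ) hη hv)).2

theorem contMDiff_totalSpace_of_apply [FiniteDimensional ℝ F₁] {A : ∀ x, V₁ x →ₗ[ℝ] V₂ x}
    (h : ∀ W : Set M, IsOpen W → ∀ s : ∀ x, V₁ x,
      ContMDiffOn I (I.prod 𝓘(ℝ, F₁)) n (fun y => (⟨y, s y⟩ : TotalSpace F₁ V₁)) W →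
      ContMDiffOn I (I.prod 𝓘(ℝ, F₂)) n (fun y => (⟨y, A y (s y)⟩ : TotalSpace F₂ V₂)) W) :
    ContMDiff (I.prod 𝓘(ℝ, F₁)) (I.prod 𝓘(ℝ, F₂)) n
      (fun q : TotalSpace F₁ V₁ => (⟨q.1, A q.1 q.2⟩ : TotalSpace F₂ V₂)) := by
  intro q
  let e := trivializationAt F₁ V₁ q.1
  let e' := trivializationAt F₂ V₂ q.1
  let b := Module.finBasis ℝ F₁
  have hproj : ContMDiffAt (I.prod 𝓘(ℝ, F₁)) I n (TotalSpace.proj : TotalSpace F₁ V₁ → M) q :=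
    contMDiffAt_proj V₁
  have hqe : q.1 ∈ e.baseSet := FiberBundle.mem_baseSet_trivializationAt' q.1
  refine contMDiffAt_totalSpace.2 ⟨hproj, ?_⟩
  have hAb (i) : ContMDiffAt (I.prod 𝓘(ℝ, F₁)) 𝓘(ℝ, F₂) n
      (fun p : TotalSpace F₁ V₁ => (e' ⟨p.1, A p.1 (e.symm p.1 (b i))⟩).2) q := by
    have h1 := (h e.baseSet e.open_baseSet _ (contMDiffOn_symm e (b i))).contMDiffAt
      (e.open_baseSet.mem_nhds hqe)
    exact (contMDiffAt_totalSpace.1 h1).2.comp q hproj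
  have hc (i) : ContMDiffAt (I.prod 𝓘(ℝ, F₁)) 𝓘(ℝ, ℝ) n
      (fun p : TotalSpace F₁ V₁ => b.coord i (e p).2) q := by
    have h1 := (contMDiffAt_totalSpace.1 (contMDiffAt_id (x := q)
      (I := I.prod 𝓘(ℝ, F₁)) (n := n))).2
    exact (ContinuousLinearMap.contMDiff (LinearMap.toContinuousLinearMap (b.coord i))
      (n := n)).contMDiffAt.comp q h1
  have hsum : ContMDiffAt (I.prod 𝓘(ℝ, F₁)) 𝓘(ℝ, F₂) n
      (fun p : TotalSpace F₁ V₁ => ∑ i, b.coord i (e p).2 •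
        (e' ⟨p.1, A p.1 (e.symm p.1 (b i))⟩).2) q :=
    ContMDiffAt.sum fun i _ => (hc i).smul (hAb i)
  refine hsum.congr_of_eventuallyEq ?_
  have hn : ∀ᶠ y in 𝓝 q.1, y ∈ e.baseSet ∩ e'.baseSet :=
    (e.open_baseSet.inter e'.open_baseSet).mem_nhds
      ⟨hqe, FiberBundle.mem_baseSet_trivializationAt' q.1⟩
  filter_upwards [hproj.continuousAt.eventually hn] with p hp
  have hs (ξ) : e.symmₗ ℝ p.1 ξ = e.symm p.1 ξ := e.symmₗ_apply hp.1 ξ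
  have e1 : e.symmₗ ℝ p.1 (e p).2 = p.2 := by
    have := e.symmₗ_linearMapAt (R := ℝ) hp.1 p.2
    rwa [e.coe_linearMapAt_of_mem hp.1] at this
  have e2 := congrArg (e'.linearMapAt ℝ p.1 ∘ₗ A p.1 ∘ₗ e.symmₗ ℝ p.1) (b.sum_repr (e p).2).symm
  rw [map_sum] at e2
  simpa [e1, e'.coe_linearMapAt_of_mem hp.2, hs] using e2

end BundleSmooth

section VectorField

variable {E : Type*} [NormedAddCommGroup E] [NormedSpace ℝ E]
  {H : Type*} [TopologicalSpace H] {I : ModelWithCorners ℝ E H}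
  {N : Type*} [TopologicalSpace N] [ChartedSpace H N] [IsManifold I ∞ N]

theorem trivializationAt_tangentSpace_snd {p q : N} (hq : q ∈ (chartAt H p).source)
    (v : TangentSpace I q) :
    (trivializationAt E (TangentSpace I) p ⟨q, v⟩).2 = mvfderiv I (extChartAt I p) q v := by
  have h := TangentBundle.continuousLinearMapAt_trivializationAt (𝕜 := ℝ) (I := I) hq
  have h2 : q ∈ (trivializationAt E (TangentSpace I) p).baseSet := hq
  have h3 := congrArg (fun L : E →L[ℝ] E => L v) h
  refine Eq.trans ?_ h3
  show _ = (trivializationAt E (TangentSpace I) p).linearMapAt ℝ q v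
  rw [(trivializationAt E (TangentSpace I) p).coe_linearMapAt_of_mem h2]

theorem contMDiffAt_vectorField_iff {Y : ∀ q : N, TangentSpace I q} {p : N} :
    ContMDiffAt I (I.prod 𝓘(ℝ, E)) ∞ (fun q => (⟨q, Y q⟩ : TangentBundle I N)) p ↔
      ContMDiffAt I 𝓘(ℝ, E) ∞ (fun q => mvfderiv I (extChartAt I p) q (Y q)) p := by
  rw [contMDiffAt_section]
  refine Filter.EventuallyEq.contMDiffAt_iff ?_
  filter_upwards [(chartAt H p).open_source.mem_nhds (mem_chart_source H p)] with q hq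
  exact trivializationAt_tangentSpace_snd hq (Y q)

end VectorField

section DualConnection

variable {E : Type*} [NormedAddCommGroup E] [NormedSpace ℝ E] [FiniteDimensional ℝ E]
  {H : Type*} [TopologicalSpace H] {I : ModelWithCorners ℝ E H}
  {M : Type*} [TopologicalSpace M] [ChartedSpace H M] [IsManifold I ∞ M]
  {F : Type*} [NormedAddCommGroup F] [NormedSpace ℝ F] [FiniteDimensional ℝ F]
  {V : M → Type*} [∀ x, AddCommGroup (V x)] [∀ x, Module ℝ (V x)]
  [TopologicalSpace (TotalSpace F V)] [∀ x, TopologicalSpace (V x)]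
  [∀ x, IsTopologicalAddGroup (V x)] [∀ x, ContinuousSMul ℝ (V x)]
  [FiberBundle F V] [VectorBundle ℝ F V] [ContMDiffVectorBundle ∞ F V I]

theorem dualConnection_apply (cov : CovariantDerivative I F V) {φ : ∀ x, DualBundle V x}
    {s : ∀ x, V x} {x : M} (u : TangentSpace I x)
    (hφ : MDifferentiableAt I (I.prod 𝓘(ℝ, F →L[ℝ] ℝ))
      (fun y => (⟨y, φ y⟩ : TotalSpace (F →L[ℝ] ℝ) (DualBundle V))) x)
    (hs : MDifferentiableAt I (I.prod 𝓘(ℝ, F)) (fun y => (⟨y, s y⟩ : TotalSpace F V)) x) :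
    dualConnection cov φ x u (s x)
      = mvfderiv I (fun y => φ y (s y)) x u - φ x (cov s x u) := by
  have h := tensorialAt_dualCovAux cov φ x hφ
  have e : dualConnection cov φ x = flipTangent (TensorialAt.mkHom _ x h) := dif_pos h
  rw [e, flipTangent_apply, TensorialAt.mkHom_apply h hs]
  rfl

theorem contMDiffOn_dualSection_apply {φ : ∀ x, DualBundle V x} {s : ∀ x, V x} {U : Set M}
    (hφ : ContMDiffOn I (I.prod 𝓘(ℝ, F →L[ℝ] ℝ)) ∞
      (fun y => (⟨y, φ y⟩ : TotalSpace (F →L[ℝ] ℝ) (DualBundle V))) U)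
    (hs : ContMDiffOn I (I.prod 𝓘(ℝ, F)) ∞ (fun y => (⟨y, s y⟩ : TotalSpace F V)) U) :
    ContMDiffOn I 𝓘(ℝ, ℝ) ∞ (fun y => φ y (s y)) U :=
  fun x hx => (contMDiffWithinAt_totalSpace.1
    (ContMDiffWithinAt.clm_bundle_apply (E₂ := Bundle.Trivial M ℝ) (F₂ := ℝ) (hφ x hx) (hs x hx))).2

theorem contMDiffOn_covariantDerivative [T2Space M] {cov : CovariantDerivative I F V}
    (hcov : CovariantDerivative.ContMDiffCovariantDerivative cov ∞) {s : ∀ x, V x} {U : Set M}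
    (hU : IsOpen U)
    (hs : ContMDiffOn I (I.prod 𝓘(ℝ, F)) ∞ (fun y => (⟨y, s y⟩ : TotalSpace F V)) U) :
    ContMDiffOn I (I.prod 𝓘(ℝ, E →L[ℝ] F)) ∞
      (fun y => (⟨y, cov s y⟩ : TotalSpace (E →L[ℝ] F) fun y => TangentSpace I y →L[ℝ] V y)) U := by
  intro x hx
  obtain ⟨ρ, hρ⟩ := (SmoothBumpFunction.nhds_basis_tsupport (I := I) x).mem_iff.1 (hU.mem_nhds hx)
  have hσ : ContMDiff I (I.prod 𝓘(ℝ, F)) ∞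
      (fun y => (⟨y, ((ρ : M → ℝ) • s) y⟩ : TotalSpace F V)) :=
    ContMDiffOn.smul_section_of_tsupport ρ.contMDiff.contMDiffOn hU hρ.2 hs
  have h1 := hcov.contMDiff.contMDiff (σ := (ρ : M → ℝ) • s) hσ.contMDiffOn
  refine ContMDiffAt.contMDiffWithinAt ((h1.contMDiffAt Filter.univ_mem).congr_of_eventuallyEq ?_)
  filter_upwards [ρ.eventuallyEq_one.eventually_nhds, hU.mem_nhds hx] with y hy hyU
  congr 1
  refine IsCovariantDerivativeOn.congr_of_eventuallyEq cov.isCovariantDerivativeOnUniv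
    ((hs.contMDiffAt (hU.mem_nhds hyU)).mdifferentiableAt (by simp))
    (hσ.contMDiffAt.mdifferentiableAt (by simp)) Filter.univ_mem ?_
  filter_upwards [hy] with z hz
  simp [hz]

theorem contMDiffOn_covariantDerivative_apply [T2Space M] {cov : CovariantDerivative I F V}
    (hcov : CovariantDerivative.ContMDiffCovariantDerivative cov ∞) {s : ∀ x, V x}
    {u : ∀ x : M, TangentSpace I x} {U : Set M} (hU : IsOpen U)
    (hs : ContMDiffOn I (I.prod 𝓘(ℝ, F)) ∞ (fun y => (⟨y, s y⟩ : TotalSpace F V)) U)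
    (hu : ContMDiffOn I (I.prod 𝓘(ℝ, E)) ∞ (fun y => (⟨y, u y⟩ : TangentBundle I M)) U) :
    ContMDiffOn I (I.prod 𝓘(ℝ, F)) ∞ (fun y => (⟨y, cov s y (u y)⟩ : TotalSpace F V)) U :=
  (contMDiffOn_covariantDerivative hcov hU hs).clm_bundle_apply hu

theorem contMDiffCovariantDerivative_dualConnection [T2Space M] {cov : CovariantDerivative I F V}
    (hcov : CovariantDerivative.ContMDiffCovariantDerivative cov ∞) :
    CovariantDerivative.ContMDiffCovariantDerivative (dualConnection cov) ∞ := by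
  refine ⟨⟨fun {φ} hφ => ?_⟩⟩
  have hφ' : ContMDiffOn I (I.prod 𝓘(ℝ, F →L[ℝ] ℝ)) ∞
      (fun y => (⟨y, φ y⟩ : TotalSpace (F →L[ℝ] ℝ) (DualBundle V))) univ := hφ
  refine contMDiffOn_hom_of_apply (V₁ := (TangentSpace I : M → Type _)) (V₂ := DualBundle V)
    (A := dualConnection cov φ) isOpen_univ fun W _ hW u hu => ?_
  refine contMDiffOn_dual_of_apply hW fun W' hWW hW' s hs => ?_
  have h1 := contMDiffOn_mvfderiv_apply hW'
    (contMDiffOn_dualSection_apply (hφ'.mono (subset_univ W')) hs) (hu.mono hWW)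
  have h2 := contMDiffOn_dualSection_apply (hφ'.mono (subset_univ W'))
    (contMDiffOn_covariantDerivative_apply hcov hW' hs (hu.mono hWW))
  refine (h1.sub h2).congr fun y hy => ?_
  exact dualConnection_apply cov (u y)
    ((hφ'.contMDiffAt Filter.univ_mem).mdifferentiableAt (by simp))
    ((hs.contMDiffAt (hW'.mem_nhds hy)).mdifferentiableAt (by simp))

theorem IsFlat.dualConnection [I.Boundaryless] [T2Space M] {cov : CovariantDerivative I F V}
    (h : IsFlat cov) : IsFlat (dualConnection cov) where
  smooth := contMDiffCovariantDerivative_dualConnection h.smooth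
  curvature_eq_zero U hU X Y φ hX hY hφ x hx := by
    have hsm := contMDiffCovariantDerivative_dualConnection h.smooth
    ext v
    set s := FiberBundle.extend F v with hs_def
    obtain ⟨W₀, hW₀, hsW₀⟩ := FiberBundle.exists_contMDiffOn_extend (k := ∞) I F v
    obtain ⟨W₁, hW₁, hW₁o, hxW₁⟩ := mem_nhds_iff.1 hW₀
    set W := U ∩ W₁
    have hW : IsOpen W := hU.inter hW₁o
    have hxW : x ∈ W := ⟨hx, hxW₁⟩
    have hs : ContMDiffOn I (I.prod 𝓘(ℝ, F)) ∞ (fun y => (⟨y, s y⟩ : TotalSpace F V)) W :=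
      hsW₀.mono (inter_subset_right.trans hW₁)
    replace hX := hX.mono (inter_subset_left (t := W₁))
    replace hY := hY.mono (inter_subset_left (t := W₁))
    replace hφ := hφ.mono (inter_subset_left (t := W₁))
    have hxn : W ∈ 𝓝 x := hW.mem_nhds hxW
    have hsec {ψ : ∀ x, DualBundle V x} (hψ : ContMDiffOn I (I.prod 𝓘(ℝ, F →L[ℝ] ℝ)) ∞
        (fun y => (⟨y, ψ y⟩ : TotalSpace (F →L[ℝ] ℝ) (DualBundle V))) W) {y : M} (hy : y ∈ W) :=
      (hψ.contMDiffAt (hW.mem_nhds hy)).mdifferentiableAt (by simp)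
    have hsec' {t : ∀ x, V x} (ht : ContMDiffOn I (I.prod 𝓘(ℝ, F)) ∞
        (fun y => (⟨y, t y⟩ : TotalSpace F V)) W) {y : M} (hy : y ∈ W) :=
      (ht.contMDiffAt (hW.mem_nhds hy)).mdifferentiableAt (by simp)
    have hfun {f : M → ℝ} (hf : ContMDiffOn I 𝓘(ℝ, ℝ) ∞ f W) :=
      (hf.contMDiffAt hxn).mdifferentiableAt (by simp)
    have hf := contMDiffOn_dualSection_apply hφ hs
    have key (A B : ∀ x : M, TangentSpace I x)
        (hA : ContMDiffOn I (I.prod 𝓘(ℝ, E)) ∞ (fun x => (⟨x, A x⟩ : TangentBundle I M)) W)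
        (hB : ContMDiffOn I (I.prod 𝓘(ℝ, E)) ∞ (fun x => (⟨x, B x⟩ : TangentBundle I M)) W) :
        GenGeom.dualConnection cov (fun y => GenGeom.dualConnection cov φ y (B y)) x (A x) (s x)
          = mvfderiv I (fun y => mvfderiv I (fun z => φ z (s z)) y (B y)) x (A x)
            - mvfderiv I (fun y => φ y (cov s y (B y))) x (A x)
            - mvfderiv I (fun y => φ y (cov s y (A y))) x (B x)
            + φ x (cov (fun y => cov s y (A y)) x (B x)) := by
      have hBφ := contMDiffOn_covariantDerivative_apply hsm hW hφ hB
      have hAs := contMDiffOn_covariantDerivative_apply h.smooth hW hs hA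
      have hBs := contMDiffOn_covariantDerivative_apply h.smooth hW hs hB
      rw [dualConnection_apply cov (A x) (hsec hBφ hxW) (hsec' hs hxW),
        dualConnection_apply cov (B x) (hsec hφ hxW) (hsec' hAs hxW)]
      have e : (fun y => GenGeom.dualConnection cov φ y (B y) (s y)) =ᶠ[𝓝 x]
          (fun y => mvfderiv I (fun z => φ z (s z)) y (B y)) - fun y => φ y (cov s y (B y)) := by
        filter_upwards [hxn] with y hy
        exact dualConnection_apply cov (B y) (hsec hφ hy) (hsec' hs hy)
      have e' : mvfderiv I (fun y => GenGeom.dualConnection cov φ y (B y) (s y)) x =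
          mvfderiv I ((fun y => mvfderiv I (fun z => φ z (s z)) y (B y))
            - fun y => φ y (cov s y (B y))) x := e.mfderiv_eq
      rw [e', mvfderiv_sub (hfun (contMDiffOn_mvfderiv_apply hW hf hB))
        (hfun (contMDiffOn_dualSection_apply hφ hBs))]
      simp only [sub_apply]
      ring
    have hbr := mvfderiv_mlieBracket ((hf.contMDiffAt hxn).of_le ENat.LEInfty.out)
      ((hX.contMDiffAt hxn).mdifferentiableAt (by simp))
      ((hY.contMDiffAt hxn).mdifferentiableAt (by simp))
      (hfun (contMDiffOn_mvfderiv_apply hW hf hX)) (hfun (contMDiffOn_mvfderiv_apply hW hf hY))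
    have hc := congrArg (φ x) (h.curvature_eq_zero W hW X Y s hX hY hs x hxW)
    simp only [map_sub, map_zero] at hc
    have hv : v = s x := by simp [s]
    simp only [sub_apply]
    rw [hv, key X Y hX hY, key Y X hY hX,
      dualConnection_apply cov (mlieBracket I X Y x) (hsec hφ hxW) (hsec' hs hxW), hbr]
    simp only [zero_apply]
    linarith

end DualConnection
section ProductRule

variable {E : Type*} [NormedAddCommGroup E] [NormedSpace ℝ E]
  {H : Type*} [TopologicalSpace H] {I : ModelWithCorners ℝ E H}
  {N : Type*} [TopologicalSpace N] [ChartedSpace H N]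
  {G₁ : Type*} [NormedAddCommGroup G₁] [NormedSpace ℝ G₁]
  {G₂ : Type*} [NormedAddCommGroup G₂] [NormedSpace ℝ G₂]

theorem mvfderiv_eq_fderiv [I.Boundaryless] {f : N → G₁} {p : N}
    (hf : MDifferentiableAt I 𝓘(ℝ, G₁) f p) (Y : TangentSpace I p) :
    DifferentiableAt ℝ (f ∘ (extChartAt I p).symm) (extChartAt I p p) ∧
      mvfderiv I f p Y
        = (fderiv ℝ (f ∘ (extChartAt I p).symm) (extChartAt I p p) : E →L[ℝ] G₁) Y := by
  have h1 : DifferentiableWithinAt ℝ (f ∘ (extChartAt I p).symm) (range I) (extChartAt I p p)  :=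
    hf.differentiableWithinAt_writtenInExtChartAt
  have h2 : mvfderiv I f p = (fderivWithin ℝ (f ∘ (extChartAt I p).symm) (range I)
      (extChartAt I p p) : E →L[ℝ] G₁) :=
    hf.mfderiv
  rw [I.range_eq_univ] at h1 h2
  rw [fderivWithin_univ] at h2
  exact ⟨h1.differentiableAt Filter.univ_mem, congrArg (fun L : E →L[ℝ] G₁ => L Y) h2⟩

theorem mvfderiv_clm_apply [I.Boundaryless] {A : N → G₁ →L[ℝ] G₂} {v : N → G₁} {p : N}
    (hA : MDifferentiableAt I 𝓘(ℝ, G₁ →L[ℝ] G₂) A p) (hv : MDifferentiableAt I 𝓘(ℝ, G₁) v p)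
    (Y : TangentSpace I p) :
    MDifferentiableAt I 𝓘(ℝ, G₂) (fun q => A q (v q)) p ∧
    mvfderiv I (fun q => A q (v q)) p Y = mvfderiv I A p Y (v p) + A p (mvfderiv I v p Y) := by
  have hAv : MDifferentiableAt I 𝓘(ℝ, G₂) (fun q => A q (v q)) p := by
    have h1 : DifferentiableAt ℝ (fun z : (G₁ →L[ℝ] G₂) × G₁ => z.1 z.2) (A p, v p) :=
      differentiableAt_fst.clm_apply differentiableAt_snd
    exact h1.mdifferentiableAt.comp p (hA.prodMk_space hv)
  refine ⟨hAv, ?_⟩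
  set φ := extChartAt I p with hφ
  obtain ⟨dA, eA⟩ := mvfderiv_eq_fderiv hA Y
  obtain ⟨dv, ev⟩ := mvfderiv_eq_fderiv hv Y
  have h1 : (A ∘ φ.symm) (φ p) = A p := congrArg A (extChartAt_to_inv p)
  have h2 : (v ∘ φ.symm) (φ p) = v p := congrArg v (extChartAt_to_inv p)
  have h3 := (mvfderiv_eq_fderiv hAv Y).2
  have h4 := fderiv_clm_apply dA dv
  rw [h1, h2] at h4
  rw [eA, ev]
  refine h3.trans ((congrArg (fun L : E →L[ℝ] G₂ => L Y) h4).trans ?_)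
  exact add_comm _ _

end ProductRule

section TotalSpace

variable {E : Type*} [NormedAddCommGroup E] [NormedSpace ℝ E] [FiniteDimensional ℝ E]
  {H : Type*} [TopologicalSpace H] {I : ModelWithCorners ℝ E H} [I.Boundaryless]
  {M : Type*} [TopologicalSpace M] [ChartedSpace H M] [IsManifold I ∞ M]
  {F : Type*} [NormedAddCommGroup F] [NormedSpace ℝ F] [FiniteDimensional ℝ F]
  {V : M → Type*} [∀ x, AddCommGroup (V x)] [∀ x, Module ℝ (V x)]
  [TopologicalSpace (TotalSpace F V)] [∀ x, TopologicalSpace (V x)]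
  [∀ x, IsTopologicalAddGroup (V x)] [∀ x, ContinuousSMul ℝ (V x)]
  [FiberBundle F V] [VectorBundle ℝ F V] [ContMDiffVectorBundle ∞ F V I]

theorem contMDiffAt_totalSpace_proj (p : TotalSpace F V) :
    ContMDiffAt (I.prod 𝓘(ℝ, F)) I ∞ (fun q : TotalSpace F V => q.1) p :=
  contMDiffAt_proj V

theorem isOpen_totalSpace_preimage {U : Set M} (hU : IsOpen U) :
    IsOpen {q : TotalSpace F V | q.1 ∈ U} :=
  hU.preimage (FiberBundle.continuous_proj F V)

theorem mvfderiv_comp_proj {G : Type*} [NormedAddCommGroup G] [NormedSpace ℝ G] {f : M → G}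
    {p : TotalSpace F V} (hf : MDifferentiableAt I 𝓘(ℝ, G) f p.1) (Y : TotTangent I F V p) :
    mvfderiv (I.prod 𝓘(ℝ, F)) (fun q : TotalSpace F V => f q.1) p Y
      = mvfderiv I f p.1 (projDeriv I p Y) :=
  mfderiv_comp_apply (f := fun q : TotalSpace F V => q.1) p hf
    ((contMDiffAt_totalSpace_proj p).mdifferentiableAt (by simp)) Y

theorem mvfderiv_fibreFunction (cov : CovariantDerivative I F V) {φ : ∀ x, DualBundle V x}
    {p : TotalSpace F V}
    (hφ : MDifferentiableAt I (I.prod 𝓘(ℝ, F →L[ℝ] ℝ))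
      (fun y => (⟨y, φ y⟩ : TotalSpace (F →L[ℝ] ℝ) (DualBundle V))) p.1)
    (Y : TotTangent I F V p) :
    mvfderiv (I.prod 𝓘(ℝ, F)) (fun q : TotalSpace F V => φ q.1 q.2) p Y
      = φ p.1 (connForm cov p Y) + dualConnection cov φ p.1 (projDeriv I p Y) p.2 := by
  set e := trivializationAt F V p.1 with he
  have hpe : p.1 ∈ e.baseSet := FiberBundle.mem_baseSet_trivializationAt' p.1
  let ψ (y : M) : F →L[ℝ] ℝ := (φ y).comp (e.symmL ℝ y)
  have hψ : MDifferentiableAt I 𝓘(ℝ, F →L[ℝ] ℝ) ψ p.1 := by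
    have h1 := ((mdifferentiableAt_totalSpace I _).1 hφ).2
    refine h1.congr_of_eventuallyEq (Filter.Eventually.of_forall fun y => ?_)
    ext ξ
    show _ = (trivializationAt ℝ (Bundle.Trivial M ℝ) p.1).continuousLinearMapAt ℝ y
      (φ y (e.symmL ℝ y ξ))
    simp [ψ]
  have hxi := mdifferentiableAt_fibreCoord (I := I) p
  have hpr : MDifferentiableAt (I.prod 𝓘(ℝ, F)) I (fun q : TotalSpace F V => q.1) p :=
    (contMDiffAt_totalSpace_proj p).mdifferentiableAt (by simp)
  have hψπ : MDifferentiableAt (I.prod 𝓘(ℝ, F)) 𝓘(ℝ, F →L[ℝ] ℝ)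
      (fun q : TotalSpace F V => ψ q.1) p := hψ.comp p hpr
  have e1 : (fun q : TotalSpace F V => φ q.1 q.2) =ᶠ[𝓝 p] fun q => ψ q.1 (e q).2 := by
    filter_upwards [(isOpen_totalSpace_preimage e.open_baseSet).mem_nhds hpe] with q hq
    have := e.symmL_continuousLinearMapAt (R := ℝ) hq q.2
    rw [Trivialization.continuousLinearMapAt_apply ℝ, e.coe_linearMapAt_of_mem hq] at this
    simp only [ψ, ContinuousLinearMap.comp_apply]
    exact congrArg (φ q.1) this.symm
  have e2 : mvfderiv (I.prod 𝓘(ℝ, F)) (fun q : TotalSpace F V => φ q.1 q.2) p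
      = mvfderiv (I.prod 𝓘(ℝ, F)) (fun q : TotalSpace F V => ψ q.1 (e q).2) p := e1.mfderiv_eq
  rw [e2, (mvfderiv_clm_apply hψπ hxi Y).2, mvfderiv_comp_proj hψ]
  have hext := mdifferentiableAt_extend (I := I) p
  have e3 : mvfderiv I ψ p.1 (projDeriv I p Y) (e p).2
      = mvfderiv I (fun y => φ y (FiberBundle.extend F p.2 y)) p.1 (projDeriv I p Y) := by
    have h1 := (mvfderiv_clm_apply hψ (mdifferentiableAt_const (c := (e p).2))
      (projDeriv I p Y)).2
    have h2 : (fun y => φ y (FiberBundle.extend F p.2 y)) =ᶠ[𝓝 p.1] fun y => ψ y (e p).2 := by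
      filter_upwards [e.open_baseSet.mem_nhds hpe] with y hy
      simp only [ψ, ContinuousLinearMap.comp_apply, e.symmL_apply hy]
      rfl
    have h3 : mvfderiv I (fun y => φ y (FiberBundle.extend F p.2 y)) p.1
      = mvfderiv I (fun y => ψ y (e p).2) p.1 := h2.mfderiv_eq
    rw [h3, h1, mvfderiv_const]
    simp
  have e4 := dualConnection_apply cov (projDeriv I p Y) hφ hext
  rw [FiberBundle.extend_apply_self] at e4
  rw [e3, e4]
  simp only [connForm, add_apply, ContinuousLinearMap.comp_apply, map_add, ψ, he]
  ring

theorem contMDiffOn_fibreFunction {φ : ∀ x, DualBundle V x} {U : Set M}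
    (hU : IsOpen U) (hφ : ContMDiffOn I (I.prod 𝓘(ℝ, F →L[ℝ] ℝ)) ∞
      (fun y => (⟨y, φ y⟩ : TotalSpace (F →L[ℝ] ℝ) (DualBundle V))) U) :
    ContMDiffOn (I.prod 𝓘(ℝ, F)) 𝓘(ℝ, ℝ) ∞ (fun q : TotalSpace F V => φ q.1 q.2) {q | q.1 ∈ U} :=
  fun q hq => ContMDiffAt.contMDiffWithinAt <| ContMDiffAt.dual_apply
    (b := fun q : TotalSpace F V => q.1) (v := fun q => q.2) ((hφ.contMDiffAt (hU.mem_nhds hq)).comp q (contMDiffAt_totalSpace_proj q)) contMDiffAt_id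

variable (cov : CovariantDerivative I F V)

/-- The vector field `s^v + u^h` on the total space: the vertical lift of the section `s` plus the
horizontal lift of the vector field `u`. -/
noncomputable def liftField (s : ∀ x, V x) (u : ∀ x : M, TangentSpace I x) (p : TotalSpace F V) :
    TotTangent I F V p :=
  vertical I p (s p.1) + horizontal cov p (u p.1)

@[simp]
theorem connForm_liftField (s : ∀ x, V x) (u : ∀ x : M, TangentSpace I x) (p : TotalSpace F V) :
    connForm cov p (liftField cov s u p) = s p.1 := by
  simp [liftField, connForm_vertical, connForm_horizontal]

@[simp]
theorem projDeriv_liftField (s : ∀ x, V x) (u : ∀ x : M, TangentSpace I x) (p : TotalSpace F V) :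
    projDeriv I p (liftField cov s u p) = u p.1 := by
  simp [liftField, projDeriv_vertical, projDeriv_horizontal]

end TotalSpace
section Along

variable {E : Type*} [NormedAddCommGroup E] [NormedSpace ℝ E]
  {H : Type*} [TopologicalSpace H] {I : ModelWithCorners ℝ E H}
  {M : Type*} [TopologicalSpace M] [ChartedSpace H M]
  {F₁ : Type*} [NormedAddCommGroup F₁] [NormedSpace ℝ F₁] [FiniteDimensional ℝ F₁]
  {V₁ : M → Type*} [∀ x, AddCommGroup (V₁ x)] [∀ x, Module ℝ (V₁ x)]
  [TopologicalSpace (TotalSpace F₁ V₁)] [∀ x, TopologicalSpace (V₁ x)]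
  [FiberBundle F₁ V₁] [VectorBundle ℝ F₁ V₁]
  {E' : Type*} [NormedAddCommGroup E'] [NormedSpace ℝ E']
  {H' : Type*} [TopologicalSpace H'] {I' : ModelWithCorners ℝ E' H'}
  {N : Type*} [TopologicalSpace N] [ChartedSpace H' N]
  {n : WithTop ℕ∞}

theorem contMDiffAt_of_dual {G : Type*} [NormedAddCommGroup G] [NormedSpace ℝ G]
    [FiniteDimensional ℝ G] {f : N → G} {m₀ : N}
    (h : ∀ ℓ : G →L[ℝ] ℝ, ContMDiffAt I' 𝓘(ℝ, ℝ) n (fun m => ℓ (f m)) m₀) :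
    ContMDiffAt I' 𝓘(ℝ, G) n f m₀ := by
  let b := Module.finBasis ℝ G
  have e : f = fun m => ∑ i, (LinearMap.toContinuousLinearMap (b.coord i)) (f m) • b i := by
    ext m
    exact (b.sum_repr (f m)).symm
  rw [e]
  exact ContMDiffAt.sum fun i _ =>
    (h _).smul (contMDiffAt_const (I := I') (I' := 𝓘(ℝ, G)) (c := b i))

/-- The local section of the dual bundle whose value is the functional `ℓ` in a trivialization. -/
noncomputable def constDual
    (e : Trivialization F₁ (TotalSpace.proj : TotalSpace F₁ V₁ → M)) [e.IsLinear ℝ]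
    (ℓ : F₁ →L[ℝ] ℝ) (y : M) : DualBundle V₁ y :=
  ℓ.comp (e.continuousLinearMapAt ℝ y)

theorem constDual_apply (e : Trivialization F₁ (TotalSpace.proj : TotalSpace F₁ V₁ → M))
    [e.IsLinear ℝ] (ℓ : F₁ →L[ℝ] ℝ) {y : M} (hy : y ∈ e.baseSet) (v : V₁ y) :
    constDual e ℓ y v = ℓ (e ⟨y, v⟩).2 := by
  simp only [constDual, ContinuousLinearMap.comp_apply]
  rw [Trivialization.continuousLinearMapAt_apply ℝ, e.coe_linearMapAt_of_mem hy]

theorem contMDiffOn_constDual [ContMDiffVectorBundle n F₁ V₁ I]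
    (e : Trivialization F₁ (TotalSpace.proj : TotalSpace F₁ V₁ → M)) [MemTrivializationAtlas e]
    (ℓ : F₁ →L[ℝ] ℝ) :
    ContMDiffOn I (I.prod 𝓘(ℝ, F₁ →L[ℝ] ℝ)) n
      (fun y => (⟨y, constDual e ℓ y⟩ : TotalSpace (F₁ →L[ℝ] ℝ) (DualBundle V₁))) e.baseSet := by
  refine contMDiffOn_dual_of_apply e.open_baseSet fun W hW hWo s hs => ?_
  have h1 : ContMDiffOn I 𝓘(ℝ, F₁) n (fun y => (e ⟨y, s y⟩).2) W :=
    fun y hy =>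
    ((e.contMDiffAt_section_iff (hW hy)).1 (hs.contMDiffAt (hWo.mem_nhds hy))).contMDiffWithinAt
  refine ((ContinuousLinearMap.contMDiff ℓ).comp_contMDiffOn h1).congr fun y hy => ?_
  exact constDual_apply e ℓ (hW hy) _

theorem contMDiffAt_along_of_dual [ContMDiffVectorBundle n F₁ V₁ I]
    {b : N → M} {v : ∀ m, V₁ (b m)} {m₀ : N} (hb : ContMDiffAt I' I n b m₀)
    (h : ∀ U, IsOpen U → b m₀ ∈ U → ∀ φ : ∀ x, DualBundle V₁ x,
      ContMDiffOn I (I.prod 𝓘(ℝ, F₁ →L[ℝ] ℝ)) n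
        (fun y => (⟨y, φ y⟩ : TotalSpace (F₁ →L[ℝ] ℝ) (DualBundle V₁))) U →
      ContMDiffAt I' 𝓘(ℝ, ℝ) n (fun m => φ (b m) (v m)) m₀) :
    ContMDiffAt I' (I.prod 𝓘(ℝ, F₁)) n (fun m => (⟨b m, v m⟩ : TotalSpace F₁ V₁)) m₀ := by
  rw [contMDiffAt_totalSpace]
  refine ⟨hb, contMDiffAt_of_dual fun ℓ => ?_⟩
  set e := trivializationAt F₁ V₁ (b m₀)
  have he : b m₀ ∈ e.baseSet := FiberBundle.mem_baseSet_trivializationAt' (b m₀)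
  refine (h _ e.open_baseSet he _ (contMDiffOn_constDual e ℓ)).congr_of_eventuallyEq ?_
  filter_upwards [hb.continuousAt (e.open_baseSet.mem_nhds he)] with y hy
  exact (constDual_apply e ℓ hy _).symm

end Along

section TotalSpace

variable {E : Type*} [NormedAddCommGroup E] [NormedSpace ℝ E] [FiniteDimensional ℝ E]
  {H : Type*} [TopologicalSpace H] {I : ModelWithCorners ℝ E H} [I.Boundaryless]
  {M : Type*} [TopologicalSpace M] [ChartedSpace H M] [IsManifold I ∞ M] [T2Space M]
  {F : Type*} [NormedAddCommGroup F] [NormedSpace ℝ F] [FiniteDimensional ℝ F]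
  {V : M → Type*} [∀ x, AddCommGroup (V x)] [∀ x, Module ℝ (V x)]
  [TopologicalSpace (TotalSpace F V)] [∀ x, TopologicalSpace (V x)]
  [∀ x, IsTopologicalAddGroup (V x)] [∀ x, ContinuousSMul ℝ (V x)]
  [FiberBundle F V] [VectorBundle ℝ F V] [ContMDiffVectorBundle ∞ F V I]

theorem contMDiffOn_projDeriv {Z : ∀ q : TotalSpace F V, TotTangent I F V q}
    {W : Set (TotalSpace F V)}
    (hZ : ContMDiffOn (I.prod 𝓘(ℝ, F)) ((I.prod 𝓘(ℝ, F)).prod 𝓘(ℝ, E × F)) ∞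
      (fun q => (⟨q, Z q⟩ : TangentBundle (I.prod 𝓘(ℝ, F)) (TotalSpace F V))) W) :
    ContMDiffOn (I.prod 𝓘(ℝ, F)) (I.prod 𝓘(ℝ, E)) ∞
      (fun q => (⟨q.1, projDeriv I q (Z q)⟩ : TangentBundle I M)) W := by
  have h : ContMDiff (I.prod 𝓘(ℝ, F)) I ∞ (TotalSpace.proj : TotalSpace F V → M) :=
    contMDiff_proj V
  exact (h.contMDiff_tangentMap (m := ∞) (by simp)).comp_contMDiffOn hZ

variable {cov : CovariantDerivative I F V}

theorem contMDiffOn_connForm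
    (hcov : CovariantDerivative.ContMDiffCovariantDerivative cov ∞)
    {Z : ∀ q : TotalSpace F V, TotTangent I F V q}
    {W : Set (TotalSpace F V)} (hW : IsOpen W)
    (hZ : ContMDiffOn (I.prod 𝓘(ℝ, F)) ((I.prod 𝓘(ℝ, F)).prod 𝓘(ℝ, E × F)) ∞
      (fun q => (⟨q, Z q⟩ : TangentBundle (I.prod 𝓘(ℝ, F)) (TotalSpace F V))) W) :
    ContMDiffOn (I.prod 𝓘(ℝ, F)) (I.prod 𝓘(ℝ, F)) ∞
      (fun q => (⟨q.1, connForm cov q (Z q)⟩ : TotalSpace F V)) W := by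
  intro p hp
  refine (contMDiffAt_along_of_dual (b := fun q : TotalSpace F V => q.1)
    (contMDiffAt_totalSpace_proj p) fun U hU hpU φ hφ => ?_).contMDiffWithinAt
  have hWU : IsOpen (W ∩ {q : TotalSpace F V | q.1 ∈ U}) :=
    hW.inter (isOpen_totalSpace_preimage hU)
  have hpW : p ∈ W ∩ {q : TotalSpace F V | q.1 ∈ U} := ⟨hp, hpU⟩
  have h1 := (contMDiffOn_mvfderiv_apply hWU ((contMDiffOn_fibreFunction hU hφ).mono
    inter_subset_right) (hZ.mono inter_subset_left)).contMDiffAt (hWU.mem_nhds hpW)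
  have h2 := (contMDiffOn_covariantDerivative (contMDiffCovariantDerivative_dualConnection hcov)
    hU hφ).contMDiffAt (hU.mem_nhds hpU)
  have h3 := (h2.comp p (contMDiffAt_totalSpace_proj p)).clm_bundle_apply
    (((contMDiffOn_projDeriv hZ).contMDiffAt (hW.mem_nhds hp)))
  have h4 := ContMDiffAt.dual_apply h3 (v := fun q : TotalSpace F V => q.2) contMDiffAt_id
  refine (h1.sub h4).congr_of_eventuallyEq ?_
  filter_upwards [hWU.mem_nhds hpW] with q hq
  have h5 := mvfderiv_fibreFunction cov ((hφ.contMDiffAt (hU.mem_nhds hq.2)).mdifferentiableAt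
    (by simp)) (Z q)
  exact eq_sub_of_add_eq h5.symm

theorem eventually_clm_mvfderiv_extChartAt {G : Type*} [NormedAddCommGroup G] [NormedSpace ℝ G]
    (Z : ∀ q : TotalSpace F V, TotTangent I F V q) (p : TotalSpace F V)
    (L : E × F →L[ℝ] G) {f : TotalSpace F V → G}
    (hf : ∀ᶠ q in 𝓝 p, f q = L (extChartAt I p.1 q.1, (trivializationAt F V p.1 q).2)) :
    ∀ᶠ q in 𝓝 p, L (mvfderiv (I.prod 𝓘(ℝ, F)) (extChartAt (I.prod 𝓘(ℝ, F)) p) q (Z q))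
      = mvfderiv (I.prod 𝓘(ℝ, F)) f q (Z q) := by
  set e := trivializationAt F V p.1 with he
  have hpe : p.1 ∈ e.baseSet := FiberBundle.mem_baseSet_trivializationAt' p.1
  have hchart : ∀ᶠ q in 𝓝 p, MDifferentiableAt (I.prod 𝓘(ℝ, F)) 𝓘(ℝ, E × F)
      (extChartAt (I.prod 𝓘(ℝ, F)) p) q :=
    Filter.Eventually.mono (extChartAt_source_mem_nhds (I := I.prod 𝓘(ℝ, F)) p) fun q hq =>
      mdifferentiableAt_extChartAt ((extChartAt_source (I.prod 𝓘(ℝ, F)) p).subset hq)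
  have heq : ∀ᶠ q in 𝓝 p, extChartAt (I.prod 𝓘(ℝ, F)) p q = (extChartAt I p.1 q.1, (e q).2) := by
    filter_upwards [(isOpen_totalSpace_preimage e.open_baseSet).mem_nhds hpe] with q hq
    rw [FiberBundle.extChartAt]
    exact congrArg (fun y => (extChartAt I p.1 y, (e q).2)) (e.coe_fst' hq)
  filter_upwards [hchart, hf.eventually_nhds, heq.eventually_nhds] with q hq hq1 hq2
  have h1 := (mvfderiv_clm_apply (mdifferentiableAt_const (c := L)) hq (Z q)).2
  rw [mvfderiv_const] at h1
  have h2 : f =ᶠ[𝓝 q] fun r => L (extChartAt (I.prod 𝓘(ℝ, F)) p r) := by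
    filter_upwards [hq1, hq2] with r hr hr'
    rw [hr, hr']
  have h3 : mvfderiv (I.prod 𝓘(ℝ, F)) f q
      = mvfderiv (I.prod 𝓘(ℝ, F)) (fun r => L (extChartAt (I.prod 𝓘(ℝ, F)) p r)) q := h2.mfderiv_eq
  rw [h3, h1]
  simp

theorem contMDiffOn_of_connForm_projDeriv
    (hcov : CovariantDerivative.ContMDiffCovariantDerivative cov ∞)
    {Z : ∀ q : TotalSpace F V, TotTangent I F V q}
    {W : Set (TotalSpace F V)} (hW : IsOpen W)
    (h₁ : ContMDiffOn (I.prod 𝓘(ℝ, F)) (I.prod 𝓘(ℝ, F)) ∞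
      (fun q => (⟨q.1, connForm cov q (Z q)⟩ : TotalSpace F V)) W)
    (h₂ : ContMDiffOn (I.prod 𝓘(ℝ, F)) (I.prod 𝓘(ℝ, E)) ∞
      (fun q => (⟨q.1, projDeriv I q (Z q)⟩ : TangentBundle I M)) W) :
    ContMDiffOn (I.prod 𝓘(ℝ, F)) ((I.prod 𝓘(ℝ, F)).prod 𝓘(ℝ, E × F)) ∞
      (fun q => (⟨q, Z q⟩ : TangentBundle (I.prod 𝓘(ℝ, F)) (TotalSpace F V))) W := by
  intro p hp
  refine ContMDiffAt.contMDiffWithinAt ?_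
  rw [contMDiffAt_vectorField_iff]
  set e := trivializationAt F V p.1 with he
  have hpe : p.1 ∈ e.baseSet := FiberBundle.mem_baseSet_trivializationAt' p.1
  have hbase : ∀ᶠ q : TotalSpace F V in 𝓝 p, q.1 ∈ (extChartAt I p.1).source :=
    (contMDiffAt_totalSpace_proj (I := I) p).continuousAt (extChartAt_source_mem_nhds (I := I) p.1)
  have hbase' : ∀ᶠ q : TotalSpace F V in 𝓝 p, q.1 ∈ e.baseSet :=
    (isOpen_totalSpace_preimage e.open_baseSet).mem_nhds hpe
  refine (contMDiffAt_prod_module_iff _).2 ⟨?_, contMDiffAt_of_dual fun ℓ => ?_⟩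
  · have h3 := (contMDiffAt_totalSpace.1 (h₂.contMDiffAt (hW.mem_nhds hp))).2
    refine h3.congr_of_eventuallyEq ?_
    filter_upwards [eventually_clm_mvfderiv_extChartAt Z p (ContinuousLinearMap.fst ℝ E F) (f := fun q => extChartAt I p.1 q.1)
      (Filter.Eventually.of_forall fun q => rfl), hbase] with q hq hq'
    refine hq.trans ?_
    rw [mvfderiv_comp_proj (mdifferentiableAt_extChartAt
      (by simpa [extChartAt_source] using hq'))]
    exact (trivializationAt_tangentSpace_snd (by simpa [extChartAt_source] using hq') _).symm
  · have hφ := contMDiffOn_constDual (I := I) (n := ∞) e ℓ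
    have h2 := (contMDiffOn_covariantDerivative (contMDiffCovariantDerivative_dualConnection hcov)
      e.open_baseSet hφ).contMDiffAt (e.open_baseSet.mem_nhds hpe)
    have h3 := (h2.comp p (contMDiffAt_totalSpace_proj p)).clm_bundle_apply
      (h₂.contMDiffAt (hW.mem_nhds hp))
    have h4 := ContMDiffAt.dual_apply h3 (v := fun q : TotalSpace F V => q.2) contMDiffAt_id
    have h5 := ContMDiffAt.dual_apply
      ((hφ.contMDiffAt (e.open_baseSet.mem_nhds hpe)).comp p (contMDiffAt_totalSpace_proj p))
      (h₁.contMDiffAt (hW.mem_nhds hp))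
    refine (h5.add h4).congr_of_eventuallyEq ?_
    filter_upwards [eventually_clm_mvfderiv_extChartAt Z p (ℓ.comp (ContinuousLinearMap.snd ℝ E F))
      (f := fun q => constDual e ℓ q.1 q.2)
      (hbase'.mono fun q hq => constDual_apply e ℓ hq _), hbase'] with q hq hq'
    refine hq.trans ?_
    rw [mvfderiv_fibreFunction cov ((hφ.contMDiffAt (e.open_baseSet.mem_nhds hq')).mdifferentiableAt
      (by simp))]
    rfl

end TotalSpace
section Sections

variable {E : Type*} [NormedAddCommGroup E] [NormedSpace ℝ E]
  {H : Type*} [TopologicalSpace H] {I : ModelWithCorners ℝ E H}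
  {M : Type*} [TopologicalSpace M] [ChartedSpace H M]
  {F : Type*} [NormedAddCommGroup F] [NormedSpace ℝ F]
  {V : M → Type*} [∀ x, AddCommGroup (V x)] [∀ x, Module ℝ (V x)]
  [TopologicalSpace (TotalSpace F V)] [∀ x, TopologicalSpace (V x)]
  [∀ x, IsTopologicalAddGroup (V x)] [∀ x, ContinuousSMul ℝ (V x)]
  [FiberBundle F V] [VectorBundle ℝ F V]
  {E' : Type*} [NormedAddCommGroup E'] [NormedSpace ℝ E']
  {H' : Type*} [TopologicalSpace H'] {I' : ModelWithCorners ℝ E' H'}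
  {N : Type*} [TopologicalSpace N] [ChartedSpace H' N]
  {n : WithTop ℕ∞}

theorem contMDiffAt_genSection {b : N → M} {a : ∀ m, GenBundle V (b m)} {m₀ : N} :
    ContMDiffAt I' (I.prod 𝓘(ℝ, F × (F →L[ℝ] ℝ))) n
        (fun m => (⟨b m, a m⟩ : TotalSpace (F × (F →L[ℝ] ℝ)) (GenBundle V))) m₀ ↔
      ContMDiffAt I' (I.prod 𝓘(ℝ, F)) n (fun m => (⟨b m, (a m).1⟩ : TotalSpace F V)) m₀ ∧
      ContMDiffAt I' (I.prod 𝓘(ℝ, F →L[ℝ] ℝ)) n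
        (fun m => (⟨b m, (a m).2⟩ : TotalSpace (F →L[ℝ] ℝ) (DualBundle V))) m₀ :=
  contMDiffAt_prodSection (V₁ := V) (V₂ := DualBundle V) (v := fun m => (a m).1)
    (w := fun m => (a m).2)

theorem smoothGenSectionOn_iff {a : ∀ x, GenBundle V x} {U : Set M} (hU : IsOpen U) :
    SmoothGenSectionOn I F a U ↔
      ContMDiffOn I (I.prod 𝓘(ℝ, F)) ∞ (fun x => (⟨x, (a x).1⟩ : TotalSpace F V)) U ∧
      ContMDiffOn I (I.prod 𝓘(ℝ, F →L[ℝ] ℝ)) ∞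
        (fun x => (⟨x, (a x).2⟩ : TotalSpace (F →L[ℝ] ℝ) (DualBundle V))) U :=
  ⟨fun h => ⟨fun _ hx => (contMDiffAt_genSection.1
      (h.contMDiffAt (hU.mem_nhds hx))).1.contMDiffWithinAt,
    fun _ hx => (contMDiffAt_genSection.1 (h.contMDiffAt (hU.mem_nhds hx))).2.contMDiffWithinAt⟩,
  fun h _ hx => (contMDiffAt_genSection.2 ⟨h.1.contMDiffAt (hU.mem_nhds hx),
    h.2.contMDiffAt (hU.mem_nhds hx)⟩).contMDiffWithinAt⟩

theorem contMDiffAt_sumSection [IsManifold I ∞ M] {b : N → M} {a : ∀ m, SumTangent I V (b m)}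
    {m₀ : N} :
    ContMDiffAt I' (I.prod 𝓘(ℝ, F × E)) n
        (fun m => (⟨b m, a m⟩ : TotalSpace (F × E) (SumTangent I V))) m₀ ↔
      ContMDiffAt I' (I.prod 𝓘(ℝ, F)) n (fun m => (⟨b m, (a m).1⟩ : TotalSpace F V)) m₀ ∧
      ContMDiffAt I' (I.prod 𝓘(ℝ, E)) n (fun m => (⟨b m, (a m).2⟩ : TangentBundle I M)) m₀ :=
  contMDiffAt_prodSection (V₁ := V) (V₂ := (TangentSpace I : M → Type _))
    (v := fun m => (a m).1) (w := fun m => (a m).2)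

end Sections

section Lift

variable {E : Type*} [NormedAddCommGroup E] [NormedSpace ℝ E] [FiniteDimensional ℝ E]
  {H : Type*} [TopologicalSpace H] {I : ModelWithCorners ℝ E H} [I.Boundaryless]
  {M : Type*} [TopologicalSpace M] [ChartedSpace H M] [IsManifold I ∞ M] [T2Space M]
  {F : Type*} [NormedAddCommGroup F] [NormedSpace ℝ F] [FiniteDimensional ℝ F]
  {V : M → Type*} [∀ x, AddCommGroup (V x)] [∀ x, Module ℝ (V x)]
  [TopologicalSpace (TotalSpace F V)] [∀ x, TopologicalSpace (V x)]
  [∀ x, IsTopologicalAddGroup (V x)] [∀ x, ContinuousSMul ℝ (V x)]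
  [FiberBundle F V] [VectorBundle ℝ F V] [ContMDiffVectorBundle ∞ F V I]
  {cov : CovariantDerivative I F V}

theorem contMDiffOn_liftField (hcov : CovariantDerivative.ContMDiffCovariantDerivative cov ∞)
    {s : ∀ x, V x} {u : ∀ x : M, TangentSpace I x} {U : Set M} (hU : IsOpen U)
    (hs : ContMDiffOn I (I.prod 𝓘(ℝ, F)) ∞ (fun y => (⟨y, s y⟩ : TotalSpace F V)) U)
    (hu : ContMDiffOn I (I.prod 𝓘(ℝ, E)) ∞ (fun y => (⟨y, u y⟩ : TangentBundle I M)) U) :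
    ContMDiffOn (I.prod 𝓘(ℝ, F)) ((I.prod 𝓘(ℝ, F)).prod 𝓘(ℝ, E × F)) ∞
      (fun q => (⟨q, liftField cov s u q⟩ : TangentBundle (I.prod 𝓘(ℝ, F)) (TotalSpace F V)))
      {q | q.1 ∈ U} := by
  have hπ : ContMDiff (I.prod 𝓘(ℝ, F)) I ∞ (TotalSpace.proj : TotalSpace F V → M) :=
    contMDiff_proj V
  refine contMDiffOn_of_connForm_projDeriv hcov (isOpen_totalSpace_preimage hU) ?_ ?_
  · simp only [connForm_liftField]
    exact hs.comp hπ.contMDiffOn fun q hq => hq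
  · simp only [projDeriv_liftField]
    exact hu.comp hπ.contMDiffOn fun q hq => hq

theorem contMDiffOn_splitting (hcov : CovariantDerivative.ContMDiffCovariantDerivative cov ∞)
    {a : ∀ q : TotalSpace F V, GenBundle (TotTangent I F V) q} {W : Set (TotalSpace F V)}
    (hW : IsOpen W) (ha : SmoothGenSectionOn (I.prod 𝓘(ℝ, F)) (E × F) a W) :
    ContMDiffOn (I.prod 𝓘(ℝ, F)) (I.prod 𝓘(ℝ, (F × E) × (F × E →L[ℝ] ℝ))) ∞
      (fun q => (⟨q.1, splitting cov q (a q)⟩ :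
        TotalSpace ((F × E) × (F × E →L[ℝ] ℝ)) (GenBundle (SumTangent I V)))) W := by
  intro p hp
  refine ContMDiffAt.contMDiffWithinAt ?_
  have ha1 : ContMDiffOn (I.prod 𝓘(ℝ, F)) ((I.prod 𝓘(ℝ, F)).prod 𝓘(ℝ, E × F)) ∞
      (fun q => (⟨q, (a q).1⟩ : TangentBundle (I.prod 𝓘(ℝ, F)) (TotalSpace F V))) W :=
    ((smoothGenSectionOn_iff hW).1 ha).1
  refine contMDiffAt_genSection.2 ⟨contMDiffAt_sumSection.2
    ⟨(contMDiffOn_connForm hcov hW ha1).contMDiffAt (hW.mem_nhds hp),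
      (contMDiffOn_projDeriv ha1).contMDiffAt (hW.mem_nhds hp)⟩, ?_⟩
  refine contMDiffAt_hom_of_apply (V₂ := Bundle.Trivial M ℝ) (b := fun q : TotalSpace F V => q.1)
    (contMDiffAt_totalSpace_proj p) fun ξ => ?_
  refine (contMDiffAt_trivialSection (contMDiffAt_totalSpace_proj p)).2 ?_
  set e := trivializationAt (F × E) (SumTangent I V) p.1
  have hpe : p.1 ∈ e.baseSet := FiberBundle.mem_baseSet_trivializationAt' p.1
  have hσ := contMDiffOn_symm (I := I) (n := ∞) e ξ
  have hσp (x) (hx : x ∈ e.baseSet) := contMDiffAt_sumSection.1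
    (hσ.contMDiffAt (e.open_baseSet.mem_nhds hx))
  have hl := contMDiffOn_liftField (s := fun y => (e.symm y ξ).1) (u := fun y => (e.symm y ξ).2)
    hcov e.open_baseSet (fun x hx => (hσp x hx).1.contMDiffWithinAt)
    (fun x hx => (hσp x hx).2.contMDiffWithinAt)
  have h := ContMDiffAt.dual_apply (((smoothGenSectionOn_iff hW).1 ha).2.contMDiffAt (hW.mem_nhds hp))
    (hl.contMDiffAt ((isOpen_totalSpace_preimage e.open_baseSet).mem_nhds hpe))
  exact h

theorem smoothGenSectionOn_splitting_symm
    (hcov : CovariantDerivative.ContMDiffCovariantDerivative cov ∞)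
    {c : ∀ q : TotalSpace F V, GenBundle (SumTangent I V) q.1} {W : Set (TotalSpace F V)}
    (hW : IsOpen W)
    (hc : ContMDiffOn (I.prod 𝓘(ℝ, F)) (I.prod 𝓘(ℝ, (F × E) × (F × E →L[ℝ] ℝ))) ∞
      (fun q => (⟨q.1, c q⟩ :
        TotalSpace ((F × E) × (F × E →L[ℝ] ℝ)) (GenBundle (SumTangent I V)))) W) :
    SmoothGenSectionOn (I.prod 𝓘(ℝ, F)) (E × F) (fun q => (splitting cov q).symm (c q)) W := by
  have hcp (q) (hq : q ∈ W) := contMDiffAt_genSection.1 (hc.contMDiffAt (hW.mem_nhds hq))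
  have hcq (q) (hq : q ∈ W) := contMDiffAt_sumSection.1 (hcp q hq).1
  have h1 : ContMDiffOn (I.prod 𝓘(ℝ, F)) ((I.prod 𝓘(ℝ, F)).prod 𝓘(ℝ, E × F)) ∞
      (fun q => (⟨q, ((splitting cov q).symm (c q)).1⟩ :
        TangentBundle (I.prod 𝓘(ℝ, F)) (TotalSpace F V))) W := by
    refine contMDiffOn_of_connForm_projDeriv hcov hW ?_ ?_
    · have e (q : TotalSpace F V) : connForm cov q ((splitting cov q).symm (c q)).1 = (c q).1.1 :=
        congrArg (fun z => z.1.1) ((splitting cov q).apply_symm_apply (c q))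
      simp only [e]
      exact fun q hq => (hcq q hq).1.contMDiffWithinAt
    · have e (q : TotalSpace F V) : projDeriv I q ((splitting cov q).symm (c q)).1 = (c q).1.2 :=
        congrArg (fun z => z.1.2) ((splitting cov q).apply_symm_apply (c q))
      simp only [e]
      exact fun q hq => (hcq q hq).2.contMDiffWithinAt
  have h2 : ContMDiffOn (I.prod 𝓘(ℝ, F)) ((I.prod 𝓘(ℝ, F)).prod 𝓘(ℝ, E × F →L[ℝ] ℝ)) ∞
      (fun q => (⟨q, ((splitting cov q).symm (c q)).2⟩ :
        TotalSpace (E × F →L[ℝ] ℝ) (DualBundle (TotTangent I F V)))) W := by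
    refine contMDiffOn_dual_of_apply hW fun W' hW' hWo Z hZ => fun p hp => ?_
    have h3 : ContMDiffAt (I.prod 𝓘(ℝ, F)) (I.prod 𝓘(ℝ, F × E)) ∞
        (fun q => (⟨q.1, (connForm cov q (Z q), projDeriv I q (Z q))⟩ :
          TotalSpace (F × E) (SumTangent I V))) p :=
      contMDiffAt_sumSection.2
        ⟨(contMDiffOn_connForm hcov hWo hZ).contMDiffAt (hWo.mem_nhds hp),
          (contMDiffOn_projDeriv hZ).contMDiffAt (hWo.mem_nhds hp)⟩
    exact (ContMDiffAt.dual_apply (hcp p (hW' hp)).2 h3).contMDiffWithinAt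
  exact (smoothGenSectionOn_iff hW).2 ⟨h1, h2⟩

theorem smoothGenSectionOn_splitting_symm_comp_proj
    (hcov : CovariantDerivative.ContMDiffCovariantDerivative cov ∞)
    {c : ∀ x, GenBundle (SumTangent I V) x} {U : Set M} (hU : IsOpen U)
    (hc : SmoothGenSectionOn I (F × E) c U) :
    SmoothGenSectionOn (I.prod 𝓘(ℝ, F)) (E × F) (fun q => (splitting cov q).symm (c q.1))
      {q | q.1 ∈ U} := by
  have hπ : ContMDiff (I.prod 𝓘(ℝ, F)) I ∞ (TotalSpace.proj : TotalSpace F V → M) :=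
    contMDiff_proj V
  exact smoothGenSectionOn_splitting_symm hcov (c := fun q => c q.1) (isOpen_totalSpace_preimage hU)
    (hc.comp hπ.contMDiffOn fun q hq => hq)

theorem pairing_splitting (p : TotalSpace F V) (a b : GenBundle (TotTangent I F V) p) :
    pairing (splitting cov p a) (splitting cov p b) = pairing a b := by
  have h (a b : GenBundle (TotTangent I F V) p) :
      (splitting cov p a).2 (splitting cov p b).1 = a.2 b.1 :=
    congrArg a.2 (vertical_add_horizontal cov p b.1)
  simp only [pairing, h]

theorem pairing_splitting_symm (p : TotalSpace F V) (a b : GenBundle (SumTangent I V) p.1) :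
    pairing ((splitting cov p).symm a) ((splitting cov p).symm b) = pairing a b := by
  simpa using (pairing_splitting (cov := cov) p ((splitting cov p).symm a)
    ((splitting cov p).symm b)).symm

theorem lift_apply (K : GenEnd (SumTangent I V)) (p : TotalSpace F V)
    (a : GenBundle (TotTangent I F V) p) :
    lift cov K p a = (splitting cov p).symm (K p.1 (splitting cov p a)) := rfl

theorem IsGenAlmostComplex.lift (hcov : CovariantDerivative.ContMDiffCovariantDerivative cov ∞)
    {K : GenEnd (SumTangent I V)} (hK : IsGenAlmostComplex I (F × E) K) :
    IsGenAlmostComplex (I.prod 𝓘(ℝ, F)) (E × F) (lift cov K) where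
  smooth := contMDiff_totalSpace_of_apply (A := GenGeom.lift cov K) fun W hW s hs =>
    smoothGenSectionOn_splitting_symm hcov hW
      (hK.smooth.comp_contMDiffOn (contMDiffOn_splitting hcov hW hs))
  orthogonal p a b := by
    rw [lift_apply, lift_apply, pairing_splitting_symm, hK.orthogonal, pairing_splitting]
  sq_eq_neg_one p a := by
    rw [lift_apply, lift_apply, LinearEquiv.apply_symm_apply, hK.sq_eq_neg_one, map_neg,
      LinearEquiv.symm_apply_apply]

theorem lift_injective : Function.Injective (lift cov : GenEnd (SumTangent I V) → _) := by
  intro K K' h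
  funext x
  refine LinearMap.ext fun a => ?_
  have h1 := congrArg (fun J : GenEnd (TotTangent I F V) =>
    J ⟨x, 0⟩ ((splitting cov ⟨x, 0⟩).symm a)) h
  simp only [lift_apply, LinearEquiv.apply_symm_apply] at h1
  exact (splitting cov ⟨x, 0⟩).symm.injective h1

end Lift
section Smoothness

variable {E : Type*} [NormedAddCommGroup E] [NormedSpace ℝ E]
  {H : Type*} [TopologicalSpace H] (I : ModelWithCorners ℝ E H)
  {M : Type*} [TopologicalSpace M] [ChartedSpace H M]

/-- `s` restricts to a smooth section of the vector bundle `V` over `U`. -/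
abbrev SmoothSectionOn (F : Type*) [NormedAddCommGroup F] [NormedSpace ℝ F]
    {V : M → Type*} [TopologicalSpace (TotalSpace F V)] [∀ x, TopologicalSpace (V x)]
    [FiberBundle F V] (s : ∀ x, V x) (U : Set M) : Prop :=
  ContMDiffOn I (I.prod 𝓘(ℝ, F)) ∞ (fun x => (⟨x, s x⟩ : TotalSpace F V)) U

/-- `X` restricts to a smooth vector field on `U`. -/
abbrev SmoothFieldOn [IsManifold I ∞ M] (X : ∀ x : M, TangentSpace I x) (U : Set M) : Prop :=
  ContMDiffOn I (I.prod 𝓘(ℝ, E)) ∞ (fun x => (⟨x, X x⟩ : TangentBundle I M)) U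

end Smoothness

section Manifold

variable {E : Type*} [NormedAddCommGroup E] [NormedSpace ℝ E] [FiniteDimensional ℝ E]
  {H : Type*} [TopologicalSpace H] {I : ModelWithCorners ℝ E H} [I.Boundaryless]
  {N : Type*} [TopologicalSpace N] [ChartedSpace H N] [IsManifold I ∞ N]
  {G : Type*} [NormedAddCommGroup G] [NormedSpace ℝ G]

theorem mvfderiv_mlieBracket_of_smooth {f : N → G} {X Y : ∀ q : N, TangentSpace I q} {U : Set N}
    (hU : IsOpen U) (hf : ContMDiffOn I 𝓘(ℝ, G) ∞ f U) (hX : SmoothFieldOn I X U)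
    (hY : SmoothFieldOn I Y U) {p : N} (hp : p ∈ U) :
    mvfderiv I f p (mlieBracket I X Y p)
      = mvfderiv I (fun q => mvfderiv I f q (Y q)) p (X p)
        - mvfderiv I (fun q => mvfderiv I f q (X q)) p (Y p) := by
  have hn := hU.mem_nhds hp
  exact mvfderiv_mlieBracket ((hf.contMDiffAt hn).of_le ENat.LEInfty.out)
    ((hX.contMDiffAt hn).mdifferentiableAt (by simp))
    ((hY.contMDiffAt hn).mdifferentiableAt (by simp))
    (((contMDiffOn_mvfderiv_apply hU hf hX).contMDiffAt hn).mdifferentiableAt (by simp))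
    (((contMDiffOn_mvfderiv_apply hU hf hY).contMDiffAt hn).mdifferentiableAt (by simp))

theorem mvfderiv_extChartAt_injective (x : N) :
    Function.Injective (mvfderiv I (extChartAt I x) x : TangentSpace I x → E) := by
  intro u v h
  have a := mfderivWithin_extChartAt_symm_comp_mfderiv_extChartAt (I := I) (x := x)
    (mem_extChartAt_target x)
  rw [extChartAt_to_inv] at a
  have hu := congrArg (fun L : E →L[ℝ] E => L u) a
  have hv := congrArg (fun L : E →L[ℝ] E => L v) a
  refine hu.symm.trans (Eq.trans ?_ hv)
  exact congrArg (mfderivWithin 𝓘(ℝ, E) I (extChartAt I x).symm (range I) (extChartAt I x x)) h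

theorem mvfderiv_congr_on {f g : N → G} {U : Set N} (hU : IsOpen U) (h : ∀ q ∈ U, f q = g q)
    {p : N} (hp : p ∈ U) : mvfderiv I f p = mvfderiv I g p :=
  (Filter.eventuallyEq_of_mem (hU.mem_nhds hp) h : f =ᶠ[𝓝 p] g).mfderiv_eq

end Manifold

section Lift

variable {E : Type*} [NormedAddCommGroup E] [NormedSpace ℝ E] [FiniteDimensional ℝ E]
  {H : Type*} [TopologicalSpace H] {I : ModelWithCorners ℝ E H} [I.Boundaryless]
  {M : Type*} [TopologicalSpace M] [ChartedSpace H M] [IsManifold I ∞ M] [T2Space M]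
  {F : Type*} [NormedAddCommGroup F] [NormedSpace ℝ F] [FiniteDimensional ℝ F]
  {V : M → Type*} [∀ x, AddCommGroup (V x)] [∀ x, Module ℝ (V x)]
  [TopologicalSpace (TotalSpace F V)] [∀ x, TopologicalSpace (V x)]
  [∀ x, IsTopologicalAddGroup (V x)] [∀ x, ContinuousSMul ℝ (V x)]
  [FiberBundle F V] [VectorBundle ℝ F V] [ContMDiffVectorBundle ∞ F V I]
  {cov : CovariantDerivative I F V}

theorem projDeriv_mlieBracket_liftField
    (hcov : CovariantDerivative.ContMDiffCovariantDerivative cov ∞)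
    {s t : ∀ x, V x} {u w : ∀ x : M, TangentSpace I x} {U : Set M} (hU : IsOpen U)
    (hs : SmoothSectionOn I F s U) (hu : SmoothFieldOn I u U)
    (ht : SmoothSectionOn I F t U) (hw : SmoothFieldOn I w U)
    {p : TotalSpace F V} (hp : p.1 ∈ U) :
    projDeriv I p (mlieBracket (I.prod 𝓘(ℝ, F)) (liftField cov s u) (liftField cov t w) p)
      = mlieBracket I u w p.1 := by
  apply mvfderiv_extChartAt_injective
  set W := U ∩ (extChartAt I p.1).source
  have hW : IsOpen W := hU.inter (isOpen_extChartAt_source p.1)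
  have hpW : p.1 ∈ W := ⟨hp, mem_extChartAt_source p.1⟩
  set f := extChartAt I p.1
  have hf : ContMDiffOn I 𝓘(ℝ, E) ∞ f W :=
    (contMDiffOn_extChartAt (x := p.1)).mono fun q hq => by
      have := hq.2
      rwa [extChartAt_source] at this
  have hfd (q) (hq : q ∈ W) : MDifferentiableAt I 𝓘(ℝ, E) f q :=
    (hf.contMDiffAt (hW.mem_nhds hq)).mdifferentiableAt (by simp)
  have hW' : IsOpen {q : TotalSpace F V | q.1 ∈ W} := isOpen_totalSpace_preimage hW
  have hπ : ContMDiff (I.prod 𝓘(ℝ, F)) I ∞ (TotalSpace.proj : TotalSpace F V → M) :=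
    contMDiff_proj V
  have hfπ : ContMDiffOn (I.prod 𝓘(ℝ, F)) 𝓘(ℝ, E) ∞ (fun q : TotalSpace F V => f q.1)
      {q | q.1 ∈ W} := hf.comp hπ.contMDiffOn fun q hq => hq
  have key (s t : ∀ x, V x) (u w : ∀ x : M, TangentSpace I x) (hw : SmoothFieldOn I w W) :
      mvfderiv (I.prod 𝓘(ℝ, F)) (fun q => mvfderiv (I.prod 𝓘(ℝ, F))
          (fun q : TotalSpace F V => f q.1) q (liftField cov t w q)) p (liftField cov s u p)
        = mvfderiv I (fun y => mvfderiv I f y (w y)) p.1 (u p.1) := by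
    rw [mvfderiv_congr_on hW' (g := fun q => (fun y => mvfderiv I f y (w y)) q.1)
      (fun q hq => ?_) hpW, mvfderiv_comp_proj
        (((contMDiffOn_mvfderiv_apply hW hf hw).contMDiffAt
          (hW.mem_nhds hpW)).mdifferentiableAt (by simp)), projDeriv_liftField]
    rw [mvfderiv_comp_proj (hfd q.1 hq), projDeriv_liftField]
  have hUW : W ⊆ U := inter_subset_left
  rw [mvfderiv_mlieBracket_of_smooth hW hf (hu.mono hUW) (hw.mono hUW) hpW,
    ← mvfderiv_comp_proj (hfd _ hpW),
    mvfderiv_mlieBracket_of_smooth hW' hfπ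
      (contMDiffOn_liftField hcov hW (hs.mono hUW) (hu.mono hUW))
      (contMDiffOn_liftField hcov hW (ht.mono hUW) (hw.mono hUW)) hpW,
    key s t u w (hw.mono hUW), key t s w u (hu.mono hUW)]

theorem eq_of_constDual {x : M} {v w : V x}
    (h : ∀ ℓ : F →L[ℝ] ℝ, constDual (trivializationAt F V x) ℓ x v
      = constDual (trivializationAt F V x) ℓ x w) : v = w := by
  have hx : x ∈ (trivializationAt F V x).baseSet := FiberBundle.mem_baseSet_trivializationAt' x
  have h1 : (trivializationAt F V x).continuousLinearMapAt ℝ x v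
      = (trivializationAt F V x).continuousLinearMapAt ℝ x w := by
    by_contra hne
    obtain ⟨ℓ, hℓ⟩ := SeparatingDual.exists_separating_of_ne (R := ℝ) hne
    exact hℓ (h ℓ)
  have h2 := congrArg ((trivializationAt F V x).symmL ℝ x) h1
  rwa [Trivialization.symmL_continuousLinearMapAt _ hx,
    Trivialization.symmL_continuousLinearMapAt _ hx] at h2

theorem connForm_mlieBracket_liftField (hflat : IsFlat cov)
    {s t : ∀ x, V x} {u w : ∀ x : M, TangentSpace I x} {U : Set M} (hU : IsOpen U)
    (hs : SmoothSectionOn I F s U) (hu : SmoothFieldOn I u U)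
    (ht : SmoothSectionOn I F t U) (hw : SmoothFieldOn I w U)
    {p : TotalSpace F V} (hp : p.1 ∈ U) :
    connForm cov p (mlieBracket (I.prod 𝓘(ℝ, F)) (liftField cov s u) (liftField cov t w) p)
      = cov t p.1 (u p.1) - cov s p.1 (w p.1) := by
  have hcov := hflat.smooth
  refine eq_of_constDual (F := F) fun ℓ => ?_
  set e := trivializationAt F V p.1
  set φ := constDual e ℓ with hφ_def
  set W := U ∩ e.baseSet
  have hW : IsOpen W := hU.inter e.open_baseSet
  have hpW : p.1 ∈ W := ⟨hp, FiberBundle.mem_baseSet_trivializationAt' p.1⟩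
  have hUW : W ⊆ U := inter_subset_left
  have hφ : SmoothSectionOn I (F →L[ℝ] ℝ) φ W :=
    (contMDiffOn_constDual (I := I) (n := ∞) e ℓ).mono inter_subset_right
  have hd {φ : ∀ x, DualBundle V x} (hφ : SmoothSectionOn I (F →L[ℝ] ℝ) φ W) (q) (hq : q ∈ W) :
      MDifferentiableAt I (I.prod 𝓘(ℝ, F →L[ℝ] ℝ))
        (fun y => (⟨y, φ y⟩ : TotalSpace (F →L[ℝ] ℝ) (DualBundle V))) q :=
    (hφ.contMDiffAt (hW.mem_nhds hq)).mdifferentiableAt (by simp)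
  have hds {s : ∀ x, V x} (hs : SmoothSectionOn I F s U) :
      MDifferentiableAt I (I.prod 𝓘(ℝ, F)) (fun y => (⟨y, s y⟩ : TotalSpace F V)) p.1 :=
    (hs.contMDiffAt (hU.mem_nhds hp)).mdifferentiableAt (by simp)
  have hW' : IsOpen {q : TotalSpace F V | q.1 ∈ W} := isOpen_totalSpace_preimage hW
  have hflat' := hflat.dualConnection
  have hφw {w : ∀ x : M, TangentSpace I x} (hw : SmoothFieldOn I w U) :
      SmoothSectionOn I (F →L[ℝ] ℝ) (fun y => dualConnection cov φ y (w y)) W :=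
    contMDiffOn_covariantDerivative_apply hflat'.smooth hW hφ (hw.mono hUW)
  have key {s t : ∀ x, V x} {u w : ∀ x : M, TangentSpace I x} (ht : SmoothSectionOn I F t U)
      (hw : SmoothFieldOn I w U) :
      mvfderiv (I.prod 𝓘(ℝ, F)) (fun q => mvfderiv (I.prod 𝓘(ℝ, F))
          (fun q : TotalSpace F V => φ q.1 q.2) q (liftField cov t w q)) p (liftField cov s u p)
        = mvfderiv I (fun y => φ y (t y)) p.1 (u p.1) + (dualConnection cov φ p.1 (w p.1) (s p.1)
          + dualConnection cov (fun y => dualConnection cov φ y (w y)) p.1 (u p.1) p.2) := by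
    have h1 : MDifferentiableAt I 𝓘(ℝ, ℝ) (fun y => φ y (t y)) p.1 :=
      mdifferentiableAt_dual_apply (hd hφ _ hpW) (hds ht)
    have h1' : MDifferentiableAt (I.prod 𝓘(ℝ, F)) 𝓘(ℝ, ℝ)
        (fun q : TotalSpace F V => φ q.1 (t q.1)) p :=
      h1.comp p ((contMDiffAt_totalSpace_proj p).mdifferentiableAt (by simp))
    have h2 : MDifferentiableAt (I.prod 𝓘(ℝ, F)) 𝓘(ℝ, ℝ)
        (fun q : TotalSpace F V => dualConnection cov φ q.1 (w q.1) q.2) p :=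
      ((contMDiffOn_fibreFunction hW (hφw hw)).contMDiffAt
        (hW'.mem_nhds hpW)).mdifferentiableAt (by simp)
    rw [mvfderiv_congr_on hW' (g := (fun q : TotalSpace F V => φ q.1 (t q.1))
      + fun q : TotalSpace F V => dualConnection cov φ q.1 (w q.1) q.2)
      (fun q hq => ?_) hpW, mvfderiv_add h1' h2, add_apply,
      mvfderiv_comp_proj (f := fun y => φ y (t y)) h1,
      mvfderiv_fibreFunction cov (hd (hφw hw) _ hpW), connForm_liftField, projDeriv_liftField]
    rw [mvfderiv_fibreFunction cov (hd hφ _ hq), connForm_liftField, projDeriv_liftField]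
    rfl
  have h1 := mvfderiv_mlieBracket_of_smooth hW' (contMDiffOn_fibreFunction hW hφ)
      (contMDiffOn_liftField hcov hW (hs.mono hUW) (hu.mono hUW))
      (contMDiffOn_liftField hcov hW (ht.mono hUW) (hw.mono hUW)) hpW
  rw [key ht hw, key hs hu, mvfderiv_fibreFunction cov (hd hφ _ hpW),
    projDeriv_mlieBracket_liftField hcov hU hs hu ht hw hp] at h1
  have h2 := congrArg (fun L : DualBundle V p.1 => L p.2)
    (hflat'.curvature_eq_zero W hW u w φ (hu.mono hUW) (hw.mono hUW) hφ p.1 hpW)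
  simp only [sub_apply, zero_apply] at h2
  have h3 := dualConnection_apply cov (u p.1) (hd hφ _ hpW) (hds ht)
  have h4 := dualConnection_apply cov (w p.1) (hd hφ _ hpW) (hds hs)
  rw [map_sub]
  linarith

end Lift
section LieDeriv

variable {E : Type*} [NormedAddCommGroup E] [NormedSpace ℝ E] [FiniteDimensional ℝ E]
  {H : Type*} [TopologicalSpace H] {I : ModelWithCorners ℝ E H}
  {N : Type*} [TopologicalSpace N] [ChartedSpace H N] [IsManifold I ∞ N]

theorem lieDeriv_apply {X : ∀ p : N, TangentSpace I p} {η : ∀ p : N, TangentSpace I p →L[ℝ] ℝ}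
    {W : ∀ p : N, TangentSpace I p} {p : N}
    (hη : MDifferentiableAt I (I.prod 𝓘(ℝ, E →L[ℝ] ℝ)) (fun q => (⟨q, η q⟩ :
      TotalSpace (E →L[ℝ] ℝ) (DualBundle (TangentSpace I : N → Type _)))) p)
    (hW : MDifferentiableAt I (I.prod 𝓘(ℝ, E)) (fun q => (⟨q, W q⟩ : TangentBundle I N)) p) :
    lieDeriv I X η p (W p)
      = mvfderiv I (fun q => η q (W q)) p (X p) - η p (mlieBracket I X W p) := by
  have h := tensorialAt_lieDerivAux I X η p hη
  have e : lieDeriv I X η p = TensorialAt.mkHom _ p h := dif_pos h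
  rw [e, TensorialAt.mkHom_apply h hW]
  rfl

theorem courant_snd_apply {a b : ∀ p : N, GenBundle (TangentSpace I : N → Type _) p}
    {W : ∀ p : N, TangentSpace I p} {p : N}
    (ha : MDifferentiableAt I (I.prod 𝓘(ℝ, E →L[ℝ] ℝ)) (fun q => (⟨q, (a q).2⟩ :
      TotalSpace (E →L[ℝ] ℝ) (DualBundle (TangentSpace I : N → Type _)))) p)
    (hb : MDifferentiableAt I (I.prod 𝓘(ℝ, E →L[ℝ] ℝ)) (fun q => (⟨q, (b q).2⟩ :
      TotalSpace (E →L[ℝ] ℝ) (DualBundle (TangentSpace I : N → Type _)))) p)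
    (hW : MDifferentiableAt I (I.prod 𝓘(ℝ, E)) (fun q => (⟨q, W q⟩ : TangentBundle I N)) p) :
    (courant I a b p).2 (W p)
      = mvfderiv I (fun q => (b q).2 (W q)) p (a p).1
          - (b p).2 (mlieBracket I (fun q => (a q).1) W p)
        - (mvfderiv I (fun q => (a q).2 (W q)) p (b p).1
          - (a p).2 (mlieBracket I (fun q => (b q).1) W p))
        + 1 / 2 * mvfderiv I (fun q => (a q).2 (b q).1 - (b q).2 (a q).1) p (W p) := by
  rw [← lieDeriv_apply (X := fun q => (b q).1) ha hW, ← lieDeriv_apply (X := fun q => (a q).1) hb hW]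
  rfl

end LieDeriv

section Lift

variable {E : Type*} [NormedAddCommGroup E] [NormedSpace ℝ E] [FiniteDimensional ℝ E]
  {H : Type*} [TopologicalSpace H] {I : ModelWithCorners ℝ E H}
  {M : Type*} [TopologicalSpace M] [ChartedSpace H M] [IsManifold I ∞ M]
  {F : Type*} [NormedAddCommGroup F] [NormedSpace ℝ F] [FiniteDimensional ℝ F]
  {V : M → Type*} [∀ x, AddCommGroup (V x)] [∀ x, Module ℝ (V x)]
  [TopologicalSpace (TotalSpace F V)] [∀ x, TopologicalSpace (V x)]
  [∀ x, IsTopologicalAddGroup (V x)] [∀ x, ContinuousSMul ℝ (V x)]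
  [FiberBundle F V] [VectorBundle ℝ F V] [ContMDiffVectorBundle ∞ F V I]
  (cov : CovariantDerivative I F V)

/-- The section of `T_X ⊕ T_X^∨` that corresponds to the pullback of the section `c`. -/
noncomputable def basicLift (c : ∀ x, GenBundle (SumTangent I V) x) (q : TotalSpace F V) :
    GenBundle (TotTangent I F V) q :=
  (splitting cov q).symm (c q.1)

/-- The covector part, evaluated on `(r, z)`, of the bracket of sections of
`(V ⊕ T_M) ⊕ (V ⊕ T_M)^∨` induced by the Courant bracket on the total space. -/
noncomputable def bracketCovector (c c' : ∀ x, GenBundle (SumTangent I V) x) (r : ∀ x, V x)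
    (z : ∀ x : M, TangentSpace I x) (x : M) : ℝ :=
  mvfderiv I (fun y => (c' y).2 (r y, z y)) x (c x).1.2
      - (c' x).2 (cov r x (c x).1.2 - cov (fun y => (c y).1.1) x (z x),
        mlieBracket I (fun y => (c y).1.2) z x)
    - (mvfderiv I (fun y => (c y).2 (r y, z y)) x (c' x).1.2
      - (c x).2 (cov r x (c' x).1.2 - cov (fun y => (c' y).1.1) x (z x),
        mlieBracket I (fun y => (c' y).1.2) z x))
    + 1 / 2 * mvfderiv I (fun y => (c y).2 (c' y).1 - (c' y).2 (c y).1) x (z x)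

/-- The bracket of sections of `(V ⊕ T_M) ⊕ (V ⊕ T_M)^∨` induced by the Courant bracket on the
total space. -/
noncomputable def baseBracket (c c' : ∀ x, GenBundle (SumTangent I V) x) (x : M) :
    GenBundle (SumTangent I V) x :=
  splitting cov ⟨x, 0⟩ (courant (I.prod 𝓘(ℝ, F)) (basicLift cov c) (basicLift cov c') ⟨x, 0⟩)

theorem SmoothGenSectionOn.mono {c : ∀ x, GenBundle (SumTangent I V) x} {U W : Set M}
    (hc : SmoothGenSectionOn I (F × E) c U) (hW : W ⊆ U) : SmoothGenSectionOn I (F × E) c W :=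
  ContMDiffOn.mono hc hW

theorem SmoothGenSectionOn.fst_fst {c : ∀ x, GenBundle (SumTangent I V) x} {U : Set M}
    (hU : IsOpen U) (hc : SmoothGenSectionOn I (F × E) c U) :
    SmoothSectionOn I F (fun x => (c x).1.1) U := fun _ hx =>
  (contMDiffAt_sumSection.1 (((smoothGenSectionOn_iff hU).1 hc).1.contMDiffAt
    (hU.mem_nhds hx))).1.contMDiffWithinAt

theorem SmoothGenSectionOn.fst_snd {c : ∀ x, GenBundle (SumTangent I V) x} {U : Set M}
    (hU : IsOpen U) (hc : SmoothGenSectionOn I (F × E) c U) :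
    SmoothFieldOn I (fun x => (c x).1.2) U := fun _ hx =>
  (contMDiffAt_sumSection.1 (((smoothGenSectionOn_iff hU).1 hc).1.contMDiffAt
    (hU.mem_nhds hx))).2.contMDiffWithinAt

theorem SmoothGenSectionOn.snd_apply {c : ∀ x, GenBundle (SumTangent I V) x} {U : Set M}
    (hU : IsOpen U) (hc : SmoothGenSectionOn I (F × E) c U) {r : ∀ x, V x}
    {z : ∀ x : M, TangentSpace I x} (hr : SmoothSectionOn I F r U) (hz : SmoothFieldOn I z U) :
    ContMDiffOn I 𝓘(ℝ, ℝ) ∞ (fun x => (c x).2 (r x, z x)) U := fun _ hx =>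
  (ContMDiffAt.dual_apply (((smoothGenSectionOn_iff hU).1 hc).2.contMDiffAt (hU.mem_nhds hx))
    (contMDiffAt_sumSection.2 ⟨hr.contMDiffAt (hU.mem_nhds hx),
      hz.contMDiffAt (hU.mem_nhds hx)⟩)).contMDiffWithinAt

variable {cov} [T2Space M] [I.Boundaryless]

variable {c c' : ∀ x, GenBundle (SumTangent I V) x} {U : Set M}

theorem splitting_courant_basicLift_fst (hflat : IsFlat cov) (hU : IsOpen U)
    (hc : SmoothGenSectionOn I (F × E) c U) (hc' : SmoothGenSectionOn I (F × E) c' U)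
    {p : TotalSpace F V} (hp : p.1 ∈ U) :
    (splitting cov p (courant (I.prod 𝓘(ℝ, F)) (basicLift cov c) (basicLift cov c') p)).1
      = (cov (fun y => (c' y).1.1) p.1 (c p.1).1.2 - cov (fun y => (c y).1.1) p.1 (c' p.1).1.2,
        mlieBracket I (fun y => (c y).1.2) (fun y => (c' y).1.2) p.1) :=
  Prod.ext
    (connForm_mlieBracket_liftField hflat hU (hc.fst_fst hU) (hc.fst_snd hU) (hc'.fst_fst hU)
      (hc'.fst_snd hU) hp)
    (projDeriv_mlieBracket_liftField hflat.smooth hU (hc.fst_fst hU) (hc.fst_snd hU)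
      (hc'.fst_fst hU) (hc'.fst_snd hU) hp)

theorem basicLift_snd_liftField (c : ∀ x, GenBundle (SumTangent I V) x) (r : ∀ x, V x)
    (z : ∀ x : M, TangentSpace I x) (q : TotalSpace F V) :
    (basicLift cov c q).2 (liftField cov r z q) = (c q.1).2 (r q.1, z q.1) := by
  show (c q.1).2 (connForm cov q (liftField cov r z q), projDeriv I q (liftField cov r z q)) = _
  rw [connForm_liftField, projDeriv_liftField]

theorem splitting_courant_basicLift_snd (hflat : IsFlat cov) (hU : IsOpen U)
    (hc : SmoothGenSectionOn I (F × E) c U) (hc' : SmoothGenSectionOn I (F × E) c' U)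
    {r : ∀ x, V x} {z : ∀ x : M, TangentSpace I x} (hr : SmoothSectionOn I F r U)
    (hz : SmoothFieldOn I z U) {p : TotalSpace F V} (hp : p.1 ∈ U) :
    (splitting cov p (courant (I.prod 𝓘(ℝ, F)) (basicLift cov c) (basicLift cov c') p)).2
      (r p.1, z p.1) = bracketCovector cov c c' r z p.1 := by
  have hcov := hflat.smooth
  have hn : {q : TotalSpace F V | q.1 ∈ U} ∈ 𝓝 p := (isOpen_totalSpace_preimage hU).mem_nhds hp
  have hL {c : ∀ x, GenBundle (SumTangent I V) x} (hc : SmoothGenSectionOn I (F × E) c U) :=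
    ((((smoothGenSectionOn_iff (isOpen_totalSpace_preimage hU)).1
      (smoothGenSectionOn_splitting_symm_comp_proj hcov hU hc)).2.contMDiffAt
        hn)).mdifferentiableAt (by simp)
  have hR := (((contMDiffOn_liftField hcov hU hr hz)).contMDiffAt hn).mdifferentiableAt (by simp)
  have hmd {c : ∀ x, GenBundle (SumTangent I V) x} (hc : SmoothGenSectionOn I (F × E) c U)
      {r : ∀ x, V x} {z : ∀ x : M, TangentSpace I x} (hr : SmoothSectionOn I F r U)
      (hz : SmoothFieldOn I z U) : MDifferentiableAt I 𝓘(ℝ, ℝ) (fun y => (c y).2 (r y, z y)) p.1 :=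
    ((hc.snd_apply hU hr hz).contMDiffAt (hU.mem_nhds hp)).mdifferentiableAt (by simp)
  have hbr {c c' : ∀ x, GenBundle (SumTangent I V) x} (hc : SmoothGenSectionOn I (F × E) c U) :
      (basicLift cov c' p).2 (mlieBracket (I.prod 𝓘(ℝ, F)) (fun q => (basicLift cov c q).1)
        (liftField cov r z) p) = (c' p.1).2 (cov r p.1 (c p.1).1.2
          - cov (fun y => (c y).1.1) p.1 (z p.1), mlieBracket I (fun y => (c y).1.2) z p.1) := by
    rw [← projDeriv_mlieBracket_liftField hcov hU (hc.fst_fst hU) (hc.fst_snd hU) hr hz hp,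
      ← connForm_mlieBracket_liftField hflat hU (hc.fst_fst hU) (hc.fst_snd hU) hr hz hp]
    rfl
  have hder {c c' : ∀ x, GenBundle (SumTangent I V) x} (hc' : SmoothGenSectionOn I (F × E) c' U) :
      mvfderiv (I.prod 𝓘(ℝ, F)) (fun q => (basicLift cov c' q).2 (liftField cov r z q)) p
        (basicLift cov c p).1 = mvfderiv I (fun y => (c' y).2 (r y, z y)) p.1 (c p.1).1.2 := by
    simp only [basicLift_snd_liftField]
    refine (mvfderiv_comp_proj (hmd hc' hr hz) _).trans ?_
    exact congrArg _ (projDeriv_liftField cov (fun y => (c y).1.1) (fun y => (c y).1.2) p)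
  have hpair : mvfderiv (I.prod 𝓘(ℝ, F)) (fun q => (basicLift cov c q).2 (basicLift cov c' q).1
      - (basicLift cov c' q).2 (basicLift cov c q).1) p (liftField cov r z p)
      = mvfderiv I (fun y => (c y).2 (c' y).1 - (c' y).2 (c y).1) p.1 (z p.1) := by
    have e : (fun q : TotalSpace F V => (basicLift cov c q).2 (basicLift cov c' q).1
        - (basicLift cov c' q).2 (basicLift cov c q).1)
        = fun q => (fun y => (c y).2 (c' y).1 - (c' y).2 (c y).1) q.1 := by
      funext q
      exact congrArg₂ (· - ·)
        (basicLift_snd_liftField c (fun y => (c' y).1.1) (fun y => (c' y).1.2) q)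
        (basicLift_snd_liftField c' (fun y => (c y).1.1) (fun y => (c y).1.2) q)
    have hd : MDifferentiableAt I 𝓘(ℝ, ℝ)
        (fun y => (c y).2 (c' y).1 - (c' y).2 (c y).1) p.1 :=
      (hmd hc (hc'.fst_fst hU) (hc'.fst_snd hU)).sub (hmd hc' (hc.fst_fst hU) (hc.fst_snd hU))
    rw [e, mvfderiv_comp_proj hd, projDeriv_liftField]
  have h := courant_snd_apply (hL hc) (hL hc') hR
  refine h.trans ?_
  exact congrArg₂ (· + ·) (congrArg₂ (· - ·) (congrArg₂ (· - ·) (hder hc') (hbr hc))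
    (congrArg₂ (· - ·) (hder hc) (hbr hc'))) (congrArg (1 / 2 * ·) hpair)

theorem splitting_courant_basicLift (hflat : IsFlat cov) (hU : IsOpen U)
    (hc : SmoothGenSectionOn I (F × E) c U) (hc' : SmoothGenSectionOn I (F × E) c' U)
    {p : TotalSpace F V} (hp : p.1 ∈ U) :
    splitting cov p (courant (I.prod 𝓘(ℝ, F)) (basicLift cov c) (basicLift cov c') p)
      = baseBracket cov c c' p.1 := by
  have hp0 : (⟨p.1, 0⟩ : TotalSpace F V).1 ∈ U := hp
  refine Prod.ext ?_ (ContinuousLinearMap.ext fun v => ?_)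
  · exact (splitting_courant_basicLift_fst hflat hU hc hc' hp).trans
      (splitting_courant_basicLift_fst hflat hU hc hc' hp0).symm
  · obtain ⟨W₁, hW₁, hr⟩ := FiberBundle.exists_contMDiffOn_extend (k := ∞) I F v.1
    obtain ⟨W₂, hW₂, hz⟩ := FiberBundle.exists_contMDiffOn_extend (k := ∞) I E v.2
    obtain ⟨W, hW, hWo, hxW⟩ := mem_nhds_iff.1
      (Filter.inter_mem (Filter.inter_mem hW₁ hW₂) (hU.mem_nhds hp))
    have h (q : TotalSpace F V) (hq : q.1 ∈ W) := splitting_courant_basicLift_snd hflat hWo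
      (hc.mono fun x hx => (hW hx).2)
      (hc'.mono fun x hx => (hW hx).2) (hr.mono fun x hx => (hW hx).1.1)
      (hz.mono fun x hx => (hW hx).1.2) hq
    have h1 := (h p hxW).trans (h ⟨p.1, 0⟩ hxW).symm
    have e : (FiberBundle.extend F v.1 p.1, FiberBundle.extend E v.2 p.1) = v :=
      Prod.ext (FiberBundle.extend_apply_self F v.1) (FiberBundle.extend_apply_self E v.2)
    rw [e] at h1
    exact h1

end Lift
section Shuffle

variable {E : Type*} [NormedAddCommGroup E] [NormedSpace ℝ E] [FiniteDimensional ℝ E]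
  {H : Type*} [TopologicalSpace H] {I : ModelWithCorners ℝ E H}
  {M : Type*} [TopologicalSpace M] [ChartedSpace H M] [IsManifold I ∞ M]
  {F : Type*} [NormedAddCommGroup F] [NormedSpace ℝ F] [FiniteDimensional ℝ F]
  {V : M → Type*} [∀ x, AddCommGroup (V x)] [∀ x, Module ℝ (V x)]
  [TopologicalSpace (TotalSpace F V)] [∀ x, TopologicalSpace (V x)]
  [∀ x, IsTopologicalAddGroup (V x)] [∀ x, ContinuousSMul ℝ (V x)]
  [FiberBundle F V] [VectorBundle ℝ F V] [ContMDiffVectorBundle ∞ F V I]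

variable (F) in
/-- The exchange of `V` and `V^∨` in the fibre over `x`. -/
noncomputable def fibreShuffle (x : M) :
    GenBundle (SumTangent I V) x ≃ₗ[ℝ] GenBundle (SumTangent I (DualBundle V)) x :=
  haveI : T2Space (V x) := FiberBundle.t2Space F V x
  haveI : FiniteDimensional ℝ (V x) := VectorBundle.finiteDimensional ℝ F V x
  shuffle (V x) (TangentSpace I x)

theorem mirror_apply (K : GenEnd (SumTangent I V)) (x : M)
    (a : GenBundle (SumTangent I (DualBundle V)) x) :
    mirror F K x a = fibreShuffle F x (K x ((fibreShuffle F x).symm a)) := rfl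

theorem fibreShuffle_fst_fst (x : M) (a : GenBundle (SumTangent I V) x) (v : V x) :
    (fibreShuffle F x a).1.1 v = a.2 (v, 0) := rfl

theorem fibreShuffle_fst_snd (x : M) (a : GenBundle (SumTangent I V) x) :
    (fibreShuffle F x a).1.2 = a.1.2 := rfl

theorem fibreShuffle_snd (x : M) (a : GenBundle (SumTangent I V) x)
    (b : SumTangent I (DualBundle V) x) :
    (fibreShuffle F x a).2 b = b.1 a.1.1 + a.2 (0, b.2) := rfl

theorem apply_fibreShuffle_symm_fst_fst (x : M) (a : GenBundle (SumTangent I (DualBundle V)) x)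
    (ρ : DualBundle V x) : ρ ((fibreShuffle F x).symm a).1.1 = a.2 (ρ, 0) := by
  have h := fibreShuffle_snd (F := F) x ((fibreShuffle F x).symm a) (ρ, 0)
  rw [LinearEquiv.apply_symm_apply] at h
  have h0 : ((fibreShuffle F x).symm a).2 (0, 0) = 0 := map_zero ((fibreShuffle F x).symm a).2
  exact (h.trans ((congrArg _ h0).trans (add_zero _))).symm

theorem smoothSectionOn_zero (F : Type*) [NormedAddCommGroup F] [NormedSpace ℝ F]
    {V : M → Type*} [∀ x, AddCommGroup (V x)] [∀ x, Module ℝ (V x)]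
    [TopologicalSpace (TotalSpace F V)] [∀ x, TopologicalSpace (V x)]
    [FiberBundle F V] [VectorBundle ℝ F V] (U : Set M) :
    SmoothSectionOn I F (fun x => (0 : V x)) U :=
  (contMDiff_zeroSection ℝ V).contMDiffOn

theorem smoothGenSectionOn_mk {s : ∀ x, V x} {u : ∀ x : M, TangentSpace I x}
    {γ : ∀ x, SumTangent I V x →L[ℝ] ℝ} {U : Set M} (hU : IsOpen U)
    (hs : SmoothSectionOn I F s U) (hu : SmoothFieldOn I u U)
    (hγ : ∀ W ⊆ U, IsOpen W → ∀ r z, SmoothSectionOn I F r W → SmoothFieldOn I z W →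
      ContMDiffOn I 𝓘(ℝ, ℝ) ∞ (fun y => γ y (r y, z y)) W) :
    SmoothGenSectionOn I (F × E)
      (fun x => (((s x, u x), γ x) : GenBundle (SumTangent I V) x)) U := by
  refine (smoothGenSectionOn_iff hU).2 ⟨fun x hx => (contMDiffAt_sumSection.2
    ⟨hs.contMDiffAt (hU.mem_nhds hx), hu.contMDiffAt (hU.mem_nhds hx)⟩).contMDiffWithinAt, ?_⟩
  refine contMDiffOn_dual_of_apply hU fun W hW hWo σ hσ => ?_
  have h (x) (hx : x ∈ W) := contMDiffAt_sumSection.1 (hσ.contMDiffAt (hWo.mem_nhds hx))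
  exact hγ W hW hWo (fun x => (σ x).1) (fun x => (σ x).2)
    (fun x hx => (h x hx).1.contMDiffWithinAt) (fun x hx => (h x hx).2.contMDiffWithinAt)

theorem SmoothGenSectionOn.fibreShuffle {c : ∀ x, GenBundle (SumTangent I V) x} {U : Set M}
    (hU : IsOpen U) (hc : SmoothGenSectionOn I (F × E) c U) :
    SmoothGenSectionOn I ((F →L[ℝ] ℝ) × E) (fun x => GenGeom.fibreShuffle F x (c x)) U := by
  refine smoothGenSectionOn_mk (V := DualBundle V) hU
    (contMDiffOn_dual_of_apply hU fun W hW hWo r hr => ?_)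
    (hc.fst_snd hU) fun W hW hWo ρ z hρ hz => ?_
  · exact (hc.mono hW).snd_apply hWo hr (smoothSectionOn_zero E W)
  · exact (contMDiffOn_dualSection_apply hρ ((hc.fst_fst hU).mono hW)).add
      ((hc.mono hW).snd_apply hWo (smoothSectionOn_zero F W) hz)

theorem SmoothGenSectionOn.fibreShuffle_symm
    {d : ∀ x, GenBundle (SumTangent I (DualBundle V)) x} {U : Set M}
    (hU : IsOpen U) (hd : SmoothGenSectionOn I ((F →L[ℝ] ℝ) × E) d U) :
    SmoothGenSectionOn I (F × E) (fun x => (GenGeom.fibreShuffle F x).symm (d x)) U := by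
  refine smoothGenSectionOn_mk hU (fun x hx => ?_)
    (hd.fst_snd (V := DualBundle V) hU) fun W hW hWo r z hr hz => ?_
  · refine (contMDiffAt_along_of_dual contMDiffAt_id fun W hW hxW ρ hρ => ?_).contMDiffWithinAt
    have hWU : IsOpen (U ∩ W) := hU.inter hW
    have h := (hd.mono inter_subset_left).snd_apply (V := DualBundle V) hWU
      (hρ.mono inter_subset_right) (smoothSectionOn_zero E (U ∩ W))
    have e : (fun y => ρ y ((GenGeom.fibreShuffle F y).symm (d y)).1.1)
        = fun y => (d y).2 (ρ y, 0) :=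
      funext fun y => apply_fibreShuffle_symm_fst_fst y (d y) (ρ y)
    exact (e ▸ h).contMDiffAt (hWU.mem_nhds ⟨hx, hxW⟩)
  · exact (contMDiffOn_dualSection_apply ((hd.fst_fst (V := DualBundle V) hU).mono hW) hr).add
      ((hd.mono hW).snd_apply (V := DualBundle V) hWo (smoothSectionOn_zero (F →L[ℝ] ℝ) W) hz)

variable [T2Space M] [I.Boundaryless] {cov : CovariantDerivative I F V}

theorem bracketCovector_zero_right (c c' : ∀ x, GenBundle (SumTangent I V) x) (r : ∀ x, V x)
    (x : M) :
    bracketCovector cov c c' r (fun _ => 0) x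
      = mvfderiv I (fun y => (c' y).2 (r y, 0)) x (c x).1.2 - (c' x).2 (cov r x (c x).1.2, 0)
        - (mvfderiv I (fun y => (c y).2 (r y, 0)) x (c' x).1.2
          - (c x).2 (cov r x (c' x).1.2, 0)) := by
  have h (u : ∀ x : M, TangentSpace I x) : mlieBracket I u (fun _ => 0) x = 0 :=
    congrFun (mlieBracket_zero_right (W := u)) x
  simp only [bracketCovector, h, map_zero, sub_zero, mul_zero, add_zero]

theorem bracketCovector_zero_left (c c' : ∀ x, GenBundle (SumTangent I V) x)
    (z : ∀ x : M, TangentSpace I x) (x : M) :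
    bracketCovector cov c c' (fun _ => 0) z x
      = mvfderiv I (fun y => (c' y).2 (0, z y)) x (c x).1.2
          + (c' x).2 (cov (fun y => (c y).1.1) x (z x), 0)
          - (c' x).2 (0, mlieBracket I (fun y => (c y).1.2) z x)
        - (mvfderiv I (fun y => (c y).2 (0, z y)) x (c' x).1.2
          + (c x).2 (cov (fun y => (c' y).1.1) x (z x), 0)
          - (c x).2 (0, mlieBracket I (fun y => (c' y).1.2) z x))
        + 1 / 2 * mvfderiv I (fun y => (c y).2 (c' y).1 - (c' y).2 (c y).1) x (z x) := by
  have h0 : cov (fun _ => 0) x = 0 := cov.isCovariantDerivativeOnUniv.zero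
  have h (a : GenBundle (SumTangent I V) x) (v : V x) (w : TangentSpace I x) :
      a.2 (0 - v, w) = a.2 (0, w) - a.2 (v, 0) := by
    rw [← map_sub]
    simp
  simp only [bracketCovector, h0, zero_apply, h]
  ring

theorem fibreShuffle_baseBracket (hflat : IsFlat cov)
    {c c' : ∀ x, GenBundle (SumTangent I V) x} {U : Set M} (hU : IsOpen U)
    (hc : SmoothGenSectionOn I (F × E) c U) (hc' : SmoothGenSectionOn I (F × E) c' U)
    {x : M} (hx : x ∈ U) :
    fibreShuffle F x (baseBracket cov c c' x)
      = baseBracket (dualConnection cov) (fun y => fibreShuffle F y (c y))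
          (fun y => fibreShuffle F y (c' y)) x := by
  have hflat' := hflat.dualConnection
  have hĉ := hc.fibreShuffle hU
  have hĉ' := hc'.fibreShuffle hU
  have h1 := splitting_courant_basicLift_fst hflat hU hc hc' (p := ⟨x, 0⟩) hx
  have h1' := splitting_courant_basicLift_fst (V := DualBundle V) hflat' hU hĉ hĉ'
    (p := ⟨x, 0⟩) hx
  have hdiff {f : M → ℝ} {W : Set M} (hW : IsOpen W) (hxW : x ∈ W)
      (hf : ContMDiffOn I 𝓘(ℝ, ℝ) ∞ f W) : MDifferentiableAt I 𝓘(ℝ, ℝ) f x :=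
    (hf.contMDiffAt (hW.mem_nhds hxW)).mdifferentiableAt (by simp)
  have hdual {c : ∀ x, GenBundle (SumTangent I V) x} (hc : SmoothGenSectionOn I (F × E) c U)
      {r : ∀ x, V x} {W : Set M} (hW : IsOpen W) (hxW : x ∈ W) (hr : SmoothSectionOn I F r W)
      (u : TangentSpace I x) :
      dualConnection cov (fun y => (fibreShuffle F y (c y)).1.1) x u (r x)
        = mvfderiv I (fun y => (c y).2 (r y, 0)) x u - (c x).2 (cov r x u, 0) :=
    dualConnection_apply cov u
      (((hc.fibreShuffle hU).fst_fst (V := DualBundle V) hU).contMDiffAt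
        (hU.mem_nhds hx) |>.mdifferentiableAt (by simp))
      ((hr.contMDiffAt (hW.mem_nhds hxW)).mdifferentiableAt (by simp))
  refine Prod.ext (Prod.ext ?_ ?_) (ContinuousLinearMap.ext fun v => ?_)
  · refine Eq.trans ?_ (congrArg Prod.fst h1').symm
    refine ContinuousLinearMap.ext fun v => ?_
    obtain ⟨W₁, hW₁, hr₁⟩ := FiberBundle.exists_contMDiffOn_extend (k := ∞) I F v
    obtain ⟨W, hW, hWo, hxW⟩ := mem_nhds_iff.1 (Filter.inter_mem hW₁ (hU.mem_nhds hx))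
    have hr := hr₁.mono fun x hx => (hW hx).1
    have hWU : W ⊆ U := fun x hx => (hW hx).2
    have h2 := splitting_courant_basicLift_snd hflat hWo (hc.mono hWU) (hc'.mono hWU) hr
      (smoothSectionOn_zero E W) (p := ⟨x, 0⟩) hxW
    rw [bracketCovector_zero_right, ← hdual hc' hWo hxW hr, ← hdual hc hWo hxW hr,
      FiberBundle.extend_apply_self] at h2
    exact h2
  · exact (congrArg Prod.snd h1).trans (congrArg Prod.snd h1').symm
  · obtain ⟨W₁, hW₁, hρ₁⟩ :=
      FiberBundle.exists_contMDiffOn_extend (k := ∞) (V := DualBundle V) I (F →L[ℝ] ℝ) v.1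
    obtain ⟨W₂, hW₂, hz₁⟩ := FiberBundle.exists_contMDiffOn_extend (k := ∞) I E v.2
    obtain ⟨W, hW, hWo, hxW⟩ := mem_nhds_iff.1
      (Filter.inter_mem (Filter.inter_mem hW₁ hW₂) (hU.mem_nhds hx))
    have hρ := hρ₁.mono fun x hx => (hW hx).1.1
    have hz := hz₁.mono fun x hx => (hW hx).1.2
    have hWU : W ⊆ U := fun x hx => (hW hx).2
    set ρ := FiberBundle.extend (E := DualBundle V) (F →L[ℝ] ℝ) v.1
    set z := FiberBundle.extend E v.2
    have h2 := splitting_courant_basicLift_snd hflat hWo (hc.mono hWU) (hc'.mono hWU)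
      (smoothSectionOn_zero F W) hz (p := ⟨x, 0⟩) hxW
    have h2' := splitting_courant_basicLift_snd (V := DualBundle V) hflat' hWo
      (hĉ.mono (V := DualBundle V) hWU) (hĉ'.mono (V := DualBundle V) hWU) hρ hz
      (p := ⟨x, 0⟩) hxW
    have hv : (ρ x, z x) = v :=
      Prod.ext (FiberBundle.extend_apply_self (E := DualBundle V) (F →L[ℝ] ℝ) v.1)
        (FiberBundle.extend_apply_self E v.2)
    rw [bracketCovector_zero_left] at h2
    rw [hv] at h2'
    refine Eq.trans ?_ h2'.symm
    have hρd : MDifferentiableAt I (I.prod 𝓘(ℝ, F →L[ℝ] ℝ))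
        (fun y => (⟨y, ρ y⟩ : TotalSpace (F →L[ℝ] ℝ) (DualBundle V))) x :=
      (hρ.contMDiffAt (hWo.mem_nhds hxW)).mdifferentiableAt (by simp)
    have hγ {c : ∀ x, GenBundle (SumTangent I V) x} (hc : SmoothGenSectionOn I (F × E) c U)
        {r : ∀ x, V x} {z : ∀ x : M, TangentSpace I x} (hr : SmoothSectionOn I F r W)
        (hz : SmoothFieldOn I z W) : MDifferentiableAt I 𝓘(ℝ, ℝ) (fun y => (c y).2 (r y, z y)) x :=
      hdiff hWo hxW ((hc.mono hWU).snd_apply hWo hr hz)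
    have h0F := smoothSectionOn_zero (I := I) F (V := V) W
    have h0E := smoothSectionOn_zero (I := I) E (V := (TangentSpace I : M → Type _)) W
    have hs := (hc.fst_fst hU).mono hWU
    have ht := (hc'.fst_fst hU).mono hWU
    have hu := (hc.fst_snd hU).mono hWU
    have hw := (hc'.fst_snd hU).mono hWU
    have hder {c : ∀ x, GenBundle (SumTangent I V) x} (hc : SmoothGenSectionOn I (F × E) c U)
        (u : TangentSpace I x) :
        mvfderiv I (fun y => (fibreShuffle F y (c y)).2 (ρ y, z y)) x u
          = dualConnection cov ρ x u (c x).1.1 + ρ x (cov (fun y => (c y).1.1) x u)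
            + mvfderiv I (fun y => (c y).2 (0, z y)) x u := by
      have hsd : MDifferentiableAt I (I.prod 𝓘(ℝ, F))
          (fun y => (⟨y, (c y).1.1⟩ : TotalSpace F V)) x :=
        ((hc.fst_fst hU).contMDiffAt (hU.mem_nhds hx)).mdifferentiableAt (by simp)
      have h3 := dualConnection_apply cov u hρd hsd
      have h4 := mvfderiv_add (mdifferentiableAt_dual_apply hρd hsd) (hγ hc h0F hz)
      refine (congrArg (fun L : TangentSpace I x →L[ℝ] ℝ => L u) h4).trans ?_
      rw [h3, add_apply]
      ring
    have hA := hγ hc ht h0E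
    have hB := hγ hc' hs h0E
    have hC := hγ hc h0F hw
    have hD := hγ hc' h0F hu
    have split (x : M) (a : GenBundle (SumTangent I V) x) (b : SumTangent I V x) :
        a.2 b = a.2 (b.1, 0) + a.2 (0, b.2) := by
      rw [← map_add]
      simp
    have hmv {f g k l : M → ℝ} (hf : MDifferentiableAt I 𝓘(ℝ, ℝ) f x)
        (hg : MDifferentiableAt I 𝓘(ℝ, ℝ) g x) (hk : MDifferentiableAt I 𝓘(ℝ, ℝ) k x)
        (hl : MDifferentiableAt I 𝓘(ℝ, ℝ) l x) :
        mvfderiv I ((f + g) - (k + l)) x (z x) = mvfderiv I f x (z x) + mvfderiv I g x (z x)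
          - (mvfderiv I k x (z x) + mvfderiv I l x (z x)) := by
      rw [mvfderiv_sub (hf.add hg) (hk.add hl), mvfderiv_add hf hg, mvfderiv_add hk hl]
      rfl
    have hP : mvfderiv I (fun y => (c y).2 (c' y).1 - (c' y).2 (c y).1) x (z x) = _ :=
      (congrArg (fun f : M → ℝ => mvfderiv I f x (z x)) (funext fun y => congrArg₂ (· - ·)
        (split y (c y) (c' y).1) (split y (c' y) (c y).1))).trans (hmv hA hC hB hD)
    have hP' : mvfderiv I (fun y => (fibreShuffle F y (c y)).2 (fibreShuffle F y (c' y)).1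
      - (fibreShuffle F y (c' y)).2 (fibreShuffle F y (c y)).1) x (z x)
        = mvfderiv I (fun y => (c' y).2 ((c y).1.1, 0)) x (z x)
            + mvfderiv I (fun y => (c y).2 (0, (c' y).1.2)) x (z x)
          - (mvfderiv I (fun y => (c y).2 ((c' y).1.1, 0)) x (z x)
            + mvfderiv I (fun y => (c' y).2 (0, (c y).1.2)) x (z x)) := hmv hB hC hA hD
    have hL : (fibreShuffle F x (baseBracket cov c c' x)).2 v
        = ρ x (baseBracket cov c c' x).1.1 + (baseBracket cov c c' x).2 (0, z x) := by
      have hv₁ : v.1 = ρ x := (congrArg Prod.fst hv).symm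
      have hv₂ : v.2 = z x := (congrArg Prod.snd hv).symm
      exact congrArg₂ (fun (a : DualBundle V x) (b : TangentSpace I x) =>
        a (baseBracket cov c c' x).1.1 + (baseBracket cov c c' x).2 (0, b)) hv₁ hv₂
    rw [hL]
    refine (congrArg₂ (fun a b => ρ x (Prod.fst a) + b) h1 h2).trans ?_
    have hφt := hdual hc hWo hxW ht (z x)
    have hψs := hdual hc' hWo hxW hs (z x)
    simp only [bracketCovector, fibreShuffle_fst_snd, hder hc', hder hc, hP, hP']
    rw [fibreShuffle_snd, fibreShuffle_snd]
    simp only [sub_apply, map_sub, hφt, hψs]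
    ring

end Shuffle
section Courant

variable {E : Type*} [NormedAddCommGroup E] [NormedSpace ℝ E] [FiniteDimensional ℝ E]
  {H : Type*} [TopologicalSpace H] {I : ModelWithCorners ℝ E H}
  {N : Type*} [TopologicalSpace N] [ChartedSpace H N] [IsManifold I ∞ N]

variable (I) in
/-- Differentiability at `p` of a section of `T ⊕ T^∨`. -/
abbrev GenMDifferentiableAt (a : ∀ p : N, GenBundle (TangentSpace I : N → Type _) p) (p : N) :
    Prop :=
  MDifferentiableAt I (I.prod 𝓘(ℝ, E × (E →L[ℝ] ℝ))) (fun q => (⟨q, a q⟩ :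
    TotalSpace (E × (E →L[ℝ] ℝ)) (GenBundle (TangentSpace I : N → Type _)))) p

variable {a b b' : ∀ p : N, GenBundle (TangentSpace I : N → Type _) p} {p : N}

theorem GenMDifferentiableAt.fst (ha : GenMDifferentiableAt I a p) :
    MDifferentiableAt I (I.prod 𝓘(ℝ, E)) (fun q => (⟨q, (a q).1⟩ : TangentBundle I N)) p :=
  (mdifferentiableAt_prodSection (V₁ := (TangentSpace I : N → Type _))
    (V₂ := DualBundle (TangentSpace I : N → Type _)) (v := fun q => (a q).1)
    (w := fun q => (a q).2) (b := fun q => q).1 ha).1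

theorem GenMDifferentiableAt.snd (ha : GenMDifferentiableAt I a p) :
    MDifferentiableAt I (I.prod 𝓘(ℝ, E →L[ℝ] ℝ)) (fun q => (⟨q, (a q).2⟩ :
      TotalSpace (E →L[ℝ] ℝ) (DualBundle (TangentSpace I : N → Type _)))) p :=
  (mdifferentiableAt_prodSection (V₁ := (TangentSpace I : N → Type _))
    (V₂ := DualBundle (TangentSpace I : N → Type _)) (v := fun q => (a q).1)
    (w := fun q => (a q).2) (b := fun q => q).1 ha).2

theorem courant_congr {a' : ∀ p : N, GenBundle (TangentSpace I : N → Type _) p}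
    (ha : ∀ᶠ q in 𝓝 p, a q = a' q) (hb : ∀ᶠ q in 𝓝 p, b q = b' q) :
    courant I a b p = courant I a' b' p := by
  have ha1 : ∀ᶠ q in 𝓝 p, (a q).1 = (a' q).1 := ha.mono fun q hq => congrArg _ hq
  have hb1 : ∀ᶠ q in 𝓝 p, (b q).1 = (b' q).1 := hb.mono fun q hq => congrArg _ hq
  have hlie {a a' b b' : ∀ p : N, GenBundle (TangentSpace I : N → Type _) p}
      (ha : ∀ᶠ q in 𝓝 p, a q = a' q) (hb : ∀ᶠ q in 𝓝 p, b q = b' q) :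
      lieDeriv I (fun q => (a q).1) (fun q => (b q).2) p
        = lieDeriv I (fun q => (a' q).1) (fun q => (b' q).2) p := by
    have e : lieDerivAux I (fun q => (a q).1) (fun q => (b q).2) p
        = lieDerivAux I (fun q => (a' q).1) (fun q => (b' q).2) p := by
      funext W
      have h1 : mvfderiv I (fun q => (b q).2 (W q)) p = mvfderiv I (fun q => (b' q).2 (W q)) p :=
        Filter.EventuallyEq.mfderiv_eq (hb.mono fun q hq => by simp only [hq])
      have h2 : mlieBracket I (fun q => (a q).1) W p = mlieBracket I (fun q => (a' q).1) W p :=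
        Filter.EventuallyEq.mlieBracket_vectorField_eq (ha.mono fun q hq => congrArg _ hq)
          Filter.EventuallyEq.rfl
      simp only [lieDerivAux, h1, h2, ha.self_of_nhds, hb.self_of_nhds]
    by_cases h : TensorialAt I E (lieDerivAux I (fun q => (a' q).1) (fun q => (b' q).2) p) p
    · rw [lieDeriv, lieDeriv, dif_pos (e ▸ h), dif_pos h]
      simp only [e]
    · rw [lieDeriv, lieDeriv, dif_neg (e ▸ h), dif_neg h]
  have hp : mvfderiv I (fun q => (a q).2 (b q).1 - (b q).2 (a q).1) p
      = mvfderiv I (fun q => (a' q).2 (b' q).1 - (b' q).2 (a' q).1) p :=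
    Filter.EventuallyEq.mfderiv_eq (by
      filter_upwards [ha, hb] with q hq hq'
      simp only [hq, hq'])
  refine Prod.ext (Filter.EventuallyEq.mlieBracket_vectorField_eq ha1 hb1) ?_
  simp only [courant, hlie ha hb, hlie hb ha, hp]

theorem mdifferentiableAt_pairingSub (ha : GenMDifferentiableAt I a p)
    (hb : GenMDifferentiableAt I b p) : MDifferentiableAt I 𝓘(ℝ, ℝ)
      (fun q => (a q).2 (b q).1 - (b q).2 (a q).1) p :=
  (mdifferentiableAt_dual_apply ha.snd hb.fst).sub (mdifferentiableAt_dual_apply hb.snd ha.fst)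

theorem courant_swap (a b : ∀ p : N, GenBundle (TangentSpace I : N → Type _) p) (p : N) :
    courant I a b p = -courant I b a p := by
  refine Prod.ext mlieBracket_swap_apply ?_
  have e : (fun q => (a q).2 (b q).1 - (b q).2 (a q).1)
      = -fun q => (b q).2 (a q).1 - (a q).2 (b q).1 := by
    funext q
    simp
  simp only [courant, e, mvfderiv_neg, Prod.snd_neg, smul_neg]
  abel

theorem courant_add_right (ha : GenMDifferentiableAt I a p) (hb : GenMDifferentiableAt I b p)
    (hb' : GenMDifferentiableAt I b' p) :
    courant I a (b + b') p = courant I a b p + courant I a b' p := by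
  have hbb : GenMDifferentiableAt I (b + b') p := mdifferentiableAt_add_section hb hb'
  refine Prod.ext (mlieBracket_add_right hb.fst hb'.fst) (ContinuousLinearMap.ext fun v => ?_)
  have hW := FiberBundle.mdifferentiableAt_extend I E v
  set W := FiberBundle.extend E v
  have hv : W p = v := FiberBundle.extend_apply_self E v
  have h := courant_snd_apply ha.snd hbb.snd hW
  have h1 := courant_snd_apply ha.snd hb.snd hW
  have h2 := courant_snd_apply ha.snd hb'.snd hW
  rw [hv] at h h1 h2
  refine h.trans ((?_ : _ = _).trans (congrArg₂ (· + ·) h1 h2).symm)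
  have e1 : (fun q => ((b + b') q).2 (W q)) = (fun q => (b q).2 (W q)) + fun q => (b' q).2 (W q) :=
    rfl
  have e2 : (fun q => (a q).2 ((b + b') q).1 - ((b + b') q).2 (a q).1)
      = (fun q => (a q).2 (b q).1 - (b q).2 (a q).1)
        + fun q => (a q).2 (b' q).1 - (b' q).2 (a q).1 := by
    funext q
    simp
    ring
  have e3 : mlieBracket I (fun q => ((b + b') q).1) W p
      = mlieBracket I (fun q => (b q).1) W p + mlieBracket I (fun q => (b' q).1) W p :=
    mlieBracket_add_left hb.fst hb'.fst
  rw [e1, e2, e3, mvfderiv_add (mdifferentiableAt_dual_apply hb.snd hW)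
    (mdifferentiableAt_dual_apply hb'.snd hW),
    mvfderiv_add (mdifferentiableAt_pairingSub ha hb) (mdifferentiableAt_pairingSub ha hb')]
  simp
  ring

theorem courant_smul_right {f : N → ℝ} (hf : MDifferentiableAt I 𝓘(ℝ, ℝ) f p)
    (ha : GenMDifferentiableAt I a p) (hb : GenMDifferentiableAt I b p) :
    courant I a (f • b) p = f p • courant I a b p + mvfderiv I f p (a p).1 • b p
      + pairing (a p) (b p) • (0, mvfderiv I f p) := by
  have hfb : GenMDifferentiableAt I (f • b) p := hf.smul_section hb
  refine Prod.ext ?_ (ContinuousLinearMap.ext fun v => ?_)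
  · refine (mlieBracket_smul_right hf hb.fst).trans ?_
    simp [courant, add_comm]
  have hW := FiberBundle.mdifferentiableAt_extend I E v
  set W := FiberBundle.extend E v
  have hv : W p = v := FiberBundle.extend_apply_self E v
  have h := courant_snd_apply ha.snd hfb.snd hW
  have h1 := courant_snd_apply ha.snd hb.snd hW
  rw [hv] at h h1
  refine h.trans ?_
  have e1 : (fun q => ((f • b) q).2 (W q)) = f * fun q => (b q).2 (W q) := rfl
  have e2 : (fun q => (a q).2 ((f • b) q).1 - ((f • b) q).2 (a q).1)
      = f * fun q => (a q).2 (b q).1 - (b q).2 (a q).1 := by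
    funext q
    simp
    ring
  have e3 : mlieBracket I (fun q => ((f • b) q).1) W p
      = - mvfderiv I f p (W p) • (b p).1 + f p • mlieBracket I (fun q => (b q).1) W p :=
    mlieBracket_smul_left hf hb.fst
  rw [e1, e2, e3, mvfderiv_mul hf (mdifferentiableAt_dual_apply hb.snd hW),
    mvfderiv_mul hf (mdifferentiableAt_pairingSub ha hb), hv]
  simp only [Prod.snd_add, Prod.smul_snd, add_apply, smul_apply, h1, pairing]
  simp
  ring

end Courant
section Torsion

variable {E : Type*} [NormedAddCommGroup E] [NormedSpace ℝ E] [FiniteDimensional ℝ E]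
  {H : Type*} [TopologicalSpace H] {I : ModelWithCorners ℝ E H}
  {N : Type*} [TopologicalSpace N] [ChartedSpace H N] [IsManifold I ∞ N]

/-- The torsion `J[σ, τ] - J[Jσ, Jτ] - [σ, Jτ] - [Jσ, τ]` of `J` with respect to the Courant
bracket. -/
noncomputable def courantTorsion (J : GenEnd (TangentSpace I : N → Type _))
    (σ τ : ∀ p : N, GenBundle (TangentSpace I : N → Type _) p) (p : N) :
    GenBundle (TangentSpace I : N → Type _) p :=
  J p (courant I σ τ p) - J p (courant I (fun q => J q (σ q)) (fun q => J q (τ q)) p)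
    - courant I σ (fun q => J q (τ q)) p - courant I (fun q => J q (σ q)) τ p

variable {J : GenEnd (TangentSpace I : N → Type _)}
  {σ τ σ' τ' : ∀ p : N, GenBundle (TangentSpace I : N → Type _) p} {p : N}

theorem courantTorsion_swap (J : GenEnd (TangentSpace I : N → Type _))
    (σ τ : ∀ p : N, GenBundle (TangentSpace I : N → Type _) p) (p : N) :
    courantTorsion J σ τ p = -courantTorsion J τ σ p := by
  simp only [courantTorsion]
  rw [courant_swap σ τ, courant_swap (fun q => J q (σ q)) (fun q => J q (τ q)),
    courant_swap σ (fun q => J q (τ q)), courant_swap (fun q => J q (σ q)) τ]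
  simp only [map_neg]
  abel

theorem IsGenAlmostComplex.genMDifferentiableAt (hJ : IsGenAlmostComplex I E J)
    (hσ : GenMDifferentiableAt I σ p) : GenMDifferentiableAt I (fun q => J q (σ q)) p :=
  (hJ.smooth.mdifferentiable (by simp)).mdifferentiableAt.comp p hσ

theorem IsGenAlmostComplex.smoothGenSectionOn (hJ : IsGenAlmostComplex I E J) {U : Set N}
    (hσ : SmoothGenSectionOn I E σ U) : SmoothGenSectionOn I E (fun q => J q (σ q)) U :=
  hJ.smooth.comp_contMDiffOn hσ

theorem IsGenAlmostComplex.pairing_apply_left (hJ : IsGenAlmostComplex I E J)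
    (a b : GenBundle (TangentSpace I : N → Type _) p) :
    pairing (J p a) b = -pairing a (J p b) := by
  rw [← hJ.orthogonal p (J p a) b, hJ.sq_eq_neg_one]
  simp [pairing]
  ring

theorem IsGenAlmostComplex.tensorialAt_courantTorsion_right (hJ : IsGenAlmostComplex I E J)
    (hσ : GenMDifferentiableAt I σ p) :
    TensorialAt I (E × (E →L[ℝ] ℝ)) (V := GenBundle (TangentSpace I : N → Type _))
      (fun τ => courantTorsion J σ τ p) p where
  smul {f τ} hf hτ := by
    have hσJ := hJ.genMDifferentiableAt hσ
    have hτJ := hJ.genMDifferentiableAt hτ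
    have e : (fun q => J q ((f • τ) q)) = f • fun q => J q (τ q) :=
      funext fun q => map_smul (J q) (f q) (τ q)
    simp only [courantTorsion, e]
    rw [courant_smul_right hf hσ hτ, courant_smul_right hf hσJ hτJ, courant_smul_right hf hσ hτJ,
      courant_smul_right hf hσJ hτ, hJ.orthogonal, hJ.pairing_apply_left]
    simp only [map_add, map_smul, hJ.sq_eq_neg_one]
    module
  add {τ τ'} hτ hτ' := by
    have hσJ := hJ.genMDifferentiableAt hσ
    have e : (fun q => J q ((τ + τ') q)) = (fun q => J q (τ q)) + fun q => J q (τ' q) :=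
      funext fun q => map_add (J q) (τ q) (τ' q)
    simp only [courantTorsion, e]
    rw [courant_add_right hσ hτ hτ', courant_add_right hσJ (hJ.genMDifferentiableAt hτ)
      (hJ.genMDifferentiableAt hτ'), courant_add_right hσ (hJ.genMDifferentiableAt hτ)
      (hJ.genMDifferentiableAt hτ'), courant_add_right hσJ hτ hτ']
    simp only [map_add]
    abel

theorem IsGenAlmostComplex.courantTorsion_pointwise (hJ : IsGenAlmostComplex I E J)
    (hσ : GenMDifferentiableAt I σ p) (hσ' : GenMDifferentiableAt I σ' p)
    (hτ : GenMDifferentiableAt I τ p) (hτ' : GenMDifferentiableAt I τ' p)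
    (h : σ p = σ' p) (h' : τ p = τ' p) :
    courantTorsion J σ τ p = courantTorsion J σ' τ' p := by
  have h1 := (hJ.tensorialAt_courantTorsion_right hσ).pointwise hτ hτ' h'
  have h2' := (hJ.tensorialAt_courantTorsion_right hτ').pointwise hσ hσ' h
  exact h1.trans ((courantTorsion_swap J σ τ' p).trans ((congrArg Neg.neg h2').trans
    (courantTorsion_swap J σ' τ' p).symm))

theorem SmoothGenSectionOn.genMDifferentiableAt {U : Set N} (hU : IsOpen U)
    (hσ : SmoothGenSectionOn I E σ U) (hp : p ∈ U) : GenMDifferentiableAt I σ p :=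
  (hσ.contMDiffAt (hU.mem_nhds hp)).mdifferentiableAt (by simp)

theorem courant_neg_right (hτ : GenMDifferentiableAt I τ p) (hσ : GenMDifferentiableAt I σ p) :
    courant I σ (fun q => -τ q) p = -courant I σ τ p := by
  have h := courant_smul_right (f := fun _ : N => (-1 : ℝ)) mdifferentiableAt_const hσ hτ
  have e : ((fun _ : N => (-1 : ℝ)) • τ) = fun q => -τ q := by
    funext q
    exact neg_one_smul ℝ (τ q)
  rw [e] at h
  rw [h, mvfderiv_const, zero_apply, zero_smul, add_zero]
  exact (congrArg₂ (· + ·) (neg_one_smul ℝ (courant I σ τ p))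
    (smul_zero (pairing (σ p) (τ p)))).trans (add_zero _)

theorem IsGenAlmostComplex.isIntegrable_iff (hJ : IsGenAlmostComplex I E J) :
    IsIntegrable J ↔ ∀ U : Set N, IsOpen U → ∀ σ τ, SmoothGenSectionOn I E σ U →
      SmoothGenSectionOn I E τ U → ∀ p ∈ U, courantTorsion J σ τ p = 0 := by
  have hneg {σ : ∀ p : N, GenBundle (TangentSpace I : N → Type _) p} {U : Set N}
      (hσ : SmoothGenSectionOn I E σ U) : SmoothGenSectionOn I E (fun q => -σ q) U :=
    ContMDiffOn.neg_section hσ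
  have hcl {σ τ : ∀ p : N, GenBundle (TangentSpace I : N → Type _) p} {U : Set N} (hU : IsOpen U)
      (hσ : SmoothGenSectionOn I E σ U) (hτ : SmoothGenSectionOn I E τ U) {p : N} (hp : p ∈ U) :
      courant I (fun q => -J q (σ q)) (fun q => -J q (τ q)) p
          = courant I (fun q => J q (σ q)) (fun q => J q (τ q)) p ∧
        courant I σ (fun q => -J q (τ q)) p = -courant I σ (fun q => J q (τ q)) p ∧
        courant I (fun q => -J q (σ q)) τ p = -courant I (fun q => J q (σ q)) τ p := by
    have dσ := hσ.genMDifferentiableAt hU hp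
    have dτ := hτ.genMDifferentiableAt hU hp
    have dσ' := hJ.genMDifferentiableAt dσ
    have dτ' := hJ.genMDifferentiableAt dτ
    have dn := (hneg (hJ.smoothGenSectionOn hσ)).genMDifferentiableAt hU hp
    refine ⟨?_, courant_neg_right dτ' dσ, ?_⟩
    · rw [courant_neg_right dτ' dn, courant_swap, courant_neg_right dσ' dτ', neg_neg,
        courant_swap, neg_neg]
    · rw [courant_swap, courant_neg_right dσ' dτ, courant_swap τ, neg_neg]
  constructor
  · intro h U hU σ τ hσ hτ p hp
    have h1 := (h U hU ⟨σ, fun q => -J q (σ q)⟩ ⟨τ, fun q => -J q (τ q)⟩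
      ⟨hσ, hneg (hJ.smoothGenSectionOn hσ)⟩ ⟨hτ, hneg (hJ.smoothGenSectionOn hτ)⟩
      (fun q _ => ⟨by simp, by simp [hJ.sq_eq_neg_one]⟩)
      (fun q _ => ⟨by simp, by simp [hJ.sq_eq_neg_one]⟩) p hp).1
    obtain ⟨e1, e2, e3⟩ := hcl hU hσ hτ hp
    simp only [ComplexSection.courant, e1, e2, e3, map_sub] at h1
    rw [courantTorsion, h1]
    abel
  · intro h U hU a b ha hb hJa hJb p hp
    have ha' : ∀ᶠ q in 𝓝 p, a.im q = -J q (a.re q) := by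
      filter_upwards [hU.mem_nhds hp] with q hq
      rw [(hJa q hq).1, neg_neg]
    have hb' : ∀ᶠ q in 𝓝 p, b.im q = -J q (b.re q) := by
      filter_upwards [hU.mem_nhds hp] with q hq
      rw [(hJb q hq).1, neg_neg]
    have hr (c : ComplexSection (N := N) I) : ∀ᶠ q in 𝓝 p, c.re q = c.re q :=
      Filter.Eventually.of_forall fun _ => rfl
    obtain ⟨e1, e2, e3⟩ := hcl hU ha.1 hb.1 hp
    have h1 := h U hU a.re b.re ha.1 hb.1 p hp
    have h2 : J p ((a.courant b).re p) = -(a.courant b).im p := by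
      simp only [ComplexSection.courant, courant_congr ha' hb', courant_congr (hr a) hb',
        courant_congr ha' (hr b), e1, e2, e3, map_sub]
      rw [courantTorsion] at h1
      rw [← sub_eq_zero, ← h1]
      abel
    refine ⟨h2, ?_⟩
    rw [← neg_eq_iff_eq_neg] at h2
    rw [← h2, map_neg, hJ.sq_eq_neg_one, neg_neg]

end Torsion

section Lift

variable {E : Type*} [NormedAddCommGroup E] [NormedSpace ℝ E] [FiniteDimensional ℝ E]
  {H : Type*} [TopologicalSpace H] {I : ModelWithCorners ℝ E H} [I.Boundaryless]
  {M : Type*} [TopologicalSpace M] [ChartedSpace H M] [IsManifold I ∞ M] [T2Space M]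
  {F : Type*} [NormedAddCommGroup F] [NormedSpace ℝ F] [FiniteDimensional ℝ F]
  {V : M → Type*} [∀ x, AddCommGroup (V x)] [∀ x, Module ℝ (V x)]
  [TopologicalSpace (TotalSpace F V)] [∀ x, TopologicalSpace (V x)]
  [∀ x, IsTopologicalAddGroup (V x)] [∀ x, ContinuousSMul ℝ (V x)]
  [FiberBundle F V] [VectorBundle ℝ F V] [ContMDiffVectorBundle ∞ F V I]

/-- The torsion of `K` with respect to the bracket `baseBracket cov`. -/
noncomputable def baseTorsion (cov : CovariantDerivative I F V) (K : GenEnd (SumTangent I V))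
    (c c' : ∀ x, GenBundle (SumTangent I V) x) (x : M) : GenBundle (SumTangent I V) x :=
  K x (baseBracket cov c c' x) - K x (baseBracket cov (fun y => K y (c y)) (fun y => K y (c' y)) x)
    - baseBracket cov c (fun y => K y (c' y)) x - baseBracket cov (fun y => K y (c y)) c' x

variable {cov : CovariantDerivative I F V} {K : GenEnd (SumTangent I V)}

theorem lift_basicLift (K : GenEnd (SumTangent I V)) (c : ∀ x, GenBundle (SumTangent I V) x) :
    (fun q => lift cov K q (basicLift cov c q)) = basicLift cov fun y => K y (c y) := by
  funext q
  rw [basicLift, lift_apply, LinearEquiv.apply_symm_apply]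
  rfl

theorem splitting_courantTorsion_basicLift (hflat : IsFlat cov)
    (hK : IsGenAlmostComplex I (F × E) K) {c c' : ∀ x, GenBundle (SumTangent I V) x} {U : Set M}
    (hU : IsOpen U) (hc : SmoothGenSectionOn I (F × E) c U)
    (hc' : SmoothGenSectionOn I (F × E) c' U) {p : TotalSpace F V} (hp : p.1 ∈ U) :
    splitting cov p (courantTorsion (lift cov K) (basicLift cov c) (basicLift cov c') p)
      = baseTorsion cov K c c' p.1 := by
  have hKc : SmoothGenSectionOn I (F × E) (fun y => K y (c y)) U := hK.smooth.comp_contMDiffOn hc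
  have hKc' : SmoothGenSectionOn I (F × E) (fun y => K y (c' y)) U :=
    hK.smooth.comp_contMDiffOn hc'
  simp only [courantTorsion, lift_basicLift]
  simp only [map_sub, lift_apply, LinearEquiv.apply_symm_apply]
  rw [splitting_courant_basicLift hflat hU hc hc' hp,
    splitting_courant_basicLift hflat hU hKc hKc' hp,
    splitting_courant_basicLift hflat hU hc hKc' hp,
    splitting_courant_basicLift hflat hU hKc hc' hp]
  rfl

theorem isIntegrable_lift_iff (hflat : IsFlat cov) (hK : IsGenAlmostComplex I (F × E) K) :
    IsIntegrable (lift cov K) ↔ ∀ U : Set M, IsOpen U → ∀ c c',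
      SmoothGenSectionOn I (F × E) c U → SmoothGenSectionOn I (F × E) c' U →
        ∀ x ∈ U, baseTorsion cov K c c' x = 0 := by
  have hcov := hflat.smooth
  have hJ := hK.lift hcov
  rw [hJ.isIntegrable_iff]
  constructor
  · intro h U hU c c' hc hc' x hx
    have hx0 : (⟨x, 0⟩ : TotalSpace F V) ∈ {q : TotalSpace F V | q.1 ∈ U} := hx
    rw [← splitting_courantTorsion_basicLift hflat hK hU hc hc' (p := ⟨x, 0⟩) hx]
    exact (congrArg _ (h _ (isOpen_totalSpace_preimage hU) _ _
      (smoothGenSectionOn_splitting_symm_comp_proj hcov hU hc)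
      (smoothGenSectionOn_splitting_symm_comp_proj hcov hU hc') _ hx0)).trans (map_zero _)
  · intro h U hU σ τ hσ hτ p hp
    obtain ⟨W₁, hW₁, hc₁⟩ := FiberBundle.exists_contMDiffOn_extend (k := ∞) I
      ((F × E) × (F × E →L[ℝ] ℝ)) (V := GenBundle (SumTangent I V)) (splitting cov p (σ p))
    obtain ⟨W₂, hW₂, hc₂⟩ := FiberBundle.exists_contMDiffOn_extend (k := ∞) I
      ((F × E) × (F × E →L[ℝ] ℝ)) (V := GenBundle (SumTangent I V)) (splitting cov p (τ p))
    obtain ⟨W, hW, hWo, hxW⟩ := mem_nhds_iff.1 (Filter.inter_mem hW₁ hW₂)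
    set c := FiberBundle.extend ((F × E) × (F × E →L[ℝ] ℝ)) (E := GenBundle (SumTangent I V))
      (splitting cov p (σ p)) with hc_def
    set c' := FiberBundle.extend ((F × E) × (F × E →L[ℝ] ℝ)) (E := GenBundle (SumTangent I V))
      (splitting cov p (τ p)) with hc'_def
    have hc : SmoothGenSectionOn I (F × E) c W := hc₁.mono fun x hx => (hW hx).1
    have hc' : SmoothGenSectionOn I (F × E) c' W := hc₂.mono fun x hx => (hW hx).2
    have hpW : p ∈ {q : TotalSpace F V | q.1 ∈ W} := hxW
    have hd {c : ∀ x, GenBundle (SumTangent I V) x} (hc : SmoothGenSectionOn I (F × E) c W) :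
        GenMDifferentiableAt (I.prod 𝓘(ℝ, F)) (basicLift cov c) p :=
      SmoothGenSectionOn.genMDifferentiableAt (isOpen_totalSpace_preimage hWo)
        (smoothGenSectionOn_splitting_symm_comp_proj hcov hWo hc) hpW
    have e : σ p = basicLift cov c p := by
      rw [basicLift, hc_def, FiberBundle.extend_apply_self, LinearEquiv.symm_apply_apply]
    have e' : τ p = basicLift cov c' p := by
      rw [basicLift, hc'_def, FiberBundle.extend_apply_self, LinearEquiv.symm_apply_apply]
    rw [hJ.courantTorsion_pointwise (SmoothGenSectionOn.genMDifferentiableAt hU hσ hp) (hd hc)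
      (SmoothGenSectionOn.genMDifferentiableAt hU hτ hp) (hd hc') e e']
    apply (splitting cov p).injective
    rw [splitting_courantTorsion_basicLift hflat hK hWo hc hc' hxW, map_zero,
      h W hWo c c' hc hc' _ hxW]

end Lift
theorem symm_conj_sq_eq_neg {A B : Type*} [AddCommGroup A] [Module ℝ A] [TopologicalSpace A]
    [AddCommGroup B] [Module ℝ B] [TopologicalSpace B]
    (e : (A × (A →L[ℝ] ℝ)) ≃ₗ[ℝ] (B × (B →L[ℝ] ℝ))) {k : Module.End ℝ (B × (B →L[ℝ] ℝ))}
    (h : ∀ b, k (k b) = -b) (a : A × (A →L[ℝ] ℝ)) : e.symm (k (k (e a))) = -a := by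
  rw [h, map_neg, LinearEquiv.symm_apply_apply]

section Mirror

variable {E : Type*} [NormedAddCommGroup E] [NormedSpace ℝ E] [FiniteDimensional ℝ E]
  {H : Type*} [TopologicalSpace H] {I : ModelWithCorners ℝ E H}
  {M : Type*} [TopologicalSpace M] [ChartedSpace H M] [IsManifold I ∞ M]
  {F : Type*} [NormedAddCommGroup F] [NormedSpace ℝ F] [FiniteDimensional ℝ F]
  {V : M → Type*} [∀ x, AddCommGroup (V x)] [∀ x, Module ℝ (V x)]
  [TopologicalSpace (TotalSpace F V)] [∀ x, TopologicalSpace (V x)]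
  [∀ x, IsTopologicalAddGroup (V x)] [∀ x, ContinuousSMul ℝ (V x)]
  [FiberBundle F V] [VectorBundle ℝ F V] [ContMDiffVectorBundle ∞ F V I]
  {K : GenEnd (SumTangent I V)} {K' : GenEnd (SumTangent I (DualBundle V))}

theorem pairing_fibreShuffle (x : M) (a b : GenBundle (SumTangent I V) x) :
    pairing (fibreShuffle F x a) (fibreShuffle F x b) = pairing a b := by
  have split (a : GenBundle (SumTangent I V) x) (b : SumTangent I V x) :
      a.2 b = a.2 (b.1, 0) + a.2 (0, b.2) := by
    rw [← map_add]
    simp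
  simp only [pairing]
  rw [fibreShuffle_snd, fibreShuffle_snd, fibreShuffle_fst_fst, fibreShuffle_fst_fst,
    fibreShuffle_fst_snd, fibreShuffle_fst_snd, split a b.1, split b a.1]
  ring

variable (F) in
/-- The inverse of `mirror`. -/
noncomputable def mirrorSymm (K' : GenEnd (SumTangent I (DualBundle V))) :
    GenEnd (SumTangent I V) :=
  fun x => (fibreShuffle F x).symm.conj (K' x)

theorem mirrorSymm_apply (K' : GenEnd (SumTangent I (DualBundle V))) (x : M)
    (a : GenBundle (SumTangent I V) x) :
    mirrorSymm F K' x a = (fibreShuffle F x).symm (K' x (fibreShuffle F x a)) := rfl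

theorem mirror_mirrorSymm (K' : GenEnd (SumTangent I (DualBundle V))) :
    mirror F (mirrorSymm F K') = K' := by
  funext x
  refine LinearMap.ext fun a => ?_
  simp only [mirror_apply, mirrorSymm_apply, LinearEquiv.apply_symm_apply]

theorem mirrorSymm_mirror (K : GenEnd (SumTangent I V)) : mirrorSymm F (mirror F K) = K := by
  funext x
  refine LinearMap.ext fun a => ?_
  simp only [mirror_apply, mirrorSymm_apply, LinearEquiv.symm_apply_apply]

theorem IsGenAlmostComplex.mirror (hK : IsGenAlmostComplex I (F × E) K) :
    IsGenAlmostComplex I ((F →L[ℝ] ℝ) × E) (mirror F K) where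
  smooth := contMDiff_totalSpace_of_apply (V₁ := GenBundle (SumTangent I (DualBundle V)))
    (V₂ := GenBundle (SumTangent I (DualBundle V))) (A := GenGeom.mirror F K) fun _ hW _ hs =>
    SmoothGenSectionOn.fibreShuffle hW
      (hK.smooth.comp_contMDiffOn (SmoothGenSectionOn.fibreShuffle_symm hW hs))
  orthogonal x a b := by
    rw [mirror_apply, mirror_apply, pairing_fibreShuffle, hK.orthogonal, ← pairing_fibreShuffle (F := F),
      LinearEquiv.apply_symm_apply, LinearEquiv.apply_symm_apply]
  sq_eq_neg_one x a := by
    rw [mirror_apply, mirror_apply, LinearEquiv.symm_apply_apply, hK.sq_eq_neg_one, map_neg,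
      LinearEquiv.apply_symm_apply]

theorem IsGenAlmostComplex.mirrorSymm (hK : IsGenAlmostComplex I ((F →L[ℝ] ℝ) × E) K') :
    IsGenAlmostComplex I (F × E) (mirrorSymm F K') where
  smooth := contMDiff_totalSpace_of_apply (V₁ := GenBundle (SumTangent I V))
    (V₂ := GenBundle (SumTangent I V)) (A := GenGeom.mirrorSymm F K') fun _ hW _ hs =>
    SmoothGenSectionOn.fibreShuffle_symm hW
      (hK.smooth.comp_contMDiffOn (SmoothGenSectionOn.fibreShuffle hW hs))
  orthogonal x a b := by
    rw [mirrorSymm_apply, mirrorSymm_apply, ← pairing_fibreShuffle (F := F),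
      LinearEquiv.apply_symm_apply, LinearEquiv.apply_symm_apply, hK.orthogonal,
      pairing_fibreShuffle]
  sq_eq_neg_one x a := by
    rw [mirrorSymm_apply, mirrorSymm_apply, LinearEquiv.apply_symm_apply]
    exact symm_conj_sq_eq_neg (A := SumTangent I V x) (B := SumTangent I (DualBundle V) x)
      (fibreShuffle F x) (hK.sq_eq_neg_one x) a

theorem fibreShuffle_mem_fibrePart (x : M) (a : GenBundle (SumTangent I V) x) :
    fibreShuffle F x a ∈ fibrePart (I := I) (DualBundle V) x ↔ a ∈ fibrePart V x := by
  refine and_congr Iff.rfl (forall_congr' fun u => ?_)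
  rw [fibreShuffle_snd]
  simp

theorem fibreShuffle_mem_basePart (x : M) (a : GenBundle (SumTangent I V) x) :
    fibreShuffle F x a ∈ basePart (I := I) (DualBundle V) x ↔ a ∈ basePart V x := by
  have : T2Space (V x) := FiberBundle.t2Space F V x
  have : FiniteDimensional ℝ (V x) := VectorBundle.finiteDimensional ℝ F V x
  have h1 : (fibreShuffle F x a).1.1 = 0 ↔ ∀ v : V x, a.2 (v, 0) = 0 := by
    rw [ContinuousLinearMap.ext_iff]
    exact Iff.rfl
  have h2 : (∀ ρ : DualBundle V x, (fibreShuffle F x a).2 (ρ, 0) = 0) ↔ a.1.1 = 0 := by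
    have h0 : a.2 (0, 0) = 0 := map_zero a.2
    simp only [fibreShuffle_snd, h0, add_zero]
    refine ⟨fun h => (evalMap_bijective (V x)).1 ?_, fun h ρ => by rw [h, map_zero]⟩
    rw [map_zero]
    exact ContinuousLinearMap.ext h
  exact (and_congr h1 h2).trans and_comm

theorem isAdapted_mirror_iff : IsAdapted (mirror F K) ↔ IsAdapted K := by
  refine forall_congr' fun x => ?_
  have h1 : fibrePart (I := I) (DualBundle V) x = fibreShuffle F x '' fibrePart V x := by
    rw [LinearEquiv.image_eq_preimage_symm]
    ext a
    rw [mem_preimage, ← fibreShuffle_mem_fibrePart (F := F) (V := V), LinearEquiv.apply_symm_apply]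
  have h2 : basePart (I := I) (DualBundle V) x = fibreShuffle F x '' basePart V x := by
    rw [LinearEquiv.image_eq_preimage_symm]
    ext a
    rw [mem_preimage, ← fibreShuffle_mem_basePart (F := F) (V := V), LinearEquiv.apply_symm_apply]
  have h3 : mirror F K x '' (fibreShuffle F x '' fibrePart V x)
      = fibreShuffle F x '' (K x '' fibrePart V x) := by
    rw [image_image, image_image]
    simp only [mirror_apply, LinearEquiv.symm_apply_apply]
  rw [h1, h2, h3]
  exact (fibreShuffle F x).injective.image_injective.eq_iff

variable [I.Boundaryless] [T2Space M] {cov : CovariantDerivative I F V}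

theorem fibreShuffle_baseTorsion (hflat : IsFlat cov) (hK : IsGenAlmostComplex I (F × E) K)
    {c c' : ∀ x, GenBundle (SumTangent I V) x} {U : Set M} (hU : IsOpen U)
    (hc : SmoothGenSectionOn I (F × E) c U) (hc' : SmoothGenSectionOn I (F × E) c' U)
    {x : M} (hx : x ∈ U) :
    fibreShuffle F x (baseTorsion cov K c c' x)
      = baseTorsion (dualConnection cov) (mirror F K) (fun y => fibreShuffle F y (c y))
          (fun y => fibreShuffle F y (c' y)) x := by
  have hKc : SmoothGenSectionOn I (F × E) (fun y => K y (c y)) U := hK.smooth.comp_contMDiffOn hc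
  have hKc' : SmoothGenSectionOn I (F × E) (fun y => K y (c' y)) U :=
    hK.smooth.comp_contMDiffOn hc'
  simp only [baseTorsion, map_sub, mirror_apply, LinearEquiv.symm_apply_apply]
  rw [← fibreShuffle_baseBracket hflat hU hc hc' hx, ← fibreShuffle_baseBracket hflat hU hKc hKc' hx,
    ← fibreShuffle_baseBracket hflat hU hc hKc' hx, ← fibreShuffle_baseBracket hflat hU hKc hc' hx,
    LinearEquiv.symm_apply_apply, LinearEquiv.symm_apply_apply]

theorem isIntegrable_lift_mirror_iff (hflat : IsFlat cov) (hK : IsGenAlmostComplex I (F × E) K) :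
    IsIntegrable (lift cov K) ↔ IsIntegrable (lift (dualConnection cov) (mirror F K)) := by
  rw [isIntegrable_lift_iff hflat hK,
    isIntegrable_lift_iff (V := DualBundle V) hflat.dualConnection hK.mirror]
  refine forall₂_congr fun U hU => ⟨fun h d d' hd hd' x hx => ?_, fun h c c' hc hc' x hx => ?_⟩
  · have h1 := fibreShuffle_baseTorsion hflat hK hU (hd.fibreShuffle_symm hU)
      (hd'.fibreShuffle_symm hU) hx
    simp only [LinearEquiv.apply_symm_apply] at h1
    rw [← h1, h _ _ (hd.fibreShuffle_symm hU) (hd'.fibreShuffle_symm hU) x hx, map_zero]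
  · apply (fibreShuffle F x).injective
    rw [fibreShuffle_baseTorsion hflat hK hU hc hc' hx, map_zero]
    exact h _ _ (hc.fibreShuffle hU) (hc'.fibreShuffle hU) x hx

theorem isSemiFlat_lift (hflat : IsFlat cov) (hK : IsGenAlmostComplex I (F × E) K)
    (hA : IsAdapted K) : IsSemiFlat cov (lift cov K) :=
  ⟨hflat, hK.lift hflat.smooth, K, hK, hA, rfl⟩

theorem isSemiFlat_lift_mirror (hflat : IsFlat cov) (hK : IsGenAlmostComplex I (F × E) K)
    (hA : IsAdapted K) :
    IsSemiFlat (dualConnection cov) (lift (dualConnection cov) (mirror F K)) :=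
  isSemiFlat_lift (V := DualBundle V) hflat.dualConnection hK.mirror (isAdapted_mirror_iff.2 hA)

end Mirror
end GenGeom

theorem mainTheorem2
    {E : Type*} [NormedAddCommGroup E] [NormedSpace ℝ E] [FiniteDimensional ℝ E]
    {M : Type*} [TopologicalSpace M] [T2Space M] [SecondCountableTopology M]
    [ChartedSpace E M] [IsManifold 𝓘(ℝ, E) ∞ M]
    {F : Type*} [NormedAddCommGroup F] [NormedSpace ℝ F] [FiniteDimensional ℝ F]
    {V : M → Type*} [∀ x, AddCommGroup (V x)] [∀ x, Module ℝ (V x)]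
    [TopologicalSpace (TotalSpace F V)] [∀ x, TopologicalSpace (V x)]
    [∀ x, IsTopologicalAddGroup (V x)] [∀ x, ContinuousSMul ℝ (V x)]
    [FiberBundle F V] [VectorBundle ℝ F V] [ContMDiffVectorBundle ∞ F V 𝓘(ℝ, E)]
    (hrank : Module.finrank ℝ F = Module.finrank ℝ E)
    (cov : CovariantDerivative 𝓘(ℝ, E) F V) (hflat : GenGeom.IsFlat cov) :
    (∀ K : GenGeom.GenEnd (GenGeom.SumTangent 𝓘(ℝ, E) V),
      GenGeom.IsGenAlmostComplex 𝓘(ℝ, E) (F × E) K → GenGeom.IsAdapted K →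
        GenGeom.IsSemiFlat cov (GenGeom.lift cov K) ∧
        GenGeom.IsSemiFlat (GenGeom.dualConnection cov)
          (GenGeom.lift (GenGeom.dualConnection cov) (GenGeom.mirror F K)) ∧
        (GenGeom.IsIntegrable (GenGeom.lift cov K) ↔
          GenGeom.IsIntegrable
            (GenGeom.lift (GenGeom.dualConnection cov) (GenGeom.mirror F K)))) ∧
    ∃ Φ : {J : GenGeom.GenEnd (GenGeom.TotTangent 𝓘(ℝ, E) F V) //
          GenGeom.IsSemiFlat cov J ∧ GenGeom.IsGenComplex J} ≃
        {J : GenGeom.GenEnd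
            (GenGeom.TotTangent 𝓘(ℝ, E) (F →L[ℝ] ℝ) (GenGeom.DualBundle V)) //
          GenGeom.IsSemiFlat (GenGeom.dualConnection cov) J ∧ GenGeom.IsGenComplex J},
      ∀ J K, J.1 = GenGeom.lift cov K →
        (Φ J).1 = GenGeom.lift (GenGeom.dualConnection cov) (GenGeom.mirror F K) := by
  refine ⟨fun K hK hA => ⟨GenGeom.isSemiFlat_lift hflat hK hA,
    GenGeom.isSemiFlat_lift_mirror hflat hK hA, GenGeom.isIntegrable_lift_mirror_iff hflat hK⟩, ?_⟩
  choose k hk hkA hkJ using fun J : {J : GenGeom.GenEnd (GenGeom.TotTangent 𝓘(ℝ, E) F V) //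
    GenGeom.IsSemiFlat cov J ∧ GenGeom.IsGenComplex J} => J.2.1.lifted
  let φ : {J : GenGeom.GenEnd (GenGeom.TotTangent 𝓘(ℝ, E) F V) //
        GenGeom.IsSemiFlat cov J ∧ GenGeom.IsGenComplex J} →
      {J : GenGeom.GenEnd (GenGeom.TotTangent 𝓘(ℝ, E) (F →L[ℝ] ℝ) (GenGeom.DualBundle V)) //
        GenGeom.IsSemiFlat (GenGeom.dualConnection cov) J ∧ GenGeom.IsGenComplex J} := fun J =>
    ⟨GenGeom.lift (GenGeom.dualConnection cov) (GenGeom.mirror F (k J)),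
      GenGeom.isSemiFlat_lift_mirror hflat (hk J) (hkA J),
      (GenGeom.isSemiFlat_lift_mirror hflat (hk J) (hkA J)).almost,
      (GenGeom.isIntegrable_lift_mirror_iff hflat (hk J)).1 (hkJ J ▸ J.2.2.integrable)⟩
  have hφ (J) (K) (h : J.1 = GenGeom.lift cov K) :
      (φ J).1 = GenGeom.lift (GenGeom.dualConnection cov) (GenGeom.mirror F K) := by
    rw [← GenGeom.lift_injective ((hkJ J).symm.trans h)]
  refine ⟨Equiv.ofBijective φ ⟨fun J J' h => ?_, fun J' => ?_⟩, hφ⟩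
  · have h1 := GenGeom.lift_injective (V := GenGeom.DualBundle V) (congrArg Subtype.val h)
    have h2 : k J = k J' := by
      rw [← GenGeom.mirrorSymm_mirror (F := F) (k J), h1, GenGeom.mirrorSymm_mirror]
    exact Subtype.ext ((hkJ J).trans ((congrArg _ h2).trans (hkJ J').symm))
  · obtain ⟨J', hJ', hJc⟩ := J'
    obtain ⟨K', hK', hA', rfl⟩ := hJ'.lifted
    have hK := hK'.mirrorSymm
    have hm := GenGeom.mirror_mirrorSymm (F := F) K'
    have hA : GenGeom.IsAdapted (GenGeom.mirrorSymm F K') :=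
      GenGeom.isAdapted_mirror_iff.1 (hm.symm ▸ hA')
    have hint : GenGeom.IsIntegrable (GenGeom.lift cov (GenGeom.mirrorSymm F K')) :=
      (GenGeom.isIntegrable_lift_mirror_iff hflat hK).2 (hm.symm ▸ hJc.integrable)
    have hs := GenGeom.isSemiFlat_lift hflat hK hA
    refine ⟨⟨_, hs, hs.almost, hint⟩, Subtype.ext ?_⟩
    rw [hφ _ _ rfl, hm]
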